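/- Let $k$ be a field of characteristic zero, $V=\bigoplus_{d\in\mathbb Z}V_d$ a $\mathbb Z$-graded $k$-vector space, $TV=\bigoplus_{n\ge 1}V^{\otimes n}$, $C_\bullet(V)=TV$ and $C^\bullet(V)=\mathrm{Hom}(TV,V)$. Let $t_1,\dots,t_n$ be formal parameters of even degrees. All operations below are given for homogeneous arguments, and are extended linearly (through even and odd parts) and $k[[t_1,\dots,t_n]]$-bilinearly. Write $(a_0,\dots,a_r)=a_0\otimes\cdots\otimes a_r$. For cochains put $$(A\circ B)(a_1,a_2,\dots)=\sum_i(-1)^{|B|(|a_1|+\cdots+|a_i|)}A(a_1,\dots,a_i,B(a_{i+1},\dots),\dots),\qquad [A,B]=A\circ B-(-1)^{|A||B|}B\circ A,$$ $$M\{A,B\}(a_1,a_2,\dots)=\sum_{i\le j}(-1)^{|A|(|a_1|+\cdots+|a_i|)+|B|(|a_1|+\cdots+|a_j|)}M(a_1,\dots,a_i,A(a_{i+1},\dots),\dots,a_j,B(a_{j+1},\dots),\dots),$$ where the arguments of $A$ precede those of $B$. Let $m\in C^\bullet(V)[[t_1,\dots,t_n]]$ be a family of $A_\infty$-structures, i.e.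 $|m|=1$ (total degree) and $m\circ m=0$. Put $\delta A=[m,A]$, $A\cup B=(-1)^{|A|-1}m\{A,B\}$, and write $x_{(j)}=\partial x/\partial t_j$. For a cochain $A$ define the operators on $C_\bullet(V)[[t_1,\dots,t_n]]$ $$L_A(a_0,\dots,a_r)=\sum_{j}(-1)^{|A|(|a_0|+\cdots+|a_j|)}(a_0,\dots,a_j,A(a_{j+1},\dots),\dots,a_r)$$ $$+\sum_{j,i}(-1)^{(|a_0|+\cdots+|a_j|)(|a_{j+1}|+\cdots+|a_r|)}(A(a_{j+1},\dots,a_r,a_0,\dots,a_i),a_{i+1},\dots,a_j),$$ $$i_A(a_0,\dots,a_r)=\sum_{j,l,i}(-1)^{(|a_0|+\cdots+|a_j|)(|a_{j+1}|+\cdots+|a_r|)+|A|(|a_{j+1}|+\cdots+|a_l|)}(m(a_{j+1},\dots,a_l,A(a_{l+1},\dots),\dots,a_r,a_0,\dots,a_i),a_{i+1},\dots,a_j),$$ where in the second sum of $L_A$ the element $a_0$ is an argument of $A$ ($0\le i\le j\le r$), and in $i_A$ the arguments of $A$ are nonempty in number, lie among $a_{j+1},\dots,a_r$, and $a_0$ is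 an argument of $m$. Let $HH_\bullet(V,m)$ be the homology of $C_\bullet(V)[[t_1,\dots,t_n]]$ with respect to the differential $\partial=L_m$. Let $$\Psi=\sum_{l=1}^{N}\sum_{j_1,\dots,j_l}c^{j_1\cdots j_l}\,m_{(j_1)}\cup(m_{(j_2)}\cup(\cdots\cup m_{(j_l)})),\qquad c^{j_1\cdots j_l}\in k[[t_1,\dots,t_n]]\ \text{ symmetric in the indices},$$ be a cup polynomial in the derivatives $m_{(j)}$, and put $$V^j=\sum_{l=1}^{N}l\sum_{j_1,\dots,j_{l-1}}c^{j_1\cdots j_{l-1}j}\,i_{m_{(j_1)}}\cdots i_{m_{(j_{l-1})}}.$$ Theorem. (1) There is $W\in\mathrm{End}(C_\bullet(V))[[t_1,\dots,t_n]]$, even (preserving degrees modulo 2), such that $$L_\Psi=[L_m,W]+\sum_{j=1}^nV^jL_{m_{(j)}}.\qquad(*)$$ (2) Let $W$ be any even element of $\mathrm{End}(C_\bullet(V))[[t_1,\dots,t_n]]$ that satisfies $(*)$. Suppose that $\Psi$ is $\delta$-exact, $\Psi=\delta U$ with $U\in C^\bullet(V)[[t_1,\dots,t_n]]$, so that $[\Psi]=0$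 is a relation in $\delta$-cohomology. Then for every cycle $\alpha$ the chain $W\alpha-L_U\alpha-\sum_{j}V^j\alpha_{(j)}$ is a cycle, and $$h_\Psi[\alpha]=\Big[W\alpha-L_U\alpha-\sum_{j=1}^nV^j\alpha_{(j)}\Big]$$ is a well-defined $k$-linear endomorphism $h_\Psi$ of $HH_\bullet(V,m)$. -/

import Mathlib

open scoped TensorProduct

noncomputable section

namespace AInfinity

/-! ### Tensor words, chains and cochains

`V` is a `ℤ`-graded vector space with homogeneous components `𝒱 d`.  `T V` is the full tensor
algebra of `V`, whose elements are combinations of words `a₁ ⋯ aₙ`, `n ≥ 0`.  The reduced tensor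
algebra `⨁_{n ≥ 1} V^{⊗ n}` is `V ⊗ T V`, the chain `a₀ ⊗ a₁ ⊗ ⋯ ⊗ aₙ` being
`a₀ ⊗ₜ (a₁ ⋯ aₙ)`. -/

section Words

variable (k V : Type*) [Field k] [AddCommGroup V] [Module k V]

/-- The full tensor algebra of `V`. -/
abbrev T : Type _ := TensorAlgebra k V

/-- The space of (Hochschild) chains, that is, the reduced tensor algebra of `V`. -/
abbrev Chain : Type _ := V ⊗[k] T k V

/-- The space of cochains: all homomorphisms from the reduced tensor algebra of `V` to `V`. -/
abbrev Cochain : Type _ := Chain k V →ₗ[k] V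

/-- The action of letters behind `deconc`. -/
def deconcStep : V →ₗ[k] Module.End k (T k V × (T k V ⊗[k] T k V)) where
  toFun a :=
    LinearMap.prod (LinearMap.mulLeft k (TensorAlgebra.ι k a) ∘ₗ LinearMap.fst k _ _)
      (TensorProduct.mk k (T k V) (T k V) 1 ∘ₗ LinearMap.mulLeft k (TensorAlgebra.ι k a) ∘ₗ
          LinearMap.fst k _ _ +
        LinearMap.rTensor (T k V) (LinearMap.mulLeft k (TensorAlgebra.ι k a)) ∘ₗ
          LinearMap.snd k _ _)
  map_add' a b := by
    ext <;> simp [add_mul, TensorProduct.add_tmul, TensorProduct.tmul_add]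
  map_smul' r a := by
    ext <;> simp [TensorProduct.smul_tmul']

theorem deconcStep_apply (a : V) (x : T k V × (T k V ⊗[k] T k V)) :
    deconcStep k V a x = (TensorAlgebra.ι k a * x.1,
      1 ⊗ₜ (TensorAlgebra.ι k a * x.1) +
        LinearMap.rTensor (T k V) (LinearMap.mulLeft k (TensorAlgebra.ι k a)) x.2) := rfl

/-- Deconcatenation `a₁ ⋯ aₙ ↦ ∑_{i = 0}^{n} (a₁ ⋯ aᵢ) ⊗ (aᵢ₊₁ ⋯ aₙ)`; it is determined by
`deconc_one` and `deconc_ι_mul` below. -/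
def deconc : T k V →ₗ[k] T k V ⊗[k] T k V :=
  LinearMap.snd k _ _ ∘ₗ
    LinearMap.applyₗ ((1 : T k V), (1 : T k V) ⊗ₜ[k] (1 : T k V)) ∘ₗ
      (TensorAlgebra.lift k (deconcStep k V)).toLinearMap

/-- The action of letters behind `uncons`. -/
def unconsStep : V →ₗ[k] Module.End k (T k V × Chain k V) where
  toFun a :=
    LinearMap.prod (LinearMap.mulLeft k (TensorAlgebra.ι k a) ∘ₗ LinearMap.fst k _ _)
      (TensorProduct.mk k V (T k V) a ∘ₗ LinearMap.fst k _ _)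
  map_add' a b := by
    ext <;> simp [add_mul]
  map_smul' r a := by
    ext <;> simp [TensorProduct.smul_tmul']

theorem unconsStep_apply (a : V) (x : T k V × Chain k V) :
    unconsStep k V a x = (TensorAlgebra.ι k a * x.1, a ⊗ₜ x.1) := rfl

/-- The projection of the full tensor algebra onto the reduced one,
`a₀ a₁ ⋯ aₙ ↦ a₀ ⊗ (a₁ ⋯ aₙ)` and `1 ↦ 0`; see `uncons_one` and `uncons_ι_mul` below. -/
def uncons : T k V →ₗ[k] Chain k V :=
  LinearMap.snd k _ _ ∘ₗ LinearMap.applyₗ ((1 : T k V), (0 : Chain k V)) ∘ₗ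
    (TensorAlgebra.lift k (unconsStep k V)).toLinearMap

/-- The inclusion of the reduced tensor algebra into the full one,
`a₀ ⊗ (a₁ ⋯ aₙ) ↦ a₀ a₁ ⋯ aₙ`. -/
def cons : Chain k V →ₗ[k] T k V :=
  LinearMap.mul' k (T k V) ∘ₗ LinearMap.rTensor (T k V) (TensorAlgebra.ι k)

variable {k V}

theorem lift_deconcStep_fst (w : T k V) (x : T k V × (T k V ⊗[k] T k V)) :
    (TensorAlgebra.lift k (deconcStep k V) w x).1 = w * x.1 := by
  induction w using TensorAlgebra.induction generalizing x with
  | algebraMap r => simp [Module.algebraMap_end_apply, Algebra.smul_def]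
  | ι a => simp [deconcStep_apply]
  | mul a b ha hb => simp [ha, hb, mul_assoc]
  | add a b ha hb => simp [ha, hb, add_mul]

theorem deconc_one : deconc k V 1 = 1 ⊗ₜ 1 := by
  simp [deconc]

theorem deconc_ι_mul (a : V) (w : T k V) :
    deconc k V (TensorAlgebra.ι k a * w) = 1 ⊗ₜ (TensorAlgebra.ι k a * w) +
      LinearMap.rTensor (T k V) (LinearMap.mulLeft k (TensorAlgebra.ι k a)) (deconc k V w) := by
  have h := lift_deconcStep_fst w ((1 : T k V), (1 : T k V) ⊗ₜ[k] (1 : T k V))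
  simp only [mul_one] at h
  simp [deconc, deconcStep_apply, h]

theorem lift_unconsStep_fst (w : T k V) (x : T k V × Chain k V) :
    (TensorAlgebra.lift k (unconsStep k V) w x).1 = w * x.1 := by
  induction w using TensorAlgebra.induction generalizing x with
  | algebraMap r => simp [Module.algebraMap_end_apply, Algebra.smul_def]
  | ι a => simp [unconsStep_apply]
  | mul a b ha hb => simp [ha, hb, mul_assoc]
  | add a b ha hb => simp [ha, hb, add_mul]

theorem uncons_one : uncons k V 1 = 0 := by
  simp [uncons]

theorem uncons_ι_mul (a : V) (w : T k V) :
    uncons k V (TensorAlgebra.ι k a * w) = a ⊗ₜ w := by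
  have h := lift_unconsStep_fst w ((1 : T k V), (0 : Chain k V))
  simp only [mul_one] at h
  simp [uncons, unconsStep_apply, h]

end Words

/-! ### Koszul signs

All signs depend on degrees modulo `2` only.  They are written through the grading involutions
`a ↦ (-1)^{|a|} a`, and operations on non-homogeneous arguments are defined by splitting the
arguments into their even and odd parts. -/

section Signs

variable {k V : Type*} [Field k] [AddCommGroup V] [Module k V]
variable (𝒱 : ℤ → Submodule k V) [DirectSum.Decomposition 𝒱]

/-- The grading involution `a ↦ (-1)^{|a|} a` of `V`. -/
def invV : Module.End k V :=
  DirectSum.toModule k ℤ V (fun d => ((-1 : k) ^ d) • (𝒱 d).subtype) ∘ₗ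
    (DirectSum.decomposeLinearEquiv 𝒱).toLinearMap

theorem invV_of_mem {d : ℤ} {a : V} (ha : a ∈ 𝒱 d) : invV 𝒱 a = ((-1 : k) ^ d) • a := by
  simp only [invV, LinearMap.comp_apply, LinearEquiv.coe_coe,
    DirectSum.decomposeLinearEquiv_apply]
  rw [DirectSum.decompose_of_mem 𝒱 ha, ← DirectSum.lof_eq_of k, DirectSum.toModule_lof]
  simp

/-- The grading involution of the tensor algebra,
`a₁ ⋯ aₙ ↦ (-1)^{|a₁| + ⋯ + |aₙ|} a₁ ⋯ aₙ`. -/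
def invT : Module.End k (T k V) :=
  (TensorAlgebra.lift k (TensorAlgebra.ι k ∘ₗ invV 𝒱)).toLinearMap

/-- The grading involution of the space of chains. -/
def invChain : Module.End k (Chain k V) :=
  TensorProduct.map (invV 𝒱) (invT 𝒱)

/-- The projection onto the even part (`p = 0`) or the odd part (`p = 1`) of a space with grading
involution `σ`. -/
def parityProj {M : Type*} [AddCommGroup M] [Module k M] (σ : Module.End k M) (p : Fin 2) :
    Module.End k M :=
  (2⁻¹ : k) • (1 + ((-1 : k) ^ (p : ℕ)) • σ)

/-- The component of parity `p` of a cochain: the even part `p = 0` preserves parity of degrees,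
and the odd part `p = 1` reverses it. -/
def part (p : Fin 2) (A : Cochain k V) : Cochain k V :=
  (2⁻¹ : k) • (A + ((-1 : k) ^ (p : ℕ)) • (invV 𝒱 ∘ₗ A ∘ₗ invChain 𝒱))

/-- The flip `x ⊗ y ↦ (-1)^{|x||y|} y ⊗ x`, for spaces with grading involutions `σ` and `ρ`. -/
def koszulFlip {M N : Type*} [AddCommGroup M] [Module k M] [AddCommGroup N] [Module k N]
    (σ : Module.End k M) (ρ : Module.End k N) : M ⊗[k] N →ₗ[k] N ⊗[k] M :=
  ∑ p : Fin 2, TensorProduct.map (ρ ^ (p : ℕ)) (parityProj σ p) ∘ₗ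
    (TensorProduct.comm k M N).toLinearMap

/-- `A` is homogeneous of degree `d`:
`|A (a₀, …, aₙ)| = |a₀| + ⋯ + |aₙ| + d` for all homogeneous `a₀, …, aₙ`. -/
def IsHomogeneousOfDegree (A : Cochain k V) (d : ℤ) : Prop :=
  ∀ (e₀ : ℤ) (a₀ : 𝒱 e₀) (w : List (Σ e : ℤ, 𝒱 e)),
    A ((a₀ : V) ⊗ₜ[k] (w.map fun b => TensorAlgebra.ι k (b.2 : V)).prod) ∈
      𝒱 (e₀ + (w.map fun b => b.1).sum + d)

end Signs

/-! ### Operations on cochains and chains -/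

section Operations

variable {k V : Type*} [Field k] [AddCommGroup V] [Module k V]
variable (𝒱 : ℤ → Submodule k V) [DirectSum.Decomposition 𝒱]

/-- A cochain as a map on the full tensor algebra, equal to `0` on the empty word. -/
def ext0 (A : Cochain k V) : T k V →ₗ[k] V := A ∘ₗ uncons k V

/-- `insertAfter φ A` sends a word to `∑ φ(u) A(x) y`, the sum being over all its factorizations
`u x y` with `x ≠ 1`. -/
def insertAfter (φ : Module.End k (T k V)) (A : Cochain k V) : Module.End k (T k V) :=
  LinearMap.mul' k (T k V) ∘ₗ LinearMap.lTensor (T k V) (LinearMap.mul' k (T k V)) ∘ₗ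
    TensorProduct.map φ
      (TensorProduct.map (TensorAlgebra.ι k ∘ₗ ext0 A) (LinearMap.id : T k V →ₗ[k] T k V)) ∘ₗ
    LinearMap.lTensor (T k V) (deconc k V) ∘ₗ deconc k V

/-- The coderivation of the tensor coalgebra induced by `A`: for homogeneous `A` it sends a word to
`∑ (-1)^{|A||u|} u A(x) y` over all factorizations `u x y` of the word, `x ≠ 1`. -/
def coder (A : Cochain k V) : Module.End k (T k V) :=
  ∑ p : Fin 2, insertAfter (invT 𝒱 ^ (p : ℕ)) (part 𝒱 p A)

/-- For homogeneous `A` and `B`, a word is sent to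
`∑ (-1)^{|A||u| + |B|(|u| + |x| + |v|)} u A(x) v B(y) z` over all factorizations `u x v y z` of the
word with `x, y ≠ 1`. -/
def coder₂ (A B : Cochain k V) : Module.End k (T k V) :=
  ∑ p : Fin 2, insertAfter (coder 𝒱 A ∘ₗ invT 𝒱 ^ (p : ℕ)) (part 𝒱 p B)

/-- The composition product
`(A ∘ B)(a₁, …) = ∑ (-1)^{|B|(|a₁| + ⋯ + |aᵢ|)} A(a₁, …, aᵢ, B(aᵢ₊₁, …), …)`. -/
def circ (A B : Cochain k V) : Cochain k V := ext0 A ∘ₗ coder 𝒱 B ∘ₗ cons k V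

/-- The Gerstenhaber bracket `[A, B] = A ∘ B - (-1)^{|A||B|} B ∘ A`. -/
def bracket (A B : Cochain k V) : Cochain k V :=
  circ 𝒱 A B - ∑ p : Fin 2, ∑ q : Fin 2,
    ((-1 : k) ^ ((p : ℕ) * (q : ℕ))) • circ 𝒱 (part 𝒱 q B) (part 𝒱 p A)

/-- The brace `M{A, B}`. -/
def brace₂ (M A B : Cochain k V) : Cochain k V := ext0 M ∘ₗ coder₂ 𝒱 A B ∘ₗ cons k V

/-- The cup product `A ∪ B = (-1)^{|A| - 1} m{A, B}`, with `m` as first argument. -/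
def cup (m A B : Cochain k V) : Cochain k V :=
  ∑ p : Fin 2, ((-1 : k) ^ ((p : ℕ) + 1)) • brace₂ 𝒱 m (part 𝒱 p A) B

/-- Cyclic rotations of a chain:
`(a₀, …, aₙ) ↦ ∑_{j = 0}^{n} (-1)^{(|a₀| + ⋯ + |aⱼ|)(|aⱼ₊₁| + ⋯ + |aₙ|)}
(aⱼ₊₁ ⋯ aₙ) ⊗ (a₀, …, aⱼ)`. -/
def rot : Chain k V →ₗ[k] T k V ⊗[k] Chain k V :=
  koszulFlip (invChain 𝒱) (invT 𝒱) ∘ₗ (TensorProduct.assoc k V (T k V) (T k V)).symm.toLinearMap ∘ₗ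
    LinearMap.lTensor V (deconc k V)

/-- `v ⊗ (a₀, …, aⱼ) ↦ ∑_{i = 0}^{j} (v a₀ a₁ ⋯ aᵢ) ⊗ (aᵢ₊₁ ⋯ aⱼ)`. -/
def wrap : T k V ⊗[k] Chain k V →ₗ[k] T k V ⊗[k] T k V :=
  LinearMap.rTensor (T k V)
      (LinearMap.mul' k (T k V) ∘ₗ LinearMap.lTensor (T k V) (cons k V)) ∘ₗ
    (TensorProduct.assoc k (T k V) (Chain k V) (T k V)).symm.toLinearMap ∘ₗ
    LinearMap.lTensor (T k V) ((TensorProduct.assoc k V (T k V) (T k V)).symm.toLinearMap ∘ₗ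
      LinearMap.lTensor V (deconc k V))

/-- The Lie derivative along a cochain.  For homogeneous `A`, `L_A (a₀, …, aₙ)` is
`∑ (-1)^{|A|(|a₀| + ⋯ + |aⱼ|)} (a₀, …, aⱼ, A(aⱼ₊₁, …), …, aₙ)` plus
`∑ (-1)^{(|a₀| + ⋯ + |aⱼ|)(|aⱼ₊₁| + ⋯ + |aₙ|)} (A(aⱼ₊₁, …, aₙ, a₀, …, aᵢ), aᵢ₊₁, …, aⱼ)`. -/
def lie (A : Cochain k V) : Module.End k (Chain k V) :=
  (∑ p : Fin 2, TensorProduct.map (invV 𝒱 ^ (p : ℕ)) (coder 𝒱 (part 𝒱 p A))) +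
    LinearMap.rTensor (T k V) (ext0 A) ∘ₗ wrap ∘ₗ rot 𝒱

/-- The contraction `i_A` with a cochain, with `m` as first argument.  For homogeneous `A`,
`i_A (a₀, …, aₙ)` is the sum of
`± (m(aⱼ₊₁, …, A(a_{l+1}, …), …, aₙ, a₀, …, aᵢ), aᵢ₊₁, …, aⱼ)`, where `A` does not touch `a₀`, with
the Koszul sign of exponent
`(|a₀| + ⋯ + |aⱼ|)(|aⱼ₊₁| + ⋯ + |aₙ|) + |A|(|aⱼ₊₁| + ⋯ + |a_l|)`. -/
def contr (m A : Cochain k V) : Module.End k (Chain k V) :=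
  LinearMap.rTensor (T k V) (ext0 m) ∘ₗ wrap ∘ₗ LinearMap.rTensor (Chain k V) (coder 𝒱 A) ∘ₗ rot 𝒱

end Operations

/-! ### Formal power series in the parameters `t₁, …, tₙ` -/

section FormalSeries

/-- `M[[t₁, …, tₙ]]`: the series `∑ fₑ tᵉ` is the family of its coefficients.  As all parameters
have even degree, they commute with everything without signs. -/
abbrev Series (n : ℕ) (M : Type*) : Type _ := (Fin n →₀ ℕ) → M

variable {k M N P : Type*} [Field k] {n : ℕ}
variable [AddCommGroup M] [Module k M] [AddCommGroup P]

/-- The partial derivative with respect to `tⱼ`. -/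
def pderiv (j : Fin n) (f : Series n M) : Series n M :=
  fun e => (e j + 1) • f (e + Finsupp.single j 1)

/-- The extension of a biadditive operation to power series. -/
def convol (op : N → M → P) (f : Series n N) (g : Series n M) : Series n P :=
  fun e => ∑ p ∈ Finset.HasAntidiagonal.antidiagonal e, op (f p.1) (g p.2)

/-- A power series of endomorphisms of `M`, as an endomorphism of `M[[t₁, …, tₙ]]`. -/
def act (X : Series n (Module.End k M)) : Module.End k (Series n M) where
  toFun := convol (fun F x => F x) X
  map_add' f g := by
    funext e
    simp [convol, Finset.sum_add_distrib]
  map_smul' r f := by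
    funext e
    simp [convol, Finset.smul_sum]

/-- Multiplication of `M[[t₁, …, tₙ]]` by a scalar power series. -/
def scal (c : MvPowerSeries (Fin n) k) : Module.End k (Series n M) :=
  act fun e => MvPowerSeries.coeff e c • (1 : Module.End k M)

end FormalSeries

/-! ### Families of `A_∞`-algebras -/

section Families

variable {k V : Type*} [Field k] [AddCommGroup V] [Module k V]
variable (𝒱 : ℤ → Submodule k V) [DirectSum.Decomposition 𝒱] {n : ℕ}

/-- `m ∈ C^•(V)[[t₁, …, tₙ]]` is a family of `A_∞`-structures: it has total degree `1`, where `tᵢ`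
has degree `τ i`, and `m ∘ m = 0`. -/
structure IsFamily (τ : Fin n → ℤ) (m : Series n (Cochain k V)) : Prop where
  degree : ∀ e : Fin n →₀ ℕ, IsHomogeneousOfDegree 𝒱 (m e) (1 - ∑ i, (e i : ℤ) * τ i)
  maurerCartan : convol (circ 𝒱) m m = 0

/-- The differential `δ A = [m, A]` on `C^•(V)[[t₁, …, tₙ]]`. -/
def delta (m A : Series n (Cochain k V)) : Series n (Cochain k V) := convol (bracket 𝒱) m A

/-- The cup product of `C^•(V)[[t₁, …, tₙ]]` defined by `m`. -/
def cupSeries (m A B : Series n (Cochain k V)) : Series n (Cochain k V) :=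
  convol (fun F b => F b) (convol (fun μ a => fun b => cup 𝒱 μ a b) m A) B

/-- The iterated cup product `A₁ ∪ (A₂ ∪ (⋯ ∪ Aₗ))` of a nonempty list. -/
def cupList (m : Series n (Cochain k V)) :
    List (Series n (Cochain k V)) → Series n (Cochain k V)
  | [] => 0
  | [A] => A
  | A :: B :: l => cupSeries 𝒱 m A (cupList m (B :: l))

/-- The Lie derivative `L_A` on `C_•(V)[[t₁, …, tₙ]]`. -/
def lieSeries (A : Series n (Cochain k V)) : Module.End k (Series n (Chain k V)) :=
  act fun e => lie 𝒱 (A e)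

/-- The contraction `i_A` on `C_•(V)[[t₁, …, tₙ]]` defined by `m`. -/
def contrSeries (m A : Series n (Cochain k V)) : Module.End k (Series n (Chain k V)) :=
  act (convol (contr 𝒱) m A)

/-- The Hochschild homology of `(V, m)`: cycles modulo boundaries for `∂ = L_m` on
`C_•(V)[[t₁, …, tₙ]]`. -/
abbrev HH (m : Series n (Cochain k V)) : Type _ :=
  LinearMap.ker (lieSeries 𝒱 m) ⧸
    (LinearMap.range (lieSeries 𝒱 m)).submoduleOf (LinearMap.ker (lieSeries 𝒱 m))

/-- The cup polynomial
`Ψ = ∑_{l = 1}^{N} ∑_{j₁, …, jₗ} c^{j₁ ⋯ jₗ} m_(j₁) ∪ ⋯ ∪ m_(jₗ)`.  The coefficients of the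
monomials of length `l + 1` are `c l`. -/
def cupPoly (m : Series n (Cochain k V)) (N : ℕ)
    (c : (l : ℕ) → (Fin (l + 1) → Fin n) → MvPowerSeries (Fin n) k) : Series n (Cochain k V) :=
  ∑ l ∈ Finset.range N, ∑ J : Fin (l + 1) → Fin n,
    scal (c l J) (cupList 𝒱 m (List.ofFn fun r => pderiv (J r) m))

/-- The operator `Vʲ = ∑_{l = 1}^{N} l ∑ c^{j₁ ⋯ jₗ₋₁ j} i_{m_(j₁)} ⋯ i_{m_(jₗ₋₁)}`. -/
def opV (m : Series n (Cochain k V)) (N : ℕ)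
    (c : (l : ℕ) → (Fin (l + 1) → Fin n) → MvPowerSeries (Fin n) k) (j : Fin n) :
    Module.End k (Series n (Chain k V)) :=
  ∑ l ∈ Finset.range N, (l + 1) • ∑ J : Fin l → Fin n,
    scal (c l (Fin.snoc J j)) *
      (List.ofFn fun r => contrSeries 𝒱 m (pderiv (J r) m)).prod

/-- `W`, a power series of endomorphisms of `C_•(V)` that preserve the parity of degrees, satisfies
`L_Ψ = [L_m, W] + ∑ⱼ Vʲ L_{m_(j)}`. -/
structure IsHomotopy (m : Series n (Cochain k V)) (N : ℕ)
    (c : (l : ℕ) → (Fin (l + 1) → Fin n) → MvPowerSeries (Fin n) k)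
    (W : Series n (Module.End k (Chain k V))) : Prop where
  even : ∀ e, W e * invChain 𝒱 = invChain 𝒱 * W e
  eq : lieSeries 𝒱 (cupPoly 𝒱 m N c) =
    (lieSeries 𝒱 m * act W - act W * lieSeries 𝒱 m) +
      ∑ j, opV 𝒱 m N c j * lieSeries 𝒱 (pderiv j m)

/-- The chain `W α - L_U α - ∑ⱼ Vʲ α_(j)`. -/
def hChain (m : Series n (Cochain k V)) (N : ℕ)
    (c : (l : ℕ) → (Fin (l + 1) → Fin n) → MvPowerSeries (Fin n) k)
    (W : Series n (Module.End k (Chain k V))) (U : Series n (Cochain k V))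
    (α : Series n (Chain k V)) : Series n (Chain k V) :=
  act W α - lieSeries 𝒱 U α - ∑ j, opV 𝒱 m N c j (pderiv j α)

end Families

end AInfinity

end

noncomputable section

namespace AInfinity

/-! ### Sums over factorizations of a list -/

section SplitSum

variable {α X Y : Type*} [AddCommMonoid X] [AddCommMonoid Y]

/-! The theorem rests on a Cartan calculus up to homotopy. Write `~` for equality up to a graded
commutator with `L_m`. For odd `δ`-cocycles `A`, `B`, both `L_A` and `i_A` supercommute with `L_m`,
moreover `i_A i_B ~ i_{A ∪ B}` and `L_{A ∪ B} ~ L_A i_B + i_A L_B`; see `serLie_anticomm`,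
`serLie_comm_serContr`, `exists_serContr_cup`, `exists_serLie_cup`. Differentiating `m ∘ m = 0`
shows that the `m_(j)` are odd cocycles, and differentiating `[L_m, i_A] = 0` shows that `L_{m_(j)}`
commutes with `i_A` up to homotopy. By induction on the number of factors, `L` of an iterated cup
product is homotopic to the sum, over the factors, of the product of the other contractions times
`L` of the chosen factor. The symmetry of `c` makes all positions contribute equally, whence the
factor `l` in `V^j`. Averaging over the grading involution makes `W` even.

For the second claim, `[∂/∂t_j, L_m] = L_{m_(j)}` and `V^j` commutes with `L_m`. Hence, for even
`U`, the commutator of `L_m` with `W - L_U - ∑ V^j ∂/∂t_j` is `[L_m, W] - L_{δU} + ∑ V^j L_{m_(j)}`,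
which is zero by `(*)`. The odd part of `U` is a cocycle because `Ψ` is odd, so its Lie derivative
anticommutes with `L_m` and also acts on homology.

The calculus is proved on words `u a w` with a marked letter. The injection `rot` sends a chain to
the sum of all ways to cut it open as a cyclic word, with `a₀` marked. It intertwines `L_A` and
`i_A` with operators built from insertions to the left of the mark, to its right and around it, and
these are governed by how they interact with deconcatenation. For a cocycle `A`, the contraction
becomes the commutator of `L_m` with insertion of `A` to the left of the mark. This insertion need
not preserve the image of `rot`, so `i_A` is closed without having to be exact on chains.

The identities are first proved for single cochains, with error terms in the brackets `[m, A]`. They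
pass to power series by convolution, which is where `m ∘ m = 0` and `δA = 0` become available. -/

/-- `splitSum F l` is the sum of `F x y` over all factorizations `l = x ++ y`. -/
def splitSum : (List α → List α → X) → List α → X
  | F, [] => F [] []
  | F, a :: l => F [] (a :: l) + splitSum (fun x y => F (a :: x) y) l

theorem splitSum_congr {F G : List α → List α → X} {l : List α}
    (h : ∀ x y, x ++ y = l → F x y = G x y) : splitSum F l = splitSum G l := by
  induction l generalizing F G with
  | nil => exact h _ _ rfl
  | cons a l ih =>
    simp only [splitSum]
    rw [h [] (a :: l) rfl, ih fun x y hxy => h (a :: x) y (by simp [hxy])]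

theorem splitSum_add (F G : List α → List α → X) (l : List α) :
    splitSum (fun x y => F x y + G x y) l = splitSum F l + splitSum G l := by
  induction l generalizing F G with
  | nil => rfl
  | cons a l ih => simp only [splitSum, ih]; abel

theorem splitSum_zero (l : List α) : splitSum (fun _ _ => (0 : X)) l = 0 := by
  induction l with
  | nil => rfl
  | cons a l ih => simp only [splitSum, ih, add_zero]

theorem map_splitSum {Φ : Type*} [FunLike Φ X Y] [AddMonoidHomClass Φ X Y] (f : Φ)
    (F : List α → List α → X) (l : List α) :
    f (splitSum F l) = splitSum (fun x y => f (F x y)) l := by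
  induction l generalizing F with
  | nil => rfl
  | cons a l ih => simp only [splitSum, map_add, ih]

theorem splitSum_comm {β : Type*} (F : List α → List α → List β → List β → X)
    (l : List α) (l' : List β) :
    splitSum (fun x y => splitSum (fun z t => F x y z t) l') l =
      splitSum (fun z t => splitSum (fun x y => F x y z t) l) l' := by
  induction l generalizing F with
  | nil => rfl
  | cons a l ih => simp only [splitSum, ih, splitSum_add]

/-- Coassociativity of deconcatenation: both sides run over the factorizations into three pieces. -/
theorem splitSum_assoc (F : List α → List α → List α → X) (l : List α) :
    splitSum (fun x y => splitSum (fun x₁ x₂ => F x₁ x₂ y) x) l =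
      splitSum (fun x y => splitSum (fun y₁ y₂ => F x y₁ y₂) y) l := by
  induction l generalizing F with
  | nil => rfl
  | cons a l ih => simp only [splitSum, ih, splitSum_add, add_assoc]

/-- A cut of a word with a distinguished letter lies before or after that letter. Applied twice,
this yields the trichotomy left of, around and right of the mark. -/
theorem splitSum_append_cons (F : List α → List α → X) (l l' : List α) (a : α) :
    splitSum F (l ++ a :: l') =
      splitSum (fun x y => F x (y ++ a :: l')) l + splitSum (fun x y => F (l ++ a :: x) y) l' := by
  induction l generalizing F with
  | nil => simp [splitSum]
  | cons b l ih => simp only [splitSum, List.cons_append, ih, add_assoc]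

theorem splitSum_eq_nil_left {F : List α → List α → X} {l : List α}
    (h : ∀ a x y, F (a :: x) y = 0) : splitSum F l = F [] l := by
  cases l with
  | nil => rfl
  | cons a l => simp only [splitSum, h, splitSum_zero, add_zero]

theorem splitSum_eq_nil_right {F : List α → List α → X} {l : List α}
    (h : ∀ x a y, F x (a :: y) = 0) : splitSum F l = F l [] := by
  induction l generalizing F with
  | nil => rfl
  | cons a l ih => simp only [splitSum, h, zero_add]; exact ih fun x b y => h _ _ _

theorem splitSum_neg {X : Type*} [AddCommGroup X] (F : List α → List α → X) (l : List α) :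
    splitSum (fun x y => -F x y) l = -splitSum F l :=
  (map_splitSum (negAddMonoidHom (α := X)) F l).symm

theorem smul_splitSum {R : Type*} [Monoid R] [DistribMulAction R X] (r : R)
    (F : List α → List α → X) (l : List α) :
    r • splitSum F l = splitSum (fun x y => r • F x y) l :=
  map_splitSum (DistribSMul.toAddMonoidHom X r) F l

theorem splitSum_tmul {R A B : Type*} [CommSemiring R] [AddCommMonoid A] [AddCommMonoid B]
    [Module R A] [Module R B] (F : List α → List α → A) (l : List α) (b : B) :
    splitSum F l ⊗ₜ[R] b = splitSum (fun x y => F x y ⊗ₜ[R] b) l :=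
  map_splitSum ((TensorProduct.mk R A B).flip b) F l

theorem tmul_splitSum {R A B : Type*} [CommSemiring R] [AddCommMonoid A] [AddCommMonoid B]
    [Module R A] [Module R B] (F : List α → List α → A) (l : List α) (b : B) :
    b ⊗ₜ[R] splitSum F l = splitSum (fun x y => b ⊗ₜ[R] F x y) l :=
  map_splitSum (TensorProduct.mk R B A b) F l

theorem splitSum_mul {A : Type*} [NonUnitalNonAssocSemiring A] (F : List α → List α → A)
    (l : List α) (b : A) : splitSum F l * b = splitSum (fun x y => F x y * b) l :=
  map_splitSum (AddMonoidHom.mulRight b) F l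

theorem mul_splitSum {A : Type*} [NonUnitalNonAssocSemiring A] (F : List α → List α → A)
    (l : List α) (b : A) : b * splitSum F l = splitSum (fun x y => b * F x y) l :=
  map_splitSum (AddMonoidHom.mulLeft b) F l

end SplitSum

/-! ### Words of homogeneous letters -/

/-- Signs are kept as natural powers of `-1`, so that exponents can be compared by `ring` or by
parity. -/
theorem neg_one_zpow_eq_pow_natAbs {k : Type*} [Field k] (z : ℤ) :
    (-1 : k) ^ z = (-1) ^ z.natAbs := by
  obtain ⟨n, rfl | rfl⟩ := z.eq_nat_or_neg
  · simp
  · rw [zpow_neg, zpow_natCast, Int.natAbs_neg, Int.natAbs_natCast, ← inv_pow, inv_neg_one]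

section Word

variable {k V : Type*} [Field k] [AddCommGroup V] [Module k V]
variable (𝒱 : ℤ → Submodule k V)

/-- Homogeneous letters, with their degrees. -/
abbrev Letter : Type _ := Σ d : ℤ, 𝒱 d

variable {𝒱}

/-- The product of the letters of a word in the tensor algebra. -/
def word (l : List (Letter 𝒱)) : T k V :=
  (l.map fun b => TensorAlgebra.ι k (b.2 : V)).prod

theorem word_nil : word ([] : List (Letter 𝒱)) = 1 := rfl

theorem word_cons (a : Letter 𝒱) (l : List (Letter 𝒱)) :
    word (a :: l) = TensorAlgebra.ι k (a.2 : V) * word l := by simp [word]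

theorem word_append (l l' : List (Letter 𝒱)) : word (l ++ l') = word l * word l' := by simp [word]

/-- The parity of a word, as a natural number. -/
def par (l : List (Letter 𝒱)) : ℕ := (l.map fun b => b.1.natAbs).sum

theorem par_nil : par ([] : List (Letter 𝒱)) = 0 := rfl

theorem par_cons (a : Letter 𝒱) (l : List (Letter 𝒱)) :
    par (a :: l) = a.1.natAbs + par l := by simp [par]

theorem par_append (l l' : List (Letter 𝒱)) : par (l ++ l') = par l + par l' := by simp [par]

theorem deconc_word (l : List (Letter 𝒱)) :
    deconc k V (word l) = splitSum (fun x y => word x ⊗ₜ word y) l := by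
  induction l with
  | nil => simp [word_nil, deconc_one, splitSum]
  | cons a l ih =>
    simp only [word_cons, deconc_ι_mul, ih, splitSum, word_nil, map_splitSum,
      LinearMap.rTensor_tmul, LinearMap.mulLeft_apply]

theorem cons_tmul (a : V) (w : T k V) : cons k V (a ⊗ₜ w) = TensorAlgebra.ι k a * w := by
  simp [cons]

theorem uncons_cons (x : Chain k V) : uncons k V (cons k V x) = x := by
  induction x using TensorProduct.induction_on with
  | zero => simp
  | tmul a w => rw [cons_tmul, uncons_ι_mul]
  | add x y hx hy => rw [map_add, map_add, hx, hy]

theorem ext0_cons (A : Cochain k V) (x : Chain k V) : ext0 A (cons k V x) = A x := by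
  simp [ext0, uncons_cons]

variable [DirectSum.Decomposition 𝒱]

theorem linearMap_ext_homogeneous {X : Type*} [AddCommMonoid X] [Module k X] {f g : V →ₗ[k] X}
    (h : ∀ a : Letter 𝒱, f (a.2 : V) = g (a.2 : V)) : f = g := by
  ext v
  induction v using DirectSum.Decomposition.inductionOn 𝒱 with
  | zero => simp
  | @homogeneous i m => exact h ⟨i, m⟩
  | add m m' h h' => rw [map_add, map_add, h, h']

variable (𝒱) in
-- The span contains `1` and is stable under left multiplication by letters, since every letter is a
-- sum of homogeneous ones; hence it is a left ideal containing `1`.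
theorem span_word : Submodule.span k (Set.range (word (𝒱 := 𝒱))) = ⊤ := by
  set S := Submodule.span k (Set.range (word (𝒱 := 𝒱))) with hS
  have key : ∀ x : T k V, ∀ y ∈ S, x * y ∈ S := by
    intro x
    induction x using TensorAlgebra.induction with
    | algebraMap r => intro y hy; rw [← Algebra.smul_def]; exact S.smul_mem r hy
    | ι a =>
      intro y hy
      induction hy using Submodule.span_induction with
      | mem y hy =>
        obtain ⟨l, rfl⟩ := hy
        induction a using DirectSum.Decomposition.inductionOn 𝒱 with
        | zero => simp
        | @homogeneous i m =>
          exact Submodule.subset_span ⟨⟨i, m⟩ :: l, word_cons _ _⟩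
        | add m m' h h' => rw [map_add, add_mul]; exact S.add_mem h h'
      | zero => simp
      | add x y _ _ hx hy => rw [mul_add]; exact S.add_mem hx hy
      | smul r x _ hx => rw [mul_smul_comm]; exact S.smul_mem r hx
    | mul a b ha hb => intro y hy; rw [mul_assoc]; exact ha _ (hb _ hy)
    | add a b ha hb => intro y hy; rw [add_mul]; exact S.add_mem (ha _ hy) (hb _ hy)
  refine eq_top_iff.2 fun x _ => ?_
  rw [← mul_one x]
  exact key x 1 (Submodule.subset_span ⟨[], word_nil⟩)

/-- Operator identities may thus be tested on words of homogeneous letters, where every Koszul sign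
is an explicit power of `-1`. -/
theorem linearMap_ext_word {X : Type*} [AddCommMonoid X] [Module k X] {f g : T k V →ₗ[k] X}
    (h : ∀ l : List (Letter 𝒱), f (word l) = g (word l)) : f = g :=
  LinearMap.ext_on_range (span_word 𝒱) h

theorem chain_ext {X : Type*} [AddCommMonoid X] [Module k X] {f g : Chain k V →ₗ[k] X}
    (h : ∀ (a : Letter 𝒱) (l : List (Letter 𝒱)),
      f ((a.2 : V) ⊗ₜ word l) = g ((a.2 : V) ⊗ₜ word l)) : f = g := by
  apply TensorProduct.ext
  exact linearMap_ext_homogeneous (𝒱 := 𝒱) fun a => linearMap_ext_word fun l => h a l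

theorem tmul_chain_ext {X : Type*} [AddCommMonoid X] [Module k X]
    {f g : T k V ⊗[k] Chain k V →ₗ[k] X}
    (h : ∀ (u : List (Letter 𝒱)) (a : Letter 𝒱) (l : List (Letter 𝒱)),
      f (word u ⊗ₜ ((a.2 : V) ⊗ₜ word l)) = g (word u ⊗ₜ ((a.2 : V) ⊗ₜ word l))) : f = g := by
  apply TensorProduct.ext
  exact linearMap_ext_word (𝒱 := 𝒱) fun u => chain_ext (𝒱 := 𝒱) fun a l => h u a l

/-! ### The grading involutions -/

variable (𝒱)

theorem invV_letter (a : Letter 𝒱) : invV 𝒱 (a.2 : V) = (-1 : k) ^ a.1.natAbs • (a.2 : V) := by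
  rw [invV_of_mem 𝒱 a.2.2, neg_one_zpow_eq_pow_natAbs]

theorem invT_one : invT 𝒱 1 = 1 := by simp [invT]

theorem invT_mul (x y : T k V) : invT 𝒱 (x * y) = invT 𝒱 x * invT 𝒱 y := by simp [invT]

theorem invT_ι (a : V) : invT 𝒱 (TensorAlgebra.ι k a) = TensorAlgebra.ι k (invV 𝒱 a) := by
  simp [invT]

theorem invT_word (l : List (Letter 𝒱)) : invT 𝒱 (word l) = (-1 : k) ^ par l • word l := by
  induction l with
  | nil => simp [word_nil, par_nil, invT_one]
  | cons a l ih =>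
    rw [word_cons, invT_mul, invT_ι, ih, invV_letter, par_cons, map_smul, smul_mul_smul_comm,
      pow_add]

theorem neg_one_pow_smul_smul {X : Type*} [AddCommMonoid X] [Module k X] (n : ℕ) (x : X) :
    (-1 : k) ^ n • (-1 : k) ^ n • x = x := by
  rw [smul_smul, ← pow_add, ← two_mul, pow_mul]; simp

theorem invV_mul_invV : invV 𝒱 * invV 𝒱 = 1 :=
  linearMap_ext_homogeneous (𝒱 := 𝒱) fun a => by
    simp [invV_letter, neg_one_pow_smul_smul]

theorem invT_mul_invT : invT 𝒱 * invT 𝒱 = 1 :=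
  linearMap_ext_word (𝒱 := 𝒱) fun a => by
    simp [invT_word, neg_one_pow_smul_smul]

theorem invV_invV (a : V) : invV 𝒱 (invV 𝒱 a) = a :=
  LinearMap.congr_fun (invV_mul_invV 𝒱) a

theorem invT_invT (a : T k V) : invT 𝒱 (invT 𝒱 a) = a :=
  LinearMap.congr_fun (invT_mul_invT 𝒱) a

theorem invChain_tmul (a : V) (w : T k V) :
    invChain 𝒱 (a ⊗ₜ w) = invV 𝒱 a ⊗ₜ invT 𝒱 w := rfl

theorem invChain_mul_invChain : invChain 𝒱 * invChain 𝒱 = 1 := by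
  ext; simp [invChain_tmul, invV_invV, invT_invT]

theorem invChain_invChain (x : Chain k V) : invChain 𝒱 (invChain 𝒱 x) = x :=
  LinearMap.congr_fun (invChain_mul_invChain 𝒱) x

theorem uncons_invT (w : T k V) : uncons k V (invT 𝒱 w) = invChain 𝒱 (uncons k V w) := by
  have : uncons k V ∘ₗ invT 𝒱 = invChain 𝒱 ∘ₗ uncons k V :=
    linearMap_ext_word (𝒱 := 𝒱) fun l => by
      cases l with
      | nil => simp [word_nil, invT_one, uncons_one]
      | cons a l =>
        simp [word_cons, invT_mul, invT_ι, uncons_ι_mul, invChain_tmul]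
  exact LinearMap.congr_fun this w

theorem deconc_invT (w : T k V) :
    deconc k V (invT 𝒱 w) = TensorProduct.map (invT 𝒱) (invT 𝒱) (deconc k V w) := by
  have : deconc k V ∘ₗ invT 𝒱 = TensorProduct.map (invT 𝒱) (invT 𝒱) ∘ₗ deconc k V :=
    linearMap_ext_word (𝒱 := 𝒱) fun l => by
      simp only [LinearMap.comp_apply, invT_word, map_smul, deconc_word, smul_splitSum,
        map_splitSum, TensorProduct.map_tmul]
      refine splitSum_congr fun x y h => ?_
      rw [← h, par_append, TensorProduct.smul_tmul_smul, pow_add]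
  exact LinearMap.congr_fun this w

/-- The cochain `A` has parity `q`. -/
def HasParity (q : Fin 2) (A : Cochain k V) : Prop :=
  ∀ x, invV 𝒱 (A (invChain 𝒱 x)) = (-1 : k) ^ (q : ℕ) • A x

variable {𝒱} {A : Cochain k V} {q : Fin 2}

/-- This collapses the sums over parities in the definitions of the operations to a single term. -/
theorem HasParity.part_eq [CharZero k] (h : HasParity 𝒱 q A) (p : Fin 2) :
    part 𝒱 p A = if p = q then A else 0 := by
  refine LinearMap.ext fun x => ?_
  have := h x
  have h2 : ∀ v : V, (2⁻¹ : k) • (v + v) = v := fun v => by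
    rw [← two_smul k v, smul_smul]; simp
  fin_cases p <;> fin_cases q <;> simp_all [part]

theorem HasParity.ext0 (h : HasParity 𝒱 q A) (w : T k V) :
    AInfinity.ext0 A (invT 𝒱 w) = (-1 : k) ^ (q : ℕ) • invV 𝒱 (AInfinity.ext0 A w) := by
  have := congrArg (invV 𝒱) (h (uncons k V w))
  simp only [invV_invV, map_smul] at this
  simp only [AInfinity.ext0, LinearMap.comp_apply, uncons_invT, this]

theorem HasParity.invV_ext0 (h : HasParity 𝒱 q A) (w : T k V) :
    invV 𝒱 (AInfinity.ext0 A w) = (-1 : k) ^ (q : ℕ) • AInfinity.ext0 A (invT 𝒱 w) := by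
  rw [h.ext0, neg_one_pow_smul_smul]

theorem HasParity.add {B : Cochain k V} (hA : HasParity 𝒱 q A) (hB : HasParity 𝒱 q B) :
    HasParity 𝒱 q (A + B) := fun x => by
  rw [LinearMap.add_apply, map_add, hA, hB, LinearMap.add_apply, smul_add]

theorem HasParity.smul (hA : HasParity 𝒱 q A) (c : k) : HasParity 𝒱 q (c • A) := fun x => by
  rw [LinearMap.smul_apply, map_smul, hA, LinearMap.smul_apply, smul_comm]

theorem HasParity.zero : HasParity 𝒱 q (0 : Cochain k V) := fun x => by simp

theorem HasParity.sum {ι : Type*} (s : Finset ι) {f : ι → Cochain k V}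
    (h : ∀ i ∈ s, HasParity 𝒱 q (f i)) : HasParity 𝒱 q (∑ i ∈ s, f i) := by
  classical
  induction s using Finset.induction_on with
  | empty => exact .zero
  | insert a s ha ih =>
    rw [Finset.sum_insert ha]
    exact (h a (by simp)).add (ih fun i hi => h i (by simp [hi]))

variable (𝒱) in
theorem hasParity_part [CharZero k] (p : Fin 2) (A : Cochain k V) :
    HasParity 𝒱 p (part 𝒱 p A) := fun x => by
  fin_cases p <;> simp [part, invV_invV, invChain_invChain, add_comm, ← sub_eq_add_neg]
  rw [← smul_neg, neg_sub]

variable (𝒱) in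
theorem part_add_part [CharZero k] (A : Cochain k V) : part 𝒱 0 A + part 𝒱 1 A = A := by
  simp only [part, ← smul_add]
  simp only [Fin.val_zero, Fin.val_one, pow_zero, pow_one, one_smul, neg_smul]
  rw [show ∀ B : Cochain k V, A + B + (A + -B) = (2 : k) • A from fun B => by
    rw [two_smul]; abel, smul_smul]
  simp

theorem IsHomogeneousOfDegree.hasParity_one {d : ℤ} (h : IsHomogeneousOfDegree 𝒱 A d)
    (hd : Odd d) : HasParity 𝒱 1 A := by
  have : invV 𝒱 ∘ₗ A ∘ₗ invChain 𝒱 = -A := chain_ext (𝒱 := 𝒱) fun a l => by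
    have h1 := h a.1 a.2 l
    change A (_ ⊗ₜ word l) ∈ _ at h1
    have h4 : (-1 : k) ^ (l.map fun b => b.1).sum = (-1) ^ par l := by
      clear h1
      induction l with
      | nil => simp [par_nil]
      | cons b l ih =>
        rw [List.map_cons, List.sum_cons, zpow_add₀ (by simp), ih, par_cons, pow_add,
          neg_one_zpow_eq_pow_natAbs]
    have h2 : (-1 : k) ^ (a.1 + (l.map fun b => b.1).sum + d) =
        -((-1) ^ a.1.natAbs * (-1) ^ par l) := by
      rw [zpow_add₀ (by simp), zpow_add₀ (by simp), h4, neg_one_zpow_eq_pow_natAbs,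
        hd.neg_one_zpow, mul_neg_one]
    simp only [LinearMap.comp_apply, invChain_tmul, invV_letter, invT_word,
      TensorProduct.smul_tmul_smul, map_smul, invV_of_mem 𝒱 h1, h2, LinearMap.neg_apply, neg_smul,
      smul_neg]
    rw [← pow_add, neg_one_pow_smul_smul]
  intro x
  have := LinearMap.congr_fun this x
  simpa using this

end Word


/-! ### Coderivations of the tensor coalgebra -/

section Coder

variable {k V : Type*} [Field k] [AddCommGroup V] [Module k V]
variable {𝒱 : ℤ → Submodule k V}

theorem insertAfter_word (φ : Module.End k (T k V)) (A : Cochain k V) (l : List (Letter 𝒱)) :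
    insertAfter φ A (word l) = splitSum (fun u v => splitSum (fun x y =>
      φ (word u) * (TensorAlgebra.ι k (ext0 A (word x)) * word y)) v) l := by
  simp only [insertAfter, LinearMap.comp_apply, deconc_word, map_splitSum, LinearMap.lTensor_tmul,
    tmul_splitSum, TensorProduct.map_tmul, LinearMap.mul'_apply, LinearMap.id_apply]

theorem insertAfter_zero_right (φ : Module.End k (T k V)) : insertAfter φ 0 = 0 := by
  simp [insertAfter, ext0]

theorem ext0_add (A B : Cochain k V) : ext0 (A + B) = ext0 A + ext0 B := LinearMap.add_comp _ _ _

theorem ext0_smul (c : k) (A : Cochain k V) : ext0 (c • A) = c • ext0 A := LinearMap.smul_comp _ _ _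

theorem insertAfter_add_left (φ ψ : Module.End k (T k V)) (A : Cochain k V) :
    insertAfter (φ + ψ) A = insertAfter φ A + insertAfter ψ A := by
  simp [insertAfter, TensorProduct.map_add_left, LinearMap.add_comp, LinearMap.comp_add]

theorem insertAfter_add_right (φ : Module.End k (T k V)) (A B : Cochain k V) :
    insertAfter φ (A + B) = insertAfter φ A + insertAfter φ B := by
  simp [insertAfter, TensorProduct.map_add_left, TensorProduct.map_add_right, LinearMap.add_comp,
    LinearMap.comp_add, ext0_add]

theorem insertAfter_smul_right (c : k) (φ : Module.End k (T k V)) (A : Cochain k V) :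
    insertAfter φ (c • A) = c • insertAfter φ A := by
  simp [insertAfter, TensorProduct.map_smul_left, TensorProduct.map_smul_right, LinearMap.smul_comp,
    LinearMap.comp_smul, ext0_smul]


theorem deconc_word_mul_ι_mul (l : List (Letter 𝒱)) (q : T k V) (a : V) :
    deconc k V (word l * (TensorAlgebra.ι k a * q)) =
      splitSum (fun x y => word x ⊗ₜ (word y * (TensorAlgebra.ι k a * q))) l +
      LinearMap.rTensor (T k V) (LinearMap.mulLeft k (word l * TensorAlgebra.ι k a))
        (deconc k V q) := by
  induction l with
  | nil => simp [word_nil, splitSum, deconc_ι_mul]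
  | cons b l ih =>
    rw [word_cons, mul_assoc, deconc_ι_mul, ih, splitSum]
    simp only [map_add, map_splitSum, LinearMap.rTensor_tmul, LinearMap.mulLeft_apply, word_nil,
      word_cons, mul_assoc, LinearMap.mulLeft_mul, LinearMap.rTensor_comp,
      LinearMap.comp_apply, add_assoc]

/-- The projection of the tensor algebra onto its scalars. -/
abbrev counit (k V : Type*) [Field k] [AddCommGroup V] [Module k V] : T k V →ₐ[k] k :=
  TensorAlgebra.algebraMapInv

theorem counit_ι (a : V) : counit k V (TensorAlgebra.ι k a) = 0 := by
  simp [counit, TensorAlgebra.algebraMapInv]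

theorem counit_word_cons {𝒱 : ℤ → Submodule k V} (a : Letter 𝒱) (l : List (Letter 𝒱)) :
    counit k V (word (a :: l)) = 0 := by
  rw [word_cons, map_mul, counit_ι, zero_mul]

theorem counit_word_nil : counit k V (word ([] : List (Letter 𝒱))) = 1 := by
  rw [word_nil, map_one]

variable [DirectSum.Decomposition 𝒱]

/-- The cut lies to the left or to the right of the letter `a`. The distinguished letter is
essential: for a bare product of two factors the cut between them would be counted twice. -/
theorem deconc_mul_ι_mul (𝒱 : ℤ → Submodule k V) [DirectSum.Decomposition 𝒱] (p q : T k V) (a : V) :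
    deconc k V (p * (TensorAlgebra.ι k a * q)) =
      LinearMap.lTensor (T k V) (LinearMap.mulRight k (TensorAlgebra.ι k a * q)) (deconc k V p) +
      LinearMap.rTensor (T k V) (LinearMap.mulLeft k p ∘ₗ LinearMap.mulLeft k (TensorAlgebra.ι k a))
        (deconc k V q) := by
  have hp : p ∈ Submodule.span k (Set.range (word (𝒱 := 𝒱))) := by rw [span_word]; trivial
  induction hp using Submodule.span_induction with
  | mem p hp =>
    obtain ⟨l, rfl⟩ := hp
    rw [deconc_word_mul_ι_mul, deconc_word, LinearMap.mulLeft_mul]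
    simp only [map_splitSum, LinearMap.lTensor_tmul, LinearMap.mulRight_apply]
  | zero => simp
  | add x y _ _ hx hy =>
    rw [add_mul, map_add, hx, hy, map_add, map_add]
    have : LinearMap.mulLeft k (x + y) = LinearMap.mulLeft k x + LinearMap.mulLeft k y := by
      ext; simp [add_mul]
    rw [this, LinearMap.add_comp, LinearMap.rTensor_add, LinearMap.add_apply]
    abel
  | smul r x _ hx =>
    rw [smul_mul_assoc, map_smul, hx, map_smul, map_smul]
    have : LinearMap.mulLeft k (r • x) = r • LinearMap.mulLeft k x := by
      ext; simp
    rw [this, LinearMap.smul_comp, LinearMap.rTensor_smul, LinearMap.smul_apply, smul_add]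

/-- If `φ` is comultiplicative up to two summands, so is `insertAfter φ A`, up to three. -/
theorem deconc_insertAfter (𝒱 : ℤ → Submodule k V) [DirectSum.Decomposition 𝒱]
    {φ φ₁ ψ₁ φ₂ ψ₂ : Module.End k (T k V)}
    (h : ∀ w, deconc k V (φ w) =
      TensorProduct.map φ₁ ψ₁ (deconc k V w) + TensorProduct.map φ₂ ψ₂ (deconc k V w))
    (A : Cochain k V) (w : T k V) :
    deconc k V (insertAfter φ A w) =
      TensorProduct.map (insertAfter φ A) LinearMap.id (deconc k V w) +
      TensorProduct.map φ₁ (insertAfter ψ₁ A) (deconc k V w) +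
      TensorProduct.map φ₂ (insertAfter ψ₂ A) (deconc k V w) := by
  have key : deconc k V ∘ₗ insertAfter φ A =
      (TensorProduct.map (insertAfter φ A) LinearMap.id + TensorProduct.map φ₁ (insertAfter ψ₁ A) +
        TensorProduct.map φ₂ (insertAfter ψ₂ A)) ∘ₗ deconc k V := by
    refine linearMap_ext_word (𝒱 := 𝒱) fun l => ?_
    simp only [LinearMap.comp_apply, insertAfter_word, map_splitSum, deconc_mul_ι_mul 𝒱, h,
      deconc_word, LinearMap.add_apply, map_add, TensorProduct.map_tmul, splitSum_add,
      LinearMap.lTensor_tmul, LinearMap.rTensor_tmul, LinearMap.mulRight_apply,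
      LinearMap.mulLeft_apply, LinearMap.id_apply, tmul_splitSum, splitSum_tmul]
    have aux : ∀ F : List (Letter 𝒱) → List (Letter 𝒱) → List (Letter 𝒱) → List (Letter 𝒱) →
        T k V ⊗[k] T k V,
        splitSum (fun u v => splitSum (fun x y => splitSum (fun u₁ u₂ => F u₁ u₂ x y) u) v) l =
        splitSum (fun u₁ r => splitSum (fun u₂ v => splitSum (fun x y => F u₁ u₂ x y) v) r) l := by
      intro F
      rw [← splitSum_assoc (fun u₁ u₂ v => splitSum (fun x y => F u₁ u₂ x y) v)]
      refine splitSum_congr fun u v _ => ?_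
      rw [splitSum_comm]
    -- A cut to the right of the inserted letter gives the first summand; a cut to its left meets `φ
    -- u` and gives the other two.
    rw [add_comm, ← add_assoc]
    refine congrArg₂ (· + ·) (congrArg₂ (· + ·) ?_ (aux _)) (aux _)
    rw [splitSum_assoc]
    refine splitSum_congr fun x y _ => ?_
    exact (splitSum_assoc (fun a b c => (φ (word x) * (TensorAlgebra.ι k (ext0 A (word a)) *
      word b)) ⊗ₜ[k] word c) y).symm
  exact LinearMap.congr_fun key w

theorem map_map_apply {A B C D E F : Type*} [AddCommGroup A] [Module k A] [AddCommGroup B]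
    [Module k B] [AddCommGroup C] [Module k C] [AddCommGroup D] [Module k D] [AddCommGroup E]
    [Module k E] [AddCommGroup F] [Module k F] (f : B →ₗ[k] C) (f' : A →ₗ[k] B) (g : E →ₗ[k] F)
    (g' : D →ₗ[k] E) (x : A ⊗[k] D) :
    TensorProduct.map f g (TensorProduct.map f' g' x) =
      TensorProduct.map (f ∘ₗ f') (g ∘ₗ g') x := by
  rw [TensorProduct.map_comp, LinearMap.comp_apply]

section Parity

variable {A B : Cochain k V} {p q : Fin 2}

theorem HasParity.coder_eq [CharZero k] (h : HasParity 𝒱 q A) :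
    coder 𝒱 A = insertAfter (invT 𝒱 ^ (q : ℕ)) A := by
  simp only [coder, h.part_eq, apply_ite, insertAfter_zero_right]
  fin_cases q <;> simp

theorem HasParity.coder₂_eq [CharZero k] (h : HasParity 𝒱 q B) :
    coder₂ 𝒱 A B = insertAfter (coder 𝒱 A ∘ₗ invT 𝒱 ^ (q : ℕ)) B := by
  simp only [coder₂, h.part_eq, apply_ite, insertAfter_zero_right]
  fin_cases q <;> simp

theorem deconc_invT_pow (n : ℕ) (w : T k V) :
    deconc k V ((invT 𝒱 ^ n) w) =
      TensorProduct.map (invT 𝒱 ^ n) (invT 𝒱 ^ n) (deconc k V w) := by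
  induction n generalizing w with
  | zero => simp
  | succ n ih =>
    rw [pow_succ, Module.End.mul_apply, ih, deconc_invT]
    rw [map_map_apply]
    rfl

/-- A power of the grading involution is comultiplicative, so only one pair is needed in
`deconc_insertAfter`, and the result is the coderivation rule with Koszul twist. -/
theorem HasParity.deconc_coder [CharZero k] (h : HasParity 𝒱 q A) (w : T k V) :
    deconc k V (coder 𝒱 A w) =
      TensorProduct.map (coder 𝒱 A) LinearMap.id (deconc k V w) +
      TensorProduct.map (invT 𝒱 ^ (q : ℕ)) (coder 𝒱 A) (deconc k V w) := by
  rw [h.coder_eq]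
  have := deconc_insertAfter 𝒱 (φ := invT 𝒱 ^ (q : ℕ)) (φ₁ := invT 𝒱 ^ (q : ℕ))
    (ψ₁ := invT 𝒱 ^ (q : ℕ)) (φ₂ := 0) (ψ₂ := 0) (fun w => by simp [deconc_invT_pow]) A w
  simpa using this

/-- The middle summand is the one in which the cut separates `A` from `B`; it is the obstruction to
`coder₂` being a coderivation. -/
theorem HasParity.deconc_coder₂ [CharZero k] (hA : HasParity 𝒱 p A) (hB : HasParity 𝒱 q B)
    (w : T k V) :
    deconc k V (coder₂ 𝒱 A B w) =
      TensorProduct.map (coder₂ 𝒱 A B) LinearMap.id (deconc k V w) +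
      TensorProduct.map (coder 𝒱 A * invT 𝒱 ^ (q : ℕ)) (coder 𝒱 B) (deconc k V w) +
      TensorProduct.map (invT 𝒱 ^ (p : ℕ) * invT 𝒱 ^ (q : ℕ)) (coder₂ 𝒱 A B) (deconc k V w) := by
  rw [hB.coder₂_eq, hB.coder_eq]
  refine deconc_insertAfter 𝒱 (fun w => ?_) B w
  rw [LinearMap.comp_apply, hA.deconc_coder, deconc_invT_pow]
  simp only [map_map_apply]
  rfl

theorem HasParity.invT_insertAfter (hB : HasParity 𝒱 q B) {φ : Module.End k (T k V)} {n : ℕ}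
    (hφ : ∀ w, invT 𝒱 (φ w) = (-1 : k) ^ n • φ (invT 𝒱 w)) (w : T k V) :
    invT 𝒱 (insertAfter φ B w) = (-1 : k) ^ (n + (q : ℕ)) • insertAfter φ B (invT 𝒱 w) := by
  have : invT 𝒱 ∘ₗ insertAfter φ B = (-1 : k) ^ (n + (q : ℕ)) • insertAfter φ B ∘ₗ invT 𝒱 := by
    refine linearMap_ext_word (𝒱 := 𝒱) fun l => ?_
    simp only [LinearMap.comp_apply, LinearMap.smul_apply, invT_word, map_smul, insertAfter_word,
      map_splitSum, smul_splitSum, invT_mul, invT_ι, hφ, hB.invV_ext0]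
    refine splitSum_congr fun u v h => splitSum_congr fun x y h' => ?_
    simp only [← h, ← h', par_append, smul_mul_assoc, mul_smul_comm, smul_smul, ← pow_add]
    congr 2
    ring
  exact LinearMap.congr_fun this w

theorem HasParity.invT_coder [CharZero k] (h : HasParity 𝒱 q A) (w : T k V) :
    invT 𝒱 (coder 𝒱 A w) = (-1 : k) ^ (q : ℕ) • coder 𝒱 A (invT 𝒱 w) := by
  rw [h.coder_eq]
  have := h.invT_insertAfter (φ := invT 𝒱 ^ (q : ℕ)) (n := 0) (fun w => by
    rw [pow_zero, one_smul, ← Module.End.mul_apply, ← Module.End.mul_apply, ← pow_succ,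
      ← pow_succ']) w
  simpa using this

theorem HasParity.invT_pow_mul_coder [CharZero k] (h : HasParity 𝒱 q A) (p : Fin 2) :
    invT 𝒱 ^ (p : ℕ) * coder 𝒱 A =
      (-1 : k) ^ ((p : ℕ) * (q : ℕ)) • (coder 𝒱 A * invT 𝒱 ^ (p : ℕ)) := by
  fin_cases p
  · simp
  · refine LinearMap.ext fun w => ?_
    simp [h.invT_coder]

end Parity

/-! ### Uniqueness of coderivations -/

/-- The projection of the tensor algebra onto `V`. -/
def letterProj (k V : Type*) [Field k] [AddCommGroup V] [Module k V] : T k V →ₗ[k] V :=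
  (TensorProduct.rid k V).toLinearMap ∘ₗ LinearMap.lTensor V (counit k V).toLinearMap ∘ₗ uncons k V

theorem letterProj_ι_mul (a : V) (w : T k V) :
    letterProj k V (TensorAlgebra.ι k a * w) = counit k V w • a := by
  simp [letterProj, uncons_ι_mul]

theorem letterProj_one : letterProj k V 1 = 0 := by simp [letterProj, uncons_one]

theorem letterProj_mul_ι_mul (𝒱 : ℤ → Submodule k V) [DirectSum.Decomposition 𝒱] (u y : T k V)
    (a : V) :
    letterProj k V (u * (TensorAlgebra.ι k a * y)) = (counit k V u * counit k V y) • a := by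
  have : letterProj k V ∘ₗ LinearMap.mulRight k (TensorAlgebra.ι k a * y) =
      (LinearMap.toSpanSingleton k V (counit k V y • a)) ∘ₗ (counit k V).toLinearMap := by
    refine linearMap_ext_word (𝒱 := 𝒱) fun l => ?_
    cases l with
    | nil => simp [word_nil, letterProj_ι_mul]
    | cons b l =>
      simp [word_cons, mul_assoc, letterProj_ι_mul, counit_ι]
  have := LinearMap.congr_fun this u
  simpa [smul_smul, mul_assoc] using this

theorem rTensor_letterProj_deconc (𝒱 : ℤ → Submodule k V) [DirectSum.Decomposition 𝒱]
    (w : T k V) :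
    LinearMap.rTensor (T k V) (letterProj k V) (deconc k V w) = uncons k V w := by
  have : LinearMap.rTensor (T k V) (letterProj k V) ∘ₗ deconc k V = uncons k V := by
    refine linearMap_ext_word (𝒱 := 𝒱) fun l => ?_
    rw [LinearMap.comp_apply, deconc_word, map_splitSum]
    cases l with
    | nil => simp [splitSum, word_nil, letterProj_one, uncons_one]
    | cons a l =>
      simp only [splitSum, LinearMap.rTensor_tmul]
      rw [splitSum_eq_nil_left]
      · simp [word_nil, letterProj_one, word_cons, uncons_ι_mul]
        rw [← mul_one (TensorAlgebra.ι k (a.2 : V)), letterProj_ι_mul, map_one, one_smul]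
      · intro b x y
        simp [word_cons, letterProj_ι_mul, counit_ι]
  exact LinearMap.congr_fun this w

theorem cons_uncons_add_counit (𝒱 : ℤ → Submodule k V) [DirectSum.Decomposition 𝒱] (w : T k V) :
    cons k V (uncons k V w) + counit k V w • 1 = w := by
  have : cons k V ∘ₗ uncons k V +
      LinearMap.toSpanSingleton k (T k V) 1 ∘ₗ (counit k V).toLinearMap = LinearMap.id := by
    refine linearMap_ext_word (𝒱 := 𝒱) fun l => ?_
    cases l with
    | nil => simp [word_nil, uncons_one]
    | cons b l => simp [word_cons, uncons_ι_mul, cons_tmul, counit_ι]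
  simpa using LinearMap.congr_fun this w

theorem letterProj_invT (𝒱 : ℤ → Submodule k V) [DirectSum.Decomposition 𝒱] (w : T k V) :
    letterProj k V (invT 𝒱 w) = invV 𝒱 (letterProj k V w) := by
  have : letterProj k V ∘ₗ invT 𝒱 = invV 𝒱 ∘ₗ letterProj k V := by
    refine linearMap_ext_word (𝒱 := 𝒱) fun l => ?_
    cases l with
    | nil => simp [word_nil, invT_one, letterProj_one]
    | cons b l =>
      simp only [LinearMap.comp_apply, word_cons, invT_mul, invT_ι, letterProj_ι_mul, map_smul,
        invT_word]
      cases l with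
      | nil => simp [par_nil]
      | cons => simp [counit_word_cons]
  exact LinearMap.congr_fun this w

/-- A twisted coderivation of the tensor coalgebra with zero corestrictions is zero. -/
theorem eq_zero_of_deconc {K : Module.End k (T k V)} (n : ℕ)
    (hK : ∀ w, deconc k V (K w) = TensorProduct.map K LinearMap.id (deconc k V w) +
      TensorProduct.map (invT 𝒱 ^ n) K (deconc k V w))
    (h0 : ∀ w, counit k V (K w) = 0) (h1 : ∀ w, letterProj k V (K w) = 0) : K = 0 := by
  have hpow : ∀ w, letterProj k V ((invT 𝒱 ^ n) w) = (invV 𝒱 ^ n) (letterProj k V w) := by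
    intro w
    clear hK
    induction n generalizing w with
    | zero => simp
    | succ n ih =>
      rw [pow_succ, pow_succ, Module.End.mul_apply, ih, letterProj_invT, Module.End.mul_apply]
  -- Projecting the first tensor factor to `V` kills `K ⊗ 1`, so the nonconstant part of `K` on a
  -- word is computed from `K` on the word without its first letter; `h0` removes the constant part.
  have hu : ∀ w, uncons k V (K w) = TensorProduct.map (invV 𝒱 ^ n) K (uncons k V w) := by
    intro w
    have e1 : letterProj k V ∘ₗ K = 0 := LinearMap.ext h1
    have e2 : letterProj k V ∘ₗ (invT 𝒱 ^ n) = (invV 𝒱 ^ n) ∘ₗ letterProj k V := LinearMap.ext hpow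
    rw [← rTensor_letterProj_deconc 𝒱, hK, ← rTensor_letterProj_deconc 𝒱 w, LinearMap.rTensor]
    simp only [map_add, map_map_apply, e1, e2, LinearMap.id_comp, LinearMap.comp_id,
      TensorProduct.map_zero_left, LinearMap.zero_apply, zero_add]
  refine linearMap_ext_word (𝒱 := 𝒱) fun l => ?_
  induction l with
  | nil =>
    rw [← cons_uncons_add_counit 𝒱 (K (word [])), h0, hu, word_nil, uncons_one]
    simp
  | cons a l ih =>
    rw [← cons_uncons_add_counit 𝒱 (K (word (a :: l))), h0, hu, word_cons, uncons_ι_mul]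
    simp [ih]

theorem counit_insertAfter (𝒱 : ℤ → Submodule k V) [DirectSum.Decomposition 𝒱]
    (φ : Module.End k (T k V)) (A : Cochain k V) (w : T k V) :
    counit k V (insertAfter φ A w) = 0 := by
  have : (counit k V).toLinearMap ∘ₗ insertAfter φ A = 0 := by
    refine linearMap_ext_word (𝒱 := 𝒱) fun l => ?_
    simp only [LinearMap.comp_apply, insertAfter_word, map_splitSum, AlgHom.toLinearMap_apply,
      map_mul, counit_ι, zero_mul, mul_zero, splitSum_zero, LinearMap.zero_apply]
  exact LinearMap.congr_fun this w

end Coder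

/-! ### Brackets and braces as commutators of coderivations. -/

section Brackets

variable {k V : Type*} [Field k] [AddCommGroup V] [Module k V]
variable {𝒱 : ℤ → Submodule k V} [DirectSum.Decomposition 𝒱]

theorem counit_invT (w : T k V) : counit k V (invT 𝒱 w) = counit k V w := by
  have : (counit k V).toLinearMap ∘ₗ invT 𝒱 = (counit k V).toLinearMap := by
    refine linearMap_ext_word (𝒱 := 𝒱) fun l => ?_
    cases l with
    | nil => simp [word_nil, invT_one]
    | cons a l => simp [invT_word, counit_word_cons]
  exact LinearMap.congr_fun this w

theorem map_sub_left {A B C D : Type*} [AddCommGroup A] [Module k A] [AddCommGroup B] [Module k B]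
    [AddCommGroup C] [Module k C] [AddCommGroup D] [Module k D] (f f' : A →ₗ[k] B) (g : C →ₗ[k] D) :
    TensorProduct.map (f - f') g = TensorProduct.map f g - TensorProduct.map f' g := by
  rw [eq_sub_iff_add_eq, ← TensorProduct.map_add_left, sub_add_cancel]

theorem map_sub_right {A B C D : Type*} [AddCommGroup A] [Module k A] [AddCommGroup B] [Module k B]
    [AddCommGroup C] [Module k C] [AddCommGroup D] [Module k D] (g : A →ₗ[k] B) (f f' : C →ₗ[k] D) :
    TensorProduct.map g (f - f') = TensorProduct.map g f - TensorProduct.map g f' := by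
  rw [eq_sub_iff_add_eq, ← TensorProduct.map_add_right, sub_add_cancel]

/-- The output is a single letter only if `A` consumes the whole word, up to constants produced by
`φ`. The factor `c` is `1` for powers of the involution and `0` for a coderivation. -/
theorem letterProj_insertAfter (𝒱 : ℤ → Submodule k V) [DirectSum.Decomposition 𝒱]
    {φ : Module.End k (T k V)} (c : k)
    (h : ∀ w, counit k V (φ w) = c • counit k V w) (A : Cochain k V) (w : T k V) :
    letterProj k V (insertAfter φ A w) = c • ext0 A w := by
  have : letterProj k V ∘ₗ insertAfter φ A = c • ext0 A := by
    refine linearMap_ext_word (𝒱 := 𝒱) fun l => ?_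
    simp only [LinearMap.comp_apply, insertAfter_word, map_splitSum, letterProj_mul_ι_mul 𝒱, h]
    rw [splitSum_eq_nil_left fun a x y => ?_, splitSum_eq_nil_right fun a x y => ?_]
    · simp [counit_word_nil]
    · simp [counit_word_cons]
    · simp [counit_word_cons, splitSum_zero]
  exact LinearMap.congr_fun this w

theorem insertAfter_one (φ : Module.End k (T k V)) (A : Cochain k V) : insertAfter φ A 1 = 0 := by
  have := insertAfter_word (𝒱 := fun _ : ℤ => (⊤ : Submodule k V)) φ A []
  rw [word_nil] at this
  rw [this]
  simp [splitSum, word_nil, ext0, uncons_one]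

theorem coder_one (A : Cochain k V) : coder 𝒱 A 1 = 0 := by
  simp [coder, insertAfter_one]

theorem coder₂_one (A B : Cochain k V) : coder₂ 𝒱 A B 1 = 0 := by
  simp [coder₂, insertAfter_one]

theorem counit_coder (A : Cochain k V) (w : T k V) : counit k V (coder 𝒱 A w) = 0 := by
  simp [coder, counit_insertAfter 𝒱]

theorem counit_coder₂ (A B : Cochain k V) (w : T k V) : counit k V (coder₂ 𝒱 A B w) = 0 := by
  simp [coder₂, counit_insertAfter 𝒱]

theorem apply_cons_uncons {X : Type*} [AddCommGroup X] [Module k X] (f : T k V →ₗ[k] X)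
    (hf : f 1 = 0) (𝒱 : ℤ → Submodule k V) [DirectSum.Decomposition 𝒱] (w : T k V) :
    f (cons k V (uncons k V w)) = f w := by
  conv_rhs => rw [← cons_uncons_add_counit 𝒱 w]
  simp [hf]

theorem ext0_circ (A B : Cochain k V) (w : T k V) :
    ext0 (circ 𝒱 A B) w = ext0 A (coder 𝒱 B w) :=
  apply_cons_uncons (ext0 A ∘ₗ coder 𝒱 B) (by simp [coder_one]) 𝒱 w

theorem ext0_brace₂ (M A B : Cochain k V) (w : T k V) :
    ext0 (brace₂ 𝒱 M A B) w = ext0 M (coder₂ 𝒱 A B w) :=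
  apply_cons_uncons (ext0 M ∘ₗ coder₂ 𝒱 A B) (by simp [coder₂_one]) 𝒱 w

variable [CharZero k] {M A B : Cochain k V} {p q r : Fin 2}

theorem HasParity.letterProj_coder (h : HasParity 𝒱 q A) (w : T k V) :
    letterProj k V (coder 𝒱 A w) = AInfinity.ext0 A w := by
  rw [h.coder_eq, letterProj_insertAfter 𝒱 1, one_smul]
  intro w
  fin_cases q <;> simp [counit_invT]

theorem HasParity.letterProj_coder₂ (h : HasParity 𝒱 q B) (w : T k V) :
    letterProj k V (coder₂ 𝒱 A B w) = 0 := by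
  rw [h.coder₂_eq, letterProj_insertAfter 𝒱 0, zero_smul]
  simp [counit_coder]

/-- A cochain of definite parity is determined by its coderivation. -/
theorem HasParity.eq_zero_of_coder (h : HasParity 𝒱 q A) (h0 : coder 𝒱 A = 0) : A = 0 := by
  refine LinearMap.ext fun x => ?_
  rw [← ext0_cons, ← h.letterProj_coder, h0]
  simp

theorem cons_invChain (x : Chain k V) : cons k V (invChain 𝒱 x) = invT 𝒱 (cons k V x) := by
  induction x using TensorProduct.induction_on with
  | zero => simp
  | tmul a w => simp [invChain_tmul, cons_tmul, invT_mul, invT_ι]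
  | add x y hx hy => simp [hx, hy]

theorem hasParity_of_ext0 (h : ∀ w, ext0 A (invT 𝒱 w) = (-1 : k) ^ (q : ℕ) • invV 𝒱 (ext0 A w)) :
    HasParity 𝒱 q A := fun x => by
  rw [← ext0_cons, cons_invChain, h, map_smul, invV_invV, ext0_cons]

theorem neg_one_pow_fin_add (p q : Fin 2) :
    (-1 : k) ^ ((p + q : Fin 2) : ℕ) = (-1) ^ (p : ℕ) * (-1) ^ (q : ℕ) := by
  fin_cases p <;> fin_cases q <;> simp

theorem invT_pow_fin_add (p q : Fin 2) :
    invT 𝒱 ^ ((p + q : Fin 2) : ℕ) = invT 𝒱 ^ (p : ℕ) * invT 𝒱 ^ (q : ℕ) := by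
  fin_cases p <;> fin_cases q <;> simp [invT_mul_invT]

theorem HasParity.circ (hA : HasParity 𝒱 p A) (hB : HasParity 𝒱 q B) :
    HasParity 𝒱 (p + q) (circ 𝒱 A B) := hasParity_of_ext0 fun w => by
  have := hB.invT_coder w
  rw [ext0_circ, ext0_circ, hA.invV_ext0, this, map_smul, neg_one_pow_fin_add, mul_comm, mul_smul,
    neg_one_pow_smul_smul, neg_one_pow_smul_smul]

theorem HasParity.invT_coder₂ (hA : HasParity 𝒱 p A) (hB : HasParity 𝒱 q B) (w : T k V) :
    invT 𝒱 (coder₂ 𝒱 A B w) = (-1 : k) ^ ((p : ℕ) + q) • coder₂ 𝒱 A B (invT 𝒱 w) := by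
  rw [hB.coder₂_eq]
  refine hB.invT_insertAfter (fun w => ?_) w
  rw [LinearMap.comp_apply, hA.invT_coder, LinearMap.comp_apply]
  fin_cases q <;> simp

theorem HasParity.brace₂ (hM : HasParity 𝒱 r M) (hA : HasParity 𝒱 p A) (hB : HasParity 𝒱 q B) :
    HasParity 𝒱 (r + (p + q)) (brace₂ 𝒱 M A B) := hasParity_of_ext0 fun w => by
  have := hA.invT_coder₂ hB w
  rw [ext0_brace₂, ext0_brace₂, hM.invV_ext0, this, map_smul, neg_one_pow_fin_add,
    neg_one_pow_fin_add, ← pow_add, mul_comm, mul_smul, neg_one_pow_smul_smul,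
    neg_one_pow_smul_smul]

theorem HasParity.bracket_eq (hA : HasParity 𝒱 p A) (hB : HasParity 𝒱 q B) :
    bracket 𝒱 A B = AInfinity.circ 𝒱 A B - (-1 : k) ^ ((p : ℕ) * q) • AInfinity.circ 𝒱 B A := by
  have h0 : ∀ X : Cochain k V, AInfinity.circ 𝒱 0 X = 0 := fun X => by
    simp [AInfinity.circ, AInfinity.ext0]
  have h1 : coder 𝒱 (0 : Cochain k V) = 0 := by
    simp [coder, (HasParity.zero (𝒱 := 𝒱) (q := 0)).part_eq, insertAfter_zero_right]
  have h2 : ∀ X : Cochain k V, AInfinity.circ 𝒱 X 0 = 0 := fun X => by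
    simp [AInfinity.circ, h1]
  simp only [bracket, hA.part_eq, hB.part_eq]
  fin_cases p <;> fin_cases q <;> simp [h0, h2]

theorem HasParity.bracket (hA : HasParity 𝒱 p A) (hB : HasParity 𝒱 q B) :
    HasParity 𝒱 (p + q) (bracket 𝒱 A B) := by
  rw [hA.bracket_eq hB, sub_eq_add_neg, ← neg_smul]
  exact (hA.circ hB).add ((add_comm p q ▸ hB.circ hA).smul _)

/-- Both sides are coderivations with the twist of parity `p + q` and have the same component in
`V`, so `eq_zero_of_deconc` identifies them. -/
theorem HasParity.coder_bracket (hA : HasParity 𝒱 p A) (hB : HasParity 𝒱 q B) :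
    coder 𝒱 A * coder 𝒱 B - (-1 : k) ^ ((p : ℕ) * q) • (coder 𝒱 B * coder 𝒱 A) =
      coder 𝒱 (AInfinity.bracket 𝒱 A B) := by
  have hC := hA.bracket hB
  have e1 : (invT 𝒱 ^ (p : ℕ)) ∘ₗ coder 𝒱 B = _ := hB.invT_pow_mul_coder p
  have e2 : (invT 𝒱 ^ (q : ℕ)) ∘ₗ coder 𝒱 A = _ := hA.invT_pow_mul_coder q
  refine sub_eq_zero.1 (eq_zero_of_deconc (𝒱 := 𝒱) ((p + q : Fin 2) : ℕ) (fun w => ?_)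
    (fun w => ?_) (fun w => ?_))
  · simp only [LinearMap.sub_apply, LinearMap.smul_apply, Module.End.mul_apply, map_sub, map_add,
      map_smul, hA.deconc_coder, hB.deconc_coder, hC.deconc_coder, map_map_apply, e1, e2,
      invT_pow_fin_add, map_sub_left, map_sub_right,
      TensorProduct.map_smul_left, TensorProduct.map_smul_right,
      ← Module.End.mul_eq_comp, smul_add, smul_smul]
    have e3 : invT 𝒱 ^ (q : ℕ) * invT 𝒱 ^ (p : ℕ) = invT 𝒱 ^ (p : ℕ) * invT 𝒱 ^ (q : ℕ) := by
      rw [← pow_add, ← pow_add, add_comm]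
    have e4 : (-1 : k) ^ ((p : ℕ) * q) * (-1 : k) ^ ((q : ℕ) * p) = 1 := by
      rw [mul_comm (q : ℕ), ← mul_pow]; simp
    rw [e3, e4]
    module
  · simp [counit_coder]
  · simp only [LinearMap.sub_apply, LinearMap.smul_apply, Module.End.mul_apply, map_sub,
      map_smul, hA.letterProj_coder, hB.letterProj_coder, hC.letterProj_coder]
    rw [hA.bracket_eq hB, sub_eq_add_neg (AInfinity.circ 𝒱 A B), ← neg_smul, ext0_add, ext0_smul]
    simp only [ext0_circ, LinearMap.add_apply, LinearMap.smul_apply]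
    module

/-- The operators `coder₂` are not coderivations, but their mixed terms cancel against those of the
two bracket terms by `coder_bracket`. What remains is an odd coderivation with component `M{A, B}`.
For cocycles, the coderivation of `m{A, B}` thus becomes a commutator with that of `m`. -/
theorem HasParity.coder_brace₂ (hM : HasParity 𝒱 1 M) (hA : HasParity 𝒱 1 A)
    (hB : HasParity 𝒱 1 B) :
    coder 𝒱 M * coder₂ 𝒱 A B - coder₂ 𝒱 A B * coder 𝒱 M =
      coder 𝒱 (AInfinity.brace₂ 𝒱 M A B) + coder₂ 𝒱 (AInfinity.bracket 𝒱 M A) B -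
        coder₂ 𝒱 A (AInfinity.bracket 𝒱 M B) := by
  have hC : HasParity 𝒱 1 (AInfinity.brace₂ 𝒱 M A B) := hM.brace₂ hA hB
  have hMA : HasParity 𝒱 0 (AInfinity.bracket 𝒱 M A) := hM.bracket hA
  have hMB : HasParity 𝒱 0 (AInfinity.bracket 𝒱 M B) := hM.bracket hB
  have eMA := hM.coder_bracket hA
  have eMB := hM.coder_bracket hB
  have e1' : ∀ {X}, HasParity 𝒱 1 X → invT 𝒱 * coder 𝒱 X = (-1 : k) • (coder 𝒱 X * invT 𝒱) := by
    intro X hX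
    simpa using hX.invT_pow_mul_coder 1
  have e1 : ∀ {X}, HasParity 𝒱 1 X → ∀ Y,
      invT 𝒱 * (coder 𝒱 X * Y) = (-1 : k) • (coder 𝒱 X * (invT 𝒱 * Y)) := by
    intro X hX Y
    rw [← mul_assoc, e1' hX, smul_mul_assoc, mul_assoc]
  have e2 : invT 𝒱 * coder₂ 𝒱 A B = coder₂ 𝒱 A B * invT 𝒱 := by
    refine LinearMap.ext fun w => ?_
    simpa using hA.invT_coder₂ hB w
  have hid : ∀ X : Module.End k (T k V), LinearMap.id * X = X := fun X => rfl
  have hid' : ∀ X : Module.End k (T k V), X * LinearMap.id = X := fun X => rfl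
  refine sub_eq_zero.1 (eq_zero_of_deconc (𝒱 := 𝒱) 1 (fun w => ?_)
    (fun w => ?_) (fun w => ?_))
  · simp only [LinearMap.sub_apply, LinearMap.add_apply, Module.End.mul_apply, map_sub, map_add,
      hM.deconc_coder, hA.deconc_coder₂ hB, hC.deconc_coder, hMA.deconc_coder₂ hB,
      hA.deconc_coder₂ hMB, map_map_apply,
      map_sub_left, map_sub_right,
      TensorProduct.map_add_left, TensorProduct.map_add_right,
      ← Module.End.mul_eq_comp, ← eMA, ← eMB, mul_assoc, e1 hA, e1' hM,
      Fin.val_zero, Fin.val_one, pow_zero, pow_one, mul_one, one_mul, invT_mul_invT, sub_mul,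
      TensorProduct.map_smul_left, TensorProduct.map_smul_right, smul_mul_assoc, neg_smul, one_smul,
      mul_smul_comm, LinearMap.smul_apply, hid, hid', e2]
    module
  · simp [counit_coder, counit_coder₂]
  · simp only [LinearMap.sub_apply, LinearMap.add_apply, Module.End.mul_apply, map_sub, map_add,
      hM.letterProj_coder, hB.letterProj_coder₂, hMB.letterProj_coder₂, hC.letterProj_coder,
      ext0_brace₂]
    abel

end Brackets


/-! ### Operators on words with a marked letter -/

section Marked

variable (k V : Type*) [Field k] [AddCommGroup V] [Module k V]

/-- The space of words with one marked letter. -/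
abbrev Marked : Type _ := T k V ⊗[k] Chain k V

/-- The right coaction of the tensor coalgebra on marked words. -/
def coactR : Marked k V →ₗ[k] Marked k V ⊗[k] T k V :=
  (TensorProduct.assoc k (T k V) (Chain k V) (T k V)).symm.toLinearMap ∘ₗ
    LinearMap.lTensor (T k V) ((TensorProduct.assoc k V (T k V) (T k V)).symm.toLinearMap ∘ₗ
      LinearMap.lTensor V (deconc k V))

/-- Forgetting the mark. -/
def concat : Marked k V →ₗ[k] T k V :=
  LinearMap.mul' k (T k V) ∘ₗ LinearMap.lTensor (T k V) (cons k V)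

/-- Coassociativity on both sides of the mark at once, for two nested blocks around it. -/
theorem splitSum_assoc_assoc {α X : Type*} [AddCommMonoid X]
    (G : List α → List α → List α → List α → List α → List α → X) (u w : List α) :
    splitSum (fun x y => splitSum (fun w₁ z => splitSum (fun w₂ w₃ =>
        splitSum (fun u₁ u₂ => G u₁ u₂ y w₁ w₂ w₃) x) z) w) u =
      splitSum (fun u₁ y => splitSum (fun x w₃ => splitSum (fun u₂ u₃ =>
        splitSum (fun w₁ w₂ => G u₁ u₂ u₃ w₁ w₂ w₃) x) y) w) u := by
  trans splitSum (fun x y => splitSum (fun u₁ u₂ => splitSum (fun w₁ z =>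
    splitSum (fun w₂ w₃ => G u₁ u₂ y w₁ w₂ w₃) z) w) x) u
  · refine splitSum_congr fun x y _ => ?_
    rw [splitSum_comm]
    exact splitSum_congr fun _ _ _ => splitSum_comm _ _ _
  · rw [splitSum_assoc (fun u₁ u₂ y => splitSum (fun w₁ z =>
      splitSum (fun w₂ w₃ => G u₁ u₂ y w₁ w₂ w₃) z) w)]
    refine splitSum_congr fun x y _ => ?_
    refine .trans ?_ (splitSum_comm _ _ _)
    exact splitSum_congr fun _ _ _ => (splitSum_assoc _ _).symm

variable {k V}

/-- The operator `u a w ↦ P(u) t(a) Q(w)` on marked words. -/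
abbrev tri (P : Module.End k (T k V)) (t : Module.End k V) (Q : Module.End k (T k V)) :
    Module.End k (Marked k V) :=
  TensorProduct.map P (TensorProduct.map t Q)

/-- The operator `u a w ↦ ∑ φ(u₁) f(u₂ a w₁) ψ(w₂)` on marked words. -/
def theta (φ : Module.End k (T k V)) (f : Marked k V →ₗ[k] V) (ψ : Module.End k (T k V)) :
    Module.End k (Marked k V) :=
  TensorProduct.map φ (TensorProduct.map f ψ ∘ₗ coactR k V) ∘ₗ
    (TensorProduct.assoc k (T k V) (T k V) (Chain k V)).toLinearMap ∘ₗ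
    LinearMap.rTensor (Chain k V) (deconc k V)

/-- The operator behind `theta`, after the two deconcatenations. -/
def thetaAux (φ : Module.End k (T k V)) (f : Marked k V →ₗ[k] V) (ψ : Module.End k (T k V)) :
    (T k V ⊗[k] T k V) ⊗[k] (V ⊗[k] (T k V ⊗[k] T k V)) →ₗ[k] Marked k V :=
  TensorProduct.map φ (TensorProduct.map f ψ ∘ₗ
      (TensorProduct.assoc k (T k V) (Chain k V) (T k V)).symm.toLinearMap) ∘ₗ
    (TensorProduct.assoc k (T k V) (T k V) (Chain k V ⊗[k] T k V)).toLinearMap ∘ₗ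
    LinearMap.lTensor _ (TensorProduct.assoc k V (T k V) (T k V)).symm.toLinearMap

theorem thetaAux_tmul (φ : Module.End k (T k V)) (f : Marked k V →ₗ[k] V)
    (ψ : Module.End k (T k V)) (u₁ u₂ w₁ w₂ : T k V) (a : V) :
    thetaAux φ f ψ ((u₁ ⊗ₜ u₂) ⊗ₜ (a ⊗ₜ (w₁ ⊗ₜ w₂))) =
      φ u₁ ⊗ₜ (f (u₂ ⊗ₜ (a ⊗ₜ w₁)) ⊗ₜ ψ w₂) := rfl

theorem theta_tmul (φ : Module.End k (T k V)) (f : Marked k V →ₗ[k] V)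
    (ψ : Module.End k (T k V)) (u w : T k V) (a : V) :
    theta φ f ψ (u ⊗ₜ (a ⊗ₜ w)) = thetaAux φ f ψ (deconc k V u ⊗ₜ (a ⊗ₜ deconc k V w)) := by
  simp only [theta, thetaAux, LinearMap.comp_apply, LinearMap.rTensor_tmul, LinearMap.lTensor_tmul]
  induction deconc k V u using TensorProduct.induction_on with
  | zero => simp
  | tmul x y => rfl
  | add x y hx hy => simp only [TensorProduct.add_tmul, map_add, hx, hy]

theorem thetaAux_map (φ : Module.End k (T k V)) (f : Marked k V →ₗ[k] V)
    (ψ P P' Q Q' : Module.End k (T k V)) (t : Module.End k V) (X Y : T k V ⊗[k] T k V) (a : V) :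
    thetaAux φ f ψ (TensorProduct.map P P' X ⊗ₜ (t a ⊗ₜ TensorProduct.map Q Q' Y)) =
      thetaAux (φ * P) (f ∘ₗ tri P' t Q) (ψ * Q') (X ⊗ₜ (a ⊗ₜ Y)) := by
  induction X using TensorProduct.induction_on with
  | zero => simp
  | tmul x y =>
    induction Y using TensorProduct.induction_on with
    | zero => simp
    | tmul z t => rfl
    | add x y hx hy => simp only [TensorProduct.tmul_add, map_add, hx, hy]
  | add x y hx hy => simp only [TensorProduct.add_tmul, map_add, hx, hy]

/-- `P` satisfies `Δ P = (∑ P' ⊗ P'') Δ`, the sum being over the pairs in `L`. -/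
def Comult (P : Module.End k (T k V)) (L : List (Module.End k (T k V) × Module.End k (T k V))) :
    Prop :=
  ∀ w, deconc k V (P w) = (L.map fun x => TensorProduct.map x.1 x.2 (deconc k V w)).sum

/-- Since `theta` begins by cutting `u` and `w`, an operator acting earlier on them is replaced by
its coproduct. On the left the first factor acts outside the block and the second inside; on the
right it is the reverse. -/
theorem theta_mul_tri (φ : Module.End k (T k V)) (f : Marked k V →ₗ[k] V)
    (ψ : Module.End k (T k V)) {P Q : Module.End k (T k V)} (t : Module.End k V)
    {L L' : List (Module.End k (T k V) × Module.End k (T k V))} (hP : Comult P L)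
    (hQ : Comult Q L') :
    theta φ f ψ * tri P t Q =
      (L.map fun x => (L'.map fun y =>
        theta (φ * x.1) (f ∘ₗ tri x.2 t y.1) (ψ * y.2)).sum).sum := by
  have aux : ∀ (X : T k V ⊗[k] T k V) (a : V) (w : T k V), 
      thetaAux φ f ψ (X ⊗ₜ (t a ⊗ₜ (L'.map fun x =>
        TensorProduct.map x.1 x.2 (deconc k V w)).sum)) =
      (L'.map fun y => thetaAux φ f ψ (X ⊗ₜ (t a ⊗ₜ
        TensorProduct.map y.1 y.2 (deconc k V w)))).sum := by
    intro X a w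
    clear hQ
    induction L' with
    | nil => simp
    | cons y L' ih => simp only [List.map_cons, List.sum_cons, TensorProduct.tmul_add, map_add, ih]
  refine TensorProduct.ext' fun u c => ?_
  induction c using TensorProduct.induction_on with
  | zero => simp
  | add x y hx hy => simp only [TensorProduct.tmul_add, map_add, hx, hy]
  | tmul a w =>
    rw [Module.End.mul_apply, TensorProduct.map_tmul, TensorProduct.map_tmul, theta_tmul, hP, hQ]
    clear hP
    induction L with
    | nil => simp
    | cons x L ih =>
      simp only [List.map_cons, List.sum_cons, TensorProduct.add_tmul, map_add, ih,
        LinearMap.add_apply]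
      congr 1
      rw [aux]
      clear hQ ih aux
      induction L' with
      | nil => simp
      | cons y L' ih =>
        simp only [List.map_cons, List.sum_cons, LinearMap.add_apply, ← ih, thetaAux_map,
          theta_tmul]

theorem tri_mul_theta (φ ψ P Q : Module.End k (T k V)) (f : Marked k V →ₗ[k] V)
    (t : Module.End k V) :
    tri P t Q * theta φ f ψ = theta (P * φ) (t ∘ₗ f) (Q * ψ) := by
  refine LinearMap.ext fun x => ?_
  simp only [Module.End.mul_apply, theta, LinearMap.comp_apply, map_map_apply]
  rw [← LinearMap.comp_assoc, ← TensorProduct.map_comp]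
  rfl

theorem theta_add (φ ψ : Module.End k (T k V)) (f g : Marked k V →ₗ[k] V) :
    theta φ (f + g) ψ = theta φ f ψ + theta φ g ψ := by
  simp only [theta, TensorProduct.map_add_left, TensorProduct.map_add_right, LinearMap.add_comp]

theorem theta_smul (φ ψ : Module.End k (T k V)) (f : Marked k V →ₗ[k] V) (c : k) :
    theta φ (c • f) ψ = c • theta φ f ψ := by
  simp only [theta, TensorProduct.map_smul_left, TensorProduct.map_smul_right, LinearMap.smul_comp]

theorem theta_smul_left (φ ψ : Module.End k (T k V)) (f : Marked k V →ₗ[k] V) (c : k) :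
    theta (c • φ) f ψ = c • theta φ f ψ := by
  simp only [theta, TensorProduct.map_smul_left, LinearMap.smul_comp]

variable {𝒱 : ℤ → Submodule k V} 

theorem theta_word (φ : Module.End k (T k V)) (f : Marked k V →ₗ[k] V)
    (ψ : Module.End k (T k V)) (u w : List (Letter 𝒱)) (a : V) :
    theta φ f ψ (word u ⊗ₜ (a ⊗ₜ word w)) =
      splitSum (fun u₁ u₂ => splitSum (fun w₁ w₂ =>
        φ (word u₁) ⊗ₜ[k] (f (word u₂ ⊗ₜ (a ⊗ₜ word w₁)) ⊗ₜ[k] ψ (word w₂))) w) u := by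
  simp only [theta_tmul, deconc_word, splitSum_tmul, tmul_splitSum, map_splitSum, thetaAux_tmul]
  rw [splitSum_comm]

theorem concat_tmul (u w : T k V) (a : V) :
    concat k V (u ⊗ₜ (a ⊗ₜ w)) = u * (TensorAlgebra.ι k a * w) := by
  simp [concat, cons_tmul]

variable [DirectSum.Decomposition 𝒱]

/-- Two successive insertions around the mark are necessarily nested, so a single kind of term
arises. -/
theorem theta_mul_theta (φ ψ : Module.End k (T k V)) (f g : Marked k V →ₗ[k] V) (n : ℕ) :
    theta φ f ψ * theta (invT 𝒱 ^ n) g 1 =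
      theta (φ * invT 𝒱 ^ n) (f ∘ₗ theta (invT 𝒱 ^ n) g 1) ψ := by
  refine tmul_chain_ext (𝒱 := 𝒱) fun u a w => ?_
  rw [Module.End.mul_apply]
  simp only [theta_word, LinearMap.comp_apply]
  simp only [map_splitSum, tmul_splitSum, splitSum_tmul, theta_tmul, deconc_invT_pow,
    deconc_word, TensorProduct.map_tmul, thetaAux_tmul, Module.End.one_apply, Module.End.mul_apply]
  exact splitSum_assoc_assoc (fun u₁ u₂ u₃ w₁ w₂ w₃ => φ ((invT 𝒱 ^ n) (word u₁)) ⊗ₜ[k]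
    (f ((invT 𝒱 ^ n) (word u₂) ⊗ₜ[k] (g (word u₃ ⊗ₜ[k] ((a.2 : V) ⊗ₜ[k] word w₁)) ⊗ₜ[k]
      word w₂)) ⊗ₜ[k] ψ (word w₃))) u w

/-! ### The action of coderivations on marked words -/

theorem comult_one : Comult (1 : Module.End k (T k V)) [(1, 1)] := fun w => by
  simp [TensorProduct.map_one]

theorem comult_invT_pow (n : ℕ) : Comult (invT 𝒱 ^ n) [(invT 𝒱 ^ n, invT 𝒱 ^ n)] := fun w => by
  simp [deconc_invT_pow]

variable [CharZero k] {M A B : Cochain k V} {p q r : Fin 2}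

theorem HasParity.comult_coder (hA : HasParity 𝒱 p A) :
    Comult (coder 𝒱 A) [(coder 𝒱 A, 1), (invT 𝒱 ^ (p : ℕ), coder 𝒱 A)] := fun w => by
  simpa [Module.End.one_eq_id] using hA.deconc_coder w

theorem HasParity.comult_coder₂ (hA : HasParity 𝒱 p A) (hB : HasParity 𝒱 q B) :
    Comult (coder₂ 𝒱 A B) [(coder₂ 𝒱 A B, 1), (coder 𝒱 A * invT 𝒱 ^ (q : ℕ), coder 𝒱 B),
      (invT 𝒱 ^ (p : ℕ) * invT 𝒱 ^ (q : ℕ), coder₂ 𝒱 A B)] := fun w => by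
  simpa [Module.End.one_eq_id, add_assoc] using hA.deconc_coder₂ hB w

variable (𝒱) in
/-- A cochain as a map on marked words, forgetting the mark. -/
def markedEval (A : Cochain k V) : Marked k V →ₗ[k] V := ext0 A ∘ₗ concat k V

variable (𝒱) in
/-- The Lie derivative on marked words along a cochain of parity `p`. -/
def markedLie (p : Fin 2) (A : Cochain k V) : Module.End k (Marked k V) :=
  tri (coder 𝒱 A) 1 1 + tri (invT 𝒱 ^ (p : ℕ)) (invV 𝒱 ^ (p : ℕ)) (coder 𝒱 A) +
    theta (invT 𝒱 ^ (p : ℕ)) (markedEval A) 1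

theorem invV_pow_letter (n : ℕ) (a : Letter 𝒱) :
    (invV 𝒱 ^ n) (a.2 : V) = (-1 : k) ^ (n * a.1.natAbs) • (a.2 : V) := by
  induction n with
  | zero => simp
  | succ n ih =>
    rw [pow_succ', Module.End.mul_apply, ih, map_smul, invV_letter, smul_smul, ← pow_add,
      Nat.succ_mul]

theorem invT_pow_word (n : ℕ) (l : List (Letter 𝒱)) :
    (invT 𝒱 ^ n) (word l) = (-1 : k) ^ (n * par l) • word l := by
  induction n with
  | zero => simp
  | succ n ih =>
    rw [pow_succ', Module.End.mul_apply, ih, map_smul, invT_word, smul_smul, ← pow_add,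
      Nat.succ_mul]

theorem concat_word (u w : List (Letter 𝒱)) (a : Letter 𝒱) :
    concat k V (word u ⊗ₜ ((a.2 : V) ⊗ₜ word w)) = word (u ++ a :: w) := by
  rw [concat_tmul, word_append, word_cons]

/-- The three summands have the block inserted to the left of the letter `a`, around it and to its
right. -/
theorem insertAfter_concat (φ : Module.End k (T k V)) (A : Cochain k V)
    (u w : List (Letter 𝒱)) (a : Letter 𝒱) :
    insertAfter φ A (word (u ++ a :: w)) =
      insertAfter φ A (word u) * word (a :: w) +
      splitSum (fun u₁ u₂ => splitSum (fun w₁ w₂ => φ (word u₁) *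
        (TensorAlgebra.ι k (ext0 A (word (u₂ ++ a :: w₁))) * word w₂)) w) u +
      splitSum (fun w₁ v => splitSum (fun x y => φ (word (u ++ a :: w₁)) *
        (TensorAlgebra.ι k (ext0 A (word x)) * word y)) v) w := by
  rw [insertAfter_word, splitSum_append_cons]
  simp only [splitSum_append_cons, splitSum_add]
  congr 2
  simp only [insertAfter_word, splitSum_mul, mul_assoc, word_append]

/-- This is why the composition product can be evaluated on marked words; see
`markedEval_comp_markedLie`. -/
theorem HasParity.concat_markedLie (hA : HasParity 𝒱 p A) (x : Marked k V) :
    concat k V (markedLie 𝒱 p A x) = coder 𝒱 A (concat k V x) := by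
  have : concat k V ∘ₗ markedLie 𝒱 p A = coder 𝒱 A ∘ₗ concat k V := by
    refine tmul_chain_ext (𝒱 := 𝒱) fun u a w => ?_
    rw [LinearMap.comp_apply, LinearMap.comp_apply, concat_word, hA.coder_eq, insertAfter_concat]
    simp only [markedLie, LinearMap.add_apply, TensorProduct.map_tmul, theta_word, map_add,
      map_splitSum, concat_tmul, Module.End.one_apply, markedEval, hA.coder_eq,
      LinearMap.comp_apply]
    rw [add_right_comm, ← word_cons]
    congr 1
    · simp only [word_append, word_cons]
    · simp only [insertAfter_word, mul_splitSum, invT_pow_word, invV_pow_letter]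
      simp only [word_append, word_cons, par_append, par_cons, map_smul, smul_mul_assoc,
        mul_smul_comm, smul_smul, ← pow_add, mul_assoc]
      refine splitSum_congr fun _ _ _ => splitSum_congr fun _ _ _ => ?_
      congr 2
      ring
  exact LinearMap.congr_fun this x

end Marked

/-! ### Two odd insertions into a marked word. -/

section MarkedOdd

variable {k V : Type*} [Field k] [AddCommGroup V] [Module k V] [CharZero k]
variable {𝒱 : ℤ → Submodule k V} [DirectSum.Decomposition 𝒱] {M A B : Cochain k V}

variable (𝒱) in
/-- Insertion of an odd cochain to the right of the mark. -/
abbrev markedRight (A : Cochain k V) : Module.End k (Marked k V) :=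
  tri (invT 𝒱) (invV 𝒱) (coder 𝒱 A)

variable (𝒱) in
/-- Insertion of an odd cochain around the mark. -/
abbrev markedMid (A : Cochain k V) : Module.End k (Marked k V) :=
  theta (invT 𝒱) (markedEval A) 1

variable (𝒱) in
/-- Insertion of two odd cochains into a marked word. -/
abbrev markedLie₂ (A B : Cochain k V) : Module.End k (Marked k V) :=
  tri (coder₂ 𝒱 A B) 1 1 + tri 1 1 (coder₂ 𝒱 A B) + tri (coder 𝒱 A) 1 1 * markedRight 𝒱 B +
    tri (coder 𝒱 A) 1 1 * markedMid 𝒱 B - markedRight 𝒱 B * markedMid 𝒱 A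

theorem markedLie_one (A : Cochain k V) :
    markedLie 𝒱 1 A = tri (coder 𝒱 A) 1 1 + markedRight 𝒱 A + markedMid 𝒱 A := by
  simp [markedLie]

theorem HasParity.invV_ext0_word {q : Fin 2} (hA : HasParity 𝒱 q A) (l : List (Letter 𝒱)) :
    invV 𝒱 (AInfinity.ext0 A (word l)) =
      (-1 : k) ^ ((q : ℕ) + par l) • AInfinity.ext0 A (word l) := by
  rw [hA.invV_ext0, invT_word, map_smul, smul_smul, pow_add]

theorem splitSum_rotate {α X : Type*} [AddCommMonoid X]
    (H : List α → List α → List α → List α → List α → X) (u w : List α) :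
    splitSum (fun z v => splitSum (fun u₁ u₂ => splitSum (fun w₁ w₂ => H u₁ u₂ w₁ w₂ v) z) u) w =
      splitSum (fun u₁ u₂ => splitSum (fun w₁ r => splitSum (fun w₂ v => H u₁ u₂ w₁ w₂ v) r) w) u := by
  rw [splitSum_comm]
  exact splitSum_congr fun _ _ _ => splitSum_assoc _ _

/-- The odd `B` is inserted after `A` has acted, so it passes `A(x)` instead of `x`; their degrees
differ by an odd number, which accounts for the minus sign. -/
theorem HasParity.neg_splitSum_markedMid (hA : HasParity 𝒱 1 A) (hB : HasParity 𝒱 1 B)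
    (u w : List (Letter 𝒱)) (a : Letter 𝒱) :
    -splitSum (fun u₁ u₂ => splitSum (fun w₁ w₂ => invT 𝒱 (invT 𝒱 (word u₁)) *
        (TensorAlgebra.ι k (invV 𝒱 (AInfinity.ext0 A (word (u₂ ++ a :: w₁)))) *
          coder 𝒱 B (word w₂))) w) u =
      splitSum (fun w₁ v => splitSum (fun x y => ((-1 : k) ^ par (u ++ a :: w₁) •
        splitSum (fun u₁ u₂ => splitSum (fun w₁ w₂ => invT 𝒱 (word u₁) *
        (TensorAlgebra.ι k (AInfinity.ext0 A (word (u₂ ++ a :: w₁))) * word w₂)) w₁) u) *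
        (TensorAlgebra.ι k (AInfinity.ext0 B (word x)) * word y)) v) w := by
  have e' : coder 𝒱 B = insertAfter (invT 𝒱) B := by simp [hB.coder_eq]
  -- The common summand is named opaquely, so that the sums around it can be rearranged without
  -- unfolding it.
  obtain ⟨H, hH⟩ : ∃ H : List (Letter 𝒱) → List (Letter 𝒱) → List (Letter 𝒱) →
      List (Letter 𝒱) → List (Letter 𝒱) → T k V, ∀ u₁ u₂ w₁ w₂ v, H u₁ u₂ w₁ w₂ v =
      splitSum (fun x y => (-1 : k) ^ (1 + par (u₂ ++ a :: w₁) + par w₂ + 1) • (word u₁ *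
        (TensorAlgebra.ι k (AInfinity.ext0 A (word (u₂ ++ a :: w₁))) * (word w₂ *
        (TensorAlgebra.ι k (AInfinity.ext0 B (word x)) * word y))))) v := ⟨_, fun _ _ _ _ _ => rfl⟩
  trans splitSum (fun z v => splitSum (fun u₁ u₂ => splitSum (fun w₁ w₂ =>
    H u₁ u₂ w₁ w₂ v) z) u) w
  · rw [splitSum_rotate, ← splitSum_neg]
    refine splitSum_congr fun u₁ u₂ hu => ?_
    rw [← splitSum_neg]
    refine splitSum_congr fun w₁ w₂ _ => ?_
    rw [e', insertAfter_word, hA.invV_ext0_word, invT_invT]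
    simp only [mul_splitSum, ← splitSum_neg, hH]
    refine splitSum_congr fun _ _ _ => splitSum_congr fun _ _ _ => ?_
    rw [invT_word, map_smul, pow_succ _ (1 + _ + _)]
    simp only [smul_mul_assoc, mul_smul_comm, smul_smul, ← pow_add, mul_neg_one, neg_smul,
      Fin.val_one]
    congr 3
    ring
  · refine splitSum_congr fun z v _ => ?_
    simp only [smul_splitSum, splitSum_mul, hH]
    refine .trans ?_ (splitSum_comm _ _ _)
    refine splitSum_congr fun u₁ u₂ hu => ?_
    refine .trans ?_ (splitSum_comm _ _ _)
    refine splitSum_congr fun w₁₁ w₁₂ hw => splitSum_congr fun x y _ => ?_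
    rw [invT_word]
    simp only [smul_mul_assoc, smul_smul, mul_assoc]
    rw [← pow_add, ← hu, ← hw]
    congr 1
    apply neg_one_pow_congr
    simp only [par_append, par_cons, Nat.even_add]
    tauto

/-- The five summands are the positions of the mark relative to the blocks of `A` and `B`, in this
order: after both, before both, between them, inside `B`, inside `A`. -/
theorem HasParity.concat_markedLie₂ (hA : HasParity 𝒱 1 A) (hB : HasParity 𝒱 1 B)
    (x : Marked k V) :
    concat k V (markedLie₂ 𝒱 A B x) = coder₂ 𝒱 A B (concat k V x) := by
  have : concat k V ∘ₗ markedLie₂ 𝒱 A B = coder₂ 𝒱 A B ∘ₗ concat k V := by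
    refine tmul_chain_ext (𝒱 := 𝒱) fun u a w => ?_
    have hco : ∀ w₁ : List (Letter 𝒱), (coder 𝒱 A ∘ₗ invT 𝒱) (word (u ++ a :: w₁)) =
        (-1 : k) ^ par (u ++ a :: w₁) • (coder 𝒱 A (word u) * word (a :: w₁) +
        invT 𝒱 (word u) * (TensorAlgebra.ι k (invV 𝒱 a.2) * coder 𝒱 A (word w₁)) +
        splitSum (fun u₁ u₂ => splitSum (fun w₁ w₂ => invT 𝒱 (word u₁) *
        (TensorAlgebra.ι k (AInfinity.ext0 A (word (u₂ ++ a :: w₁))) * word w₂)) w₁) u) := by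
      intro w₁
      rw [LinearMap.comp_apply, invT_word, map_smul, ← concat_word, ← hA.concat_markedLie]
      simp only [markedLie, LinearMap.add_apply, TensorProduct.map_tmul, theta_word, map_add,
        map_splitSum, concat_tmul, Module.End.one_apply, markedEval,
        LinearMap.comp_apply, Fin.val_one, pow_one, ← word_cons]
      simp only [word_append]
    have e : coder₂ 𝒱 A B = insertAfter (coder 𝒱 A ∘ₗ invT 𝒱) B := by simp [hB.coder₂_eq]
    have e' : coder 𝒱 B = insertAfter (invT 𝒱) B := by simp [hB.coder_eq]
    rw [LinearMap.comp_apply, LinearMap.comp_apply, concat_word, e, insertAfter_concat]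
    simp only [hco, smul_add, add_mul, splitSum_add]
    simp only [LinearMap.add_apply, LinearMap.sub_apply, Module.End.mul_apply,
      TensorProduct.map_tmul, theta_word, map_add, map_sub,
      map_splitSum, concat_tmul, Module.End.one_apply, markedEval,
      LinearMap.comp_apply, ← word_cons, ← e]
    have h1 : invT 𝒱 (word u) = _ := invT_word 𝒱 u
    have t1 : coder 𝒱 A (invT 𝒱 (word u)) * (TensorAlgebra.ι k (invV 𝒱 (a.2 : V)) *
        coder 𝒱 B (word w)) = splitSum (fun w₁ v => splitSum (fun x y =>
        (-1 : k) ^ par (u ++ a :: w₁) • (coder 𝒱 A (word u) * word (a :: w₁)) *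
        (TensorAlgebra.ι k (AInfinity.ext0 B (word x)) * word y)) v) w := by
      rw [e', insertAfter_word]
      simp only [mul_splitSum, invT_word, invV_letter, par_append, par_cons, word_cons, map_smul,
        smul_mul_assoc, mul_smul_comm, smul_smul, ← pow_add, mul_assoc]
      refine splitSum_congr fun _ _ _ => splitSum_congr fun _ _ _ => ?_
      congr 2
      ring
    have t2 : word u * (TensorAlgebra.ι k (a.2 : V) * coder₂ 𝒱 A B (word w)) =
        splitSum (fun w₁ v => splitSum (fun x y =>
        (-1 : k) ^ par (u ++ a :: w₁) • (invT 𝒱 (word u) *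
          (TensorAlgebra.ι k (invV 𝒱 a.2) * coder 𝒱 A (word w₁))) *
        (TensorAlgebra.ι k (AInfinity.ext0 B (word x)) * word y)) v) w := by
      rw [e, insertAfter_word]
      simp only [mul_splitSum, LinearMap.comp_apply, invT_word, invV_letter, par_append, par_cons,
        map_smul, smul_mul_assoc, mul_smul_comm, smul_smul, ← pow_add, mul_assoc]
      refine splitSum_congr fun _ _ _ => splitSum_congr fun _ _ _ => ?_
      congr 1
      apply neg_one_pow_congr
      simp only [Nat.even_add]
      tauto
    have t3 := hA.neg_splitSum_markedMid hB u w a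
    rw [← t1, ← t2, ← t3]
    simp only [word_append]
    abel
  exact LinearMap.congr_fun this x

end MarkedOdd

/-! ### The bracket of Lie derivatives on marked words. -/

section MarkedBracket

variable {k V : Type*} [Field k] [AddCommGroup V] [Module k V]

theorem tri_mul_tri (P P' Q Q' : Module.End k (T k V)) (t t' : Module.End k V) :
    tri P t Q * tri P' t' Q' = tri (P * P') (t * t') (Q * Q') := by
  rw [tri, tri, ← TensorProduct.map_mul, ← TensorProduct.map_mul]

theorem tri_one : tri (1 : Module.End k (T k V)) 1 1 = 1 := by
  rw [tri, TensorProduct.map_one, TensorProduct.map_one]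

theorem tri_smul_left (c : k) (P Q : Module.End k (T k V)) (t : Module.End k V) :
    tri (c • P) t Q = c • tri P t Q := TensorProduct.map_smul_left _ _ _

theorem tri_smul_right (c : k) (P Q : Module.End k (T k V)) (t : Module.End k V) :
    tri P t (c • Q) = c • tri P t Q := by
  rw [tri, TensorProduct.map_smul_right, TensorProduct.map_smul_right]

theorem tri_sub_left (P P' Q : Module.End k (T k V)) (t : Module.End k V) :
    tri (P - P') t Q = tri P t Q - tri P' t Q := map_sub_left _ _ _

theorem tri_sub_right (P Q Q' : Module.End k (T k V)) (t : Module.End k V) :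
    tri P t (Q - Q') = tri P t Q - tri P t Q' := by
  rw [tri, map_sub_right, map_sub_right]

theorem theta_sub (φ ψ : Module.End k (T k V)) (f g : Marked k V →ₗ[k] V) :
    theta φ (f - g) ψ = theta φ f ψ - theta φ g ψ := by
  simp only [theta, map_sub_left, map_sub_right, LinearMap.sub_comp]

variable [CharZero k]
variable {𝒱 : ℤ → Submodule k V} [DirectSum.Decomposition 𝒱] {M A B : Cochain k V} {p q : Fin 2}

theorem invV_pow_fin_add (p q : Fin 2) :
    invV 𝒱 ^ ((p + q : Fin 2) : ℕ) = invV 𝒱 ^ (p : ℕ) * invV 𝒱 ^ (q : ℕ) := by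
  fin_cases p <;> fin_cases q <;> simp [invV_mul_invV]

theorem HasParity.markedEval_comp_tri (hA : HasParity 𝒱 p A) (n : ℕ) :
    markedEval A ∘ₗ tri (invT 𝒱 ^ n) (invV 𝒱 ^ n) (invT 𝒱 ^ n) =
      (-1 : k) ^ (n * (p : ℕ)) • (invV 𝒱 ^ n) ∘ₗ markedEval A := by
  have h1 : ∀ w, AInfinity.ext0 A ((invT 𝒱 ^ n) w) =
      (-1 : k) ^ (n * (p : ℕ)) • (invV 𝒱 ^ n) (AInfinity.ext0 A w) := by
    intro w
    induction n generalizing w with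
    | zero => simp
    | succ n ih =>
      rw [pow_succ, Module.End.mul_apply, ih, hA.ext0, map_smul, smul_smul, pow_succ,
        Module.End.mul_apply, ← pow_add, Nat.succ_mul]
  have h2 : ∀ (x : T k V) (a : V) (y : T k V), concat k V ((invT 𝒱 ^ n) x ⊗ₜ ((invV 𝒱 ^ n) a ⊗ₜ
      (invT 𝒱 ^ n) y)) = (invT 𝒱 ^ n) (concat k V (x ⊗ₜ (a ⊗ₜ y))) := by
    intro x a y
    clear h1
    simp only [concat_tmul]
    induction n generalizing x a y with
    | zero => simp
    | succ n ih =>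
      simp only [pow_succ, Module.End.mul_apply, invT_mul, invT_ι] at ih ⊢
      rw [ih]
  refine tmul_chain_ext (𝒱 := 𝒱) fun u a w => ?_
  simp only [LinearMap.comp_apply, LinearMap.smul_apply, TensorProduct.map_tmul, markedEval, h2, h1]

theorem HasParity.markedEval_comp_markedLie (hB : HasParity 𝒱 q B) (A : Cochain k V) :
    markedEval A ∘ₗ markedLie 𝒱 q B = markedEval (AInfinity.circ 𝒱 A B) := by
  refine LinearMap.ext fun x => ?_
  simp only [LinearMap.comp_apply, markedEval, hB.concat_markedLie, ext0_circ]

theorem markedEval_sub (A B : Cochain k V) : markedEval (A - B) = markedEval A - markedEval B := rfl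

theorem markedEval_smul (c : k) (A : Cochain k V) : markedEval (c • A) = c • markedEval A := rfl

/-- Insertions on the same side give the bracket by `coder_bracket`, and insertions on opposite
sides supercommute. If one of them is around the mark, only the nested terms survive, and these add
up to `markedEval` of the bracket. -/
theorem HasParity.markedLie_bracket (hA : HasParity 𝒱 p A) (hB : HasParity 𝒱 q B) :
    markedLie 𝒱 p A * markedLie 𝒱 q B -
        (-1 : k) ^ ((p : ℕ) * q) • (markedLie 𝒱 q B * markedLie 𝒱 p A) =
      markedLie 𝒱 (p + q) (AInfinity.bracket 𝒱 A B) := by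
  have e1 := hA.coder_bracket hB
  have e2 : markedEval (AInfinity.bracket 𝒱 A B) = markedEval A ∘ₗ markedLie 𝒱 q B -
      (-1 : k) ^ ((p : ℕ) * q) • markedEval B ∘ₗ markedLie 𝒱 p A := by
    rw [hA.bracket_eq hB, markedEval_sub, markedEval_smul, hA.markedEval_comp_markedLie,
      hB.markedEval_comp_markedLie]
  have e3 := hA.markedEval_comp_tri (q : ℕ)
  have e4 := hB.markedEval_comp_tri (p : ℕ)
  have e5 := hB.invT_pow_mul_coder p
  have e6 := hA.invT_pow_mul_coder q
  have e7 : invT 𝒱 ^ (q : ℕ) * invT 𝒱 ^ (p : ℕ) = invT 𝒱 ^ (p : ℕ) * invT 𝒱 ^ (q : ℕ) := by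
    rw [← pow_add, ← pow_add, add_comm]
  have e7' : invV 𝒱 ^ (q : ℕ) * invV 𝒱 ^ (p : ℕ) = invV 𝒱 ^ (p : ℕ) * invV 𝒱 ^ (q : ℕ) := by
    rw [← pow_add, ← pow_add, add_comm]
  have e8 : (-1 : k) ^ ((p : ℕ) * q) * (-1 : k) ^ ((p : ℕ) * q) = 1 := by
    rw [← mul_pow]; simp
  have e9 : (q : ℕ) * (p : ℕ) = p * q := mul_comm _ _
  rw [e9] at e3 e6
  have e10 : ∀ A : Cochain k V, markedEval A ∘ₗ (1 : Module.End k (Marked k V)) = markedEval A :=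
    fun _ => rfl
  have e11 : ∀ A : Cochain k V, (1 : Module.End k V) ∘ₗ markedEval A = markedEval A :=
    fun _ => rfl
  rw [markedLie.eq_1 𝒱 (p + q), e2]
  simp only [markedLie, mul_add, add_mul, LinearMap.comp_add, tri_mul_tri, theta_mul_theta,
    tri_mul_theta, theta_mul_tri _ _ _ _ hA.comult_coder comult_one,
    theta_mul_tri _ _ _ _ hB.comult_coder comult_one,
    theta_mul_tri _ _ _ _ (comult_invT_pow (𝒱 := 𝒱) _) hA.comult_coder,
    theta_mul_tri _ _ _ _ (comult_invT_pow (𝒱 := 𝒱) _) hB.comult_coder,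
    List.map_cons, List.map_nil, List.sum_cons, List.sum_nil, add_zero, theta_sub, theta_add,
    theta_smul, smul_add, mul_one, one_mul, invT_pow_fin_add, invV_pow_fin_add, e3, e4, e5, e6, e7,
    e7', ← e1, tri_sub_left, tri_sub_right, tri_smul_left, tri_smul_right, smul_smul, e8,
    theta_smul_left, e10, e11, tri_one, one_smul]
  refine LinearMap.ext fun x => ?_
  simp only [LinearMap.add_apply, LinearMap.sub_apply, LinearMap.smul_apply]
  module

end MarkedBracket

/-! ### Contractions and the brace on marked words. -/

section MarkedBrace

variable {k V : Type*} [Field k] [AddCommGroup V] [Module k V] [CharZero k]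
variable {𝒱 : ℤ → Submodule k V} [DirectSum.Decomposition 𝒱] {M A B : Cochain k V}

variable (𝒱) in
/-- Insertion of a cochain to the left of the mark. -/
abbrev markedLeft (A : Cochain k V) : Module.End k (Marked k V) := tri (coder 𝒱 A) 1 1

variable (𝒱) in
/-- Insertion of two cochains to the left of the mark. -/
abbrev markedLeft₂ (A B : Cochain k V) : Module.End k (Marked k V) := tri (coder₂ 𝒱 A B) 1 1

variable (𝒱) in
/-- Insertion of two odd cochains to the right of the mark. -/
abbrev markedRight₂ (A B : Cochain k V) : Module.End k (Marked k V) := tri 1 1 (coder₂ 𝒱 A B)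

variable (𝒱) in
/-- Insertion of odd cochains, the second one to the left of the mark, the first one around both. -/
abbrev markedIota (M A : Cochain k V) : Module.End k (Marked k V) :=
  markedMid 𝒱 M * markedLeft 𝒱 A + markedLeft 𝒱 A * markedMid 𝒱 M

variable (𝒱) in
/-- Insertion of odd cochains, the second one to the right of the mark, the first one around
both. -/
abbrev markedIota' (M A : Cochain k V) : Module.End k (Marked k V) :=
  markedMid 𝒱 M * markedRight 𝒱 A + markedRight 𝒱 A * markedMid 𝒱 M

variable (𝒱) in
/-- Insertion of odd cochains, the second and the third one to the left of the mark, the first one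
around all. -/
abbrev markedKappa (M A B : Cochain k V) : Module.End k (Marked k V) :=
  markedMid 𝒱 M * markedLeft₂ 𝒱 A B - markedLeft₂ 𝒱 A B * markedMid 𝒱 M +
    markedLeft 𝒱 A * markedIota 𝒱 M B

theorem HasParity.comult_coder_odd (hA : HasParity 𝒱 1 A) :
    Comult (coder 𝒱 A) [(coder 𝒱 A, 1), (invT 𝒱, coder 𝒱 A)] := by
  simpa using hA.comult_coder

theorem comult_invT : Comult (invT 𝒱) [(invT 𝒱, invT 𝒱)] := by
  simpa using comult_invT_pow (𝒱 := 𝒱) 1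

theorem HasParity.comult_coder₂_odd (hA : HasParity 𝒱 1 A) (hB : HasParity 𝒱 1 B) :
    Comult (coder₂ 𝒱 A B) [(coder₂ 𝒱 A B, 1), (coder 𝒱 A * invT 𝒱, coder 𝒱 B),
      (1, coder₂ 𝒱 A B)] := by
  simpa [invT_mul_invT] using hA.comult_coder₂ hB

theorem HasParity.invT_mul_coder_odd (hA : HasParity 𝒱 1 A) :
    invT 𝒱 * coder 𝒱 A = (-1 : k) • (coder 𝒱 A * invT 𝒱) := by
  simpa using hA.invT_pow_mul_coder 1

theorem HasParity.invT_mul_coder_odd' (hA : HasParity 𝒱 1 A) (X : Module.End k (T k V)) :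
    invT 𝒱 * (coder 𝒱 A * X) = (-1 : k) • (coder 𝒱 A * (invT 𝒱 * X)) := by
  rw [← mul_assoc, hA.invT_mul_coder_odd, smul_mul_assoc, mul_assoc]

theorem HasParity.invT_mul_coder₂_odd (hA : HasParity 𝒱 1 A) (hB : HasParity 𝒱 1 B) :
    invT 𝒱 * coder₂ 𝒱 A B = coder₂ 𝒱 A B * invT 𝒱 := by
  refine LinearMap.ext fun w => ?_
  simpa using hA.invT_coder₂ hB w

theorem theta_one_mul_markedMid (f : Marked k V →ₗ[k] V) (B : Cochain k V) :
    theta 1 f 1 * markedMid 𝒱 B = theta (invT 𝒱) (f ∘ₗ markedMid 𝒱 B) 1 := by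
  have := theta_mul_theta (𝒱 := 𝒱) 1 1 f (markedEval B) 1
  simpa using this

/-- In the anticommutator the terms with `A` outside the block of `M` cancel, and those with `A`
inside remain. The outer operator is `1`, since the two odd signs cancel. -/
theorem HasParity.markedIota_eq (hA : HasParity 𝒱 1 A) (M : Cochain k V) :
    markedIota 𝒱 M A = theta 1 (markedEval M ∘ₗ markedLeft 𝒱 A) 1 := by
  have e1 : ∀ f : Marked k V →ₗ[k] V, (1 : Module.End k V) ∘ₗ f = f := fun _ => rfl
  have e10 : ∀ f : Marked k V →ₗ[k] V, f ∘ₗ (1 : Module.End k (Marked k V)) = f := fun _ => rfl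
  refine LinearMap.ext fun x => ?_
  simp only [markedIota, tri_mul_theta, theta_mul_tri _ _ _ _ hA.comult_coder_odd comult_one,
    List.map_cons, List.map_nil, List.sum_cons, List.sum_nil, add_zero, mul_one,
    hA.invT_mul_coder_odd, theta_smul_left, invT_mul_invT, LinearMap.add_apply,
    LinearMap.smul_apply, e1, tri_one, e10]
  module

theorem HasParity.markedEval_comp_tri_one (hM : HasParity 𝒱 1 M) :
    markedEval M ∘ₗ tri (invT 𝒱) (invV 𝒱) (invT 𝒱) = (-1 : k) • invV 𝒱 ∘ₗ markedEval M := by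
  have := hM.markedEval_comp_tri 1
  simpa using this

theorem HasParity.markedIota'_eq (hM : HasParity 𝒱 1 M) (hA : HasParity 𝒱 1 A) :
    markedIota' 𝒱 M A = theta 1 (markedEval M ∘ₗ markedRight 𝒱 A) 1 := by
  refine LinearMap.ext fun x => ?_
  simp only [markedIota', tri_mul_theta,
    theta_mul_tri _ _ _ _ (comult_invT (𝒱 := 𝒱)) hA.comult_coder_odd,
    List.map_cons, List.map_nil, List.sum_cons, List.sum_nil, add_zero, mul_one, one_mul,
    theta_smul, invT_mul_invT, LinearMap.add_apply, hM.markedEval_comp_tri_one,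
    LinearMap.smul_apply]
  module

/-- The commutator of `markedMid` with `markedLeft₂` leaves the terms with both `A` and `B` inside
the block of `M`, and those with `A` outside and `B` inside. The summand with `markedIota` removes
the latter. -/
theorem HasParity.markedKappa_eq (hA : HasParity 𝒱 1 A) (hB : HasParity 𝒱 1 B) (M : Cochain k V) :
    markedKappa 𝒱 M A B = theta (invT 𝒱) (markedEval M ∘ₗ markedLeft₂ 𝒱 A B) 1 := by
  have e1 : ∀ f : Marked k V →ₗ[k] V, (1 : Module.End k V) ∘ₗ f = f := fun _ => rfl
  have e10 : ∀ f : Marked k V →ₗ[k] V, f ∘ₗ (1 : Module.End k (Marked k V)) = f := fun _ => rfl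
  refine LinearMap.ext fun x => ?_
  simp only [markedKappa, hB.markedIota_eq, tri_mul_theta,
    theta_mul_tri _ _ _ _ (hA.comult_coder₂_odd hB) comult_one,
    List.map_cons, List.map_nil, List.sum_cons, List.sum_nil, add_zero, mul_one,
    hA.invT_mul_coder_odd', hA.invT_mul_coder₂_odd hB, theta_smul_left, invT_mul_invT,
    LinearMap.add_apply, LinearMap.sub_apply,
    LinearMap.smul_apply, tri_one, e1, e10]
  module

/-- Inside the block of `M`, the five positions of the mark in `markedLie₂` occur. Each is rewritten
through products of elementary insertions, with corrections that cancel the configurations where `A`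
or `B` escapes from the block. This form is the one that can be commuted with `L_m`. -/
theorem HasParity.markedMid_brace₂ (hM : HasParity 𝒱 1 M) (hA : HasParity 𝒱 1 A)
    (hB : HasParity 𝒱 1 B) :
    markedMid 𝒱 (AInfinity.brace₂ 𝒱 M A B) =
      markedKappa 𝒱 M A B +
      (markedMid 𝒱 M * markedRight₂ 𝒱 A B - markedRight₂ 𝒱 A B * markedMid 𝒱 M) -
      markedRight 𝒱 B * markedIota' 𝒱 M A +
      (markedIota 𝒱 M A * markedRight 𝒱 B - markedRight 𝒱 B * markedIota 𝒱 M A) +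
      markedIota 𝒱 M A * markedMid 𝒱 B - markedIota' 𝒱 M B * markedMid 𝒱 A := by
  have e1 : markedEval (AInfinity.brace₂ 𝒱 M A B) = markedEval M ∘ₗ markedLie₂ 𝒱 A B := by
    refine LinearMap.ext fun x => ?_
    simp only [LinearMap.comp_apply, markedEval, ext0_brace₂, hA.concat_markedLie₂ hB]
  have e2 : markedEval M ∘ₗ (markedLeft 𝒱 A) ∘ₗ tri (invT 𝒱) (invV 𝒱) (invT 𝒱) =
      invV 𝒱 ∘ₗ (markedEval M ∘ₗ markedLeft 𝒱 A) := by
    have h1 : (markedLeft 𝒱 A) ∘ₗ tri (invT 𝒱) (invV 𝒱) (invT 𝒱) =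
        (-1 : k) • (tri (invT 𝒱) (invV 𝒱) (invT 𝒱) ∘ₗ markedLeft 𝒱 A) := by
      rw [← Module.End.mul_eq_comp, ← Module.End.mul_eq_comp, tri_mul_tri, tri_mul_tri,
        hA.invT_mul_coder_odd, tri_smul_left, smul_smul]
      simp
    rw [h1, LinearMap.comp_smul, ← LinearMap.comp_assoc, hM.markedEval_comp_tri_one,
      LinearMap.smul_comp, smul_smul]
    simp [LinearMap.comp_assoc]
  have e3 : invV 𝒱 ∘ₗ (markedEval M ∘ₗ markedRight 𝒱 A) =
      markedEval M ∘ₗ tri 1 1 (coder 𝒱 A * invT 𝒱) := by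
    have h1 : invV 𝒱 ∘ₗ markedEval M = (-1 : k) •
        (markedEval M ∘ₗ tri (invT 𝒱) (invV 𝒱) (invT 𝒱)) := by
      rw [hM.markedEval_comp_tri_one, smul_smul]; simp
    rw [← LinearMap.comp_assoc, h1, LinearMap.smul_comp, LinearMap.comp_assoc,
      ← Module.End.mul_eq_comp, tri_mul_tri, invT_mul_invT, invV_mul_invV, hA.invT_mul_coder_odd,
      tri_smul_right, LinearMap.comp_smul, smul_smul]
    simp
  have e4 : ∀ f : Marked k V →ₗ[k] V, (1 : Module.End k V) ∘ₗ f = f := fun _ => rfl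
  have e5 : ∀ f : Marked k V →ₗ[k] V, f ∘ₗ (1 : Module.End k (Marked k V)) = f := fun _ => rfl
  have e2' : markedEval M ∘ₗ tri (coder 𝒱 A * invT 𝒱) (invV 𝒱) (invT 𝒱) =
      invV 𝒱 ∘ₗ (markedEval M ∘ₗ markedLeft 𝒱 A) := by
    rw [← e2, ← Module.End.mul_eq_comp, tri_mul_tri, one_mul, one_mul]
  have e6 : ∀ (P Q P' Q' : Module.End k (T k V)) (t t' : Module.End k V),
      tri P t Q ∘ₗ tri P' t' Q' = tri (P * P') (t * t') (Q * Q') :=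
    fun P Q P' Q' t t' => tri_mul_tri P P' Q Q' t t'
  have e7 : ∀ (P Q φ ψ : Module.End k (T k V)) (t : Module.End k V) (f : Marked k V →ₗ[k] V),
      tri P t Q ∘ₗ theta φ f ψ = theta (P * φ) (t ∘ₗ f) (Q * ψ) :=
    fun P Q φ ψ t f => tri_mul_theta φ ψ P Q f t
  rw [markedMid, e1, hA.markedKappa_eq hB, hA.markedIota_eq, hM.markedIota'_eq hA,
    hM.markedIota'_eq hB]
  refine LinearMap.ext fun x => ?_
  simp only [LinearMap.add_apply, LinearMap.sub_apply, theta_one_mul_markedMid, tri_mul_theta,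
    theta_mul_tri _ _ _ _ (comult_invT (𝒱 := 𝒱)) hB.comult_coder_odd,
    theta_mul_tri _ _ _ _ comult_one (hA.comult_coder₂_odd hB),
    List.map_cons, List.map_nil, List.sum_cons, List.sum_nil, add_zero, mul_one, one_mul,
    e3, markedLie₂, LinearMap.comp_add, LinearMap.comp_sub, theta_add, theta_sub,
    LinearMap.comp_assoc, tri_mul_tri, tri_one, e4, e5, e6, e7, e2']
  module

end MarkedBrace

/-! ### Cyclic rotations -/

section Rot

variable {k V : Type*} [Field k] [AddCommGroup V] [Module k V]

/-- Only one parity projection of a homogeneous `x` survives; since `ρ` is an involution, `ρ ^ d`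
depends on the parity of `d` only. -/
theorem koszulFlip_tmul [CharZero k] {M N : Type*} [AddCommGroup M] [Module k M] [AddCommGroup N]
    [Module k N] {σ : Module.End k M} {ρ : Module.End k N} {x : M} {d : ℕ}
    (hx : σ x = (-1 : k) ^ d • x) (hρ : ρ * ρ = 1) (y : N) :
    koszulFlip σ ρ (x ⊗ₜ y) = (ρ ^ d) y ⊗ₜ x := by
  have h2 : (2 : k) ≠ 0 := two_ne_zero
  have key : ∀ p : Fin 2, parityProj σ p x = (2⁻¹ * (1 + (-1) ^ (p : ℕ) * (-1) ^ d) : k) • x := by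
    intro p
    simp only [parityProj, LinearMap.smul_apply, LinearMap.add_apply, Module.End.one_apply, hx]
    module
  have h3 : (2⁻¹ * (1 + 1) : k) = 1 := by field_simp; norm_num
  simp only [koszulFlip, Fin.sum_univ_two, LinearMap.add_apply, LinearMap.comp_apply,
    LinearEquiv.coe_coe, TensorProduct.comm_tmul, TensorProduct.map_tmul, key]
  rcases Nat.even_or_odd d with hd | hd
  · have : ρ ^ d = 1 := by
      obtain ⟨e, rfl⟩ := hd
      rw [← two_mul, pow_mul, pow_two, hρ, one_pow]
    simp [hd.neg_one_pow, this, h3]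
  · have : ρ ^ d = ρ := by
      obtain ⟨e, rfl⟩ := hd
      rw [pow_succ, pow_mul, pow_two, hρ, one_pow, one_mul]
    simp [hd.neg_one_pow, this, h3]

variable {𝒱 : ℤ → Submodule k V} [DirectSum.Decomposition 𝒱] [CharZero k]

theorem invChain_word {v : V} {d : ℕ} (hv : invV 𝒱 v = (-1 : k) ^ d • v) (l : List (Letter 𝒱)) :
    invChain 𝒱 (v ⊗ₜ word l) = (-1 : k) ^ (d + par l) • (v ⊗ₜ word l) := by
  rw [invChain_tmul, hv, invT_word, TensorProduct.smul_tmul_smul, ← pow_add]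

theorem rot_tmul_word {v : V} {d : ℕ} (hv : invV 𝒱 v = (-1 : k) ^ d • v) (l : List (Letter 𝒱)) :
    rot 𝒱 (v ⊗ₜ word l) = splitSum (fun x y =>
      (-1 : k) ^ ((d + par x) * par y) • (word y ⊗ₜ[k] (v ⊗ₜ[k] word x))) l := by
  simp only [rot, LinearMap.comp_apply, LinearMap.lTensor_tmul, deconc_word, tmul_splitSum,
    map_splitSum, LinearEquiv.coe_coe, TensorProduct.assoc_symm_tmul]
  refine splitSum_congr fun x y _ => ?_
  rw [koszulFlip_tmul (invChain_word hv x) (invT_mul_invT 𝒱), invT_pow_word,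
    TensorProduct.smul_tmul']

theorem rot_letter_word (a : Letter 𝒱) (l : List (Letter 𝒱)) :
    rot 𝒱 ((a.2 : V) ⊗ₜ word l) = splitSum (fun x y =>
      (-1 : k) ^ ((a.1.natAbs + par x) * par y) • (word y ⊗ₜ[k] ((a.2 : V) ⊗ₜ[k] word x))) l :=
  rot_tmul_word (invV_letter 𝒱 a) l

variable (𝒱) in
-- The summand in which no letter is moved in front is the chain itself, and the counit of the front
-- factor selects it. This allows identities between operators on chains to be checked on marked
-- words.
theorem rot_injective : Function.Injective (rot 𝒱) := by
  have : (TensorProduct.lid k (Chain k V)).toLinearMap ∘ₗ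
      LinearMap.rTensor (Chain k V) (counit k V).toLinearMap ∘ₗ rot 𝒱 = LinearMap.id := by
    refine chain_ext (𝒱 := 𝒱) fun a l => ?_
    simp only [LinearMap.comp_apply, rot_letter_word, map_splitSum, map_smul,
      LinearMap.rTensor_tmul, LinearEquiv.coe_coe, AlgHom.toLinearMap_apply,
      TensorProduct.lid_tmul]
    rw [splitSum_eq_nil_right]
    · simp [counit_word_nil, par_nil]
    · intro x b y
      simp [counit_word_cons]
  exact Function.LeftInverse.injective (g := fun x => (TensorProduct.lid k (Chain k V))
    (LinearMap.rTensor (Chain k V) (counit k V).toLinearMap x)) fun x => LinearMap.congr_fun this x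

theorem splitSum_rotate' {α X : Type*} [AddCommMonoid X]
    (H : List α → List α → List α → List α → X) (l : List α) :
    splitSum (fun x y => splitSum (fun x₁ x₂ => splitSum (fun z t => H x₁ z t y) x₂) x) l =
      splitSum (fun x r => splitSum (fun t y => splitSum (fun x₁ z => H x₁ z t y) x) r) l := by
  simp only [← splitSum_assoc (fun x₁ z t => H x₁ z t _)]
  exact splitSum_assoc (fun x' t y => splitSum (fun x₁ z => H x₁ z t y) x') l

variable (k V) in
/-- The operator on chains that corresponds to `theta`. -/
def cyclic (𝒱 : ℤ → Submodule k V) [DirectSum.Decomposition 𝒱] (f : Marked k V →ₗ[k] V) :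
    Module.End k (Chain k V) :=
  LinearMap.rTensor (T k V) f ∘ₗ coactR k V ∘ₗ rot 𝒱

theorem coactR_word (u w : List (Letter 𝒱)) (a : V) :
    coactR k V (word u ⊗ₜ (a ⊗ₜ word w)) =
      splitSum (fun x y => (word u ⊗ₜ[k] (a ⊗ₜ[k] word x)) ⊗ₜ[k] word y) w := by
  simp [coactR, deconc_word, tmul_splitSum, map_splitSum]

/-- Cutting the cyclic word open after `f` has consumed an arc around `a₀`, or cutting it first and
letting `f` consume a block around the mark, produces the same configurations. The hypothesis says
that `f` has parity `n`. -/
theorem rot_cyclic {f : Marked k V →ₗ[k] V} {n : ℕ}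
    (hf : f ∘ₗ tri (invT 𝒱) (invV 𝒱) (invT 𝒱) = (-1 : k) ^ n • invV 𝒱 ∘ₗ f) :
    rot 𝒱 ∘ₗ cyclic k V 𝒱 f = theta (invT 𝒱 ^ n) f 1 ∘ₗ rot 𝒱 := by
  have hv : ∀ (u : List (Letter 𝒱)) (a : Letter 𝒱) (w : List (Letter 𝒱)),
      invV 𝒱 (f (word u ⊗ₜ ((a.2 : V) ⊗ₜ word w))) =
        (-1 : k) ^ (n + (par u + (a.1.natAbs + par w))) • f (word u ⊗ₜ ((a.2 : V) ⊗ₜ word w)) := by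
    intro u a w
    have := LinearMap.congr_fun hf (word u ⊗ₜ ((a.2 : V) ⊗ₜ word w))
    simp only [LinearMap.comp_apply, TensorProduct.map_tmul, invT_word, invV_letter,
      LinearMap.smul_apply, ← TensorProduct.smul_tmul', TensorProduct.tmul_smul, smul_smul,
      ← pow_add, map_smul] at this
    have h2 := congrArg (fun v => (-1 : k) ^ n • v) this
    simp only [smul_smul, ← pow_add] at h2
    rw [Even.neg_one_pow ⟨n, rfl⟩, one_smul] at h2
    rw [← h2]
    congr 2; ring
  refine chain_ext (𝒱 := 𝒱) fun a l => ?_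
  simp only [LinearMap.comp_apply, cyclic, rot_letter_word, map_splitSum, map_smul, coactR_word,
    LinearMap.rTensor_tmul, theta_word, rot_tmul_word (hv _ _ _), smul_splitSum, invT_pow_word,
    Module.End.one_apply]
  trans splitSum (fun x y => splitSum (fun x₁ x₂ => splitSum (fun z t =>
      (-1 : k) ^ ((a.1.natAbs + par x₁ + par z) * (par t + par y) + n * par t) •
        (word t ⊗ₜ[k] (f (word y ⊗ₜ ((a.2 : V) ⊗ₜ word x₁)) ⊗ₜ[k] word z))) x₂) x) l
  · refine splitSum_congr fun x y _ => splitSum_congr fun x₁ x₂ hx => splitSum_congr fun z t hz => ?_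
    subst hx; subst hz
    rw [smul_smul, ← pow_add]
    congr 1
    -- The two Koszul exponents differ by an even number: `y` and `t` are exchanged twice.
    have : (a.1.natAbs + par (x₁ ++ (z ++ t))) * par y +
        (n + (par y + (a.1.natAbs + par x₁)) + par z) * par t =
        (a.1.natAbs + par x₁ + par z) * (par t + par y) + n * par t + 2 * (par y * par t) := by
      simp only [par_append]; ring
    rw [this, pow_add _ _ (2 * _), pow_mul, neg_one_sq, one_pow, mul_one]
  · rw [splitSum_rotate' (fun x₁ z t y =>
      (-1 : k) ^ ((a.1.natAbs + par x₁ + par z) * (par t + par y) + n * par t) •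
        (word t ⊗ₜ[k] (f (word y ⊗ₜ ((a.2 : V) ⊗ₜ word x₁)) ⊗ₜ[k] word z)))]
    refine splitSum_congr fun x r _ => splitSum_congr fun t y hr => splitSum_congr fun x₁ z hx => ?_
    subst hr; subst hx
    rw [← TensorProduct.smul_tmul', smul_smul, ← pow_add, par_append, par_append]
    congr 2; ring

variable {M A B : Cochain k V} {p q : Fin 2}

/-- The block of `A` avoids `a₀`, so after the cut it lies either to the left or to the right of the
mark. -/
theorem HasParity.rot_map_coder (hA : HasParity 𝒱 p A) :
    rot 𝒱 ∘ₗ TensorProduct.map (invV 𝒱 ^ (p : ℕ)) (coder 𝒱 A) =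
      (tri (coder 𝒱 A) 1 1 + tri (invT 𝒱 ^ (p : ℕ)) (invV 𝒱 ^ (p : ℕ)) (coder 𝒱 A)) ∘ₗ rot 𝒱 := by
  refine chain_ext (𝒱 := 𝒱) fun a l => ?_
  have h1 : ∀ x : List (Letter 𝒱), invChain 𝒱 ((a.2 : V) ⊗ₜ coder 𝒱 A (word x)) =
      (-1 : k) ^ (a.1.natAbs + p + par x) • ((a.2 : V) ⊗ₜ coder 𝒱 A (word x)) := by
    intro x
    rw [invChain_tmul, hA.invT_coder, invV_letter, invT_word, map_smul, TensorProduct.tmul_smul,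
      TensorProduct.tmul_smul, ← TensorProduct.smul_tmul', smul_smul, smul_smul]
    congr 1; ring
  have h2 : ∀ (n : ℕ) (y : List (Letter 𝒱)), (invT 𝒱 ^ n) (coder 𝒱 A (word y)) =
      (-1 : k) ^ (n * (p + par y)) • coder 𝒱 A (word y) := by
    intro n y
    induction n with
    | zero => simp
    | succ n ih =>
      rw [pow_succ', Module.End.mul_apply, ih, map_smul, hA.invT_coder, invT_word, map_smul,
        smul_smul, smul_smul]
      congr 1; ring
  simp only [LinearMap.comp_apply, LinearMap.add_apply, rot_letter_word, map_splitSum, map_smul,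
    TensorProduct.map_tmul, Module.End.one_apply, invV_pow_letter, ← TensorProduct.smul_tmul']
  simp only [rot, LinearMap.comp_apply, LinearMap.lTensor_tmul, hA.deconc_coder, deconc_word,
    TensorProduct.map_tmul, TensorProduct.tmul_add, map_add, map_splitSum, tmul_splitSum,
    TensorProduct.assoc_symm_tmul, LinearEquiv.coe_coe, LinearMap.id_apply, invT_pow_word,
    TensorProduct.tmul_smul, ← TensorProduct.smul_tmul', map_smul,
    koszulFlip_tmul (h1 _) (invT_mul_invT 𝒱),
    koszulFlip_tmul (invChain_word (invV_letter 𝒱 a) _) (invT_mul_invT 𝒱), h2, smul_add,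
    smul_splitSum, smul_smul, ← pow_add]
  rw [← splitSum_add]
  refine splitSum_congr fun x y _ => ?_
  rw [add_comm]
  congr 2 <;> (apply neg_one_pow_congr; simp only [Nat.even_add, Nat.even_mul]; tauto)

/-- Here `A` precedes `B` in the linear word that follows `a₀`. A cut between the blocks brings `B`
to the left of the mark and leaves `A` to its right. -/
theorem HasParity.rot_map_coder₂ (hA : HasParity 𝒱 1 A) (hB : HasParity 𝒱 1 B) :
    rot 𝒱 ∘ₗ TensorProduct.map 1 (coder₂ 𝒱 A B) =
      (markedLeft₂ 𝒱 A B + markedRight₂ 𝒱 A B + markedRight 𝒱 A * markedLeft 𝒱 B) ∘ₗ rot 𝒱 := by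
  refine chain_ext (𝒱 := 𝒱) fun a l => ?_
  have h1 : ∀ x : List (Letter 𝒱), invChain 𝒱 ((a.2 : V) ⊗ₜ coder 𝒱 A (word x)) =
      (-1 : k) ^ (a.1.natAbs + 1 + par x) • ((a.2 : V) ⊗ₜ coder 𝒱 A (word x)) := by
    intro x
    rw [invChain_tmul, hA.invT_coder, invV_letter, invT_word, map_smul, TensorProduct.tmul_smul,
      TensorProduct.tmul_smul, ← TensorProduct.smul_tmul', smul_smul, smul_smul]
    congr 1; simp; ring
  have h1' : ∀ x : List (Letter 𝒱), invChain 𝒱 ((a.2 : V) ⊗ₜ coder₂ 𝒱 A B (word x)) =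
      (-1 : k) ^ (a.1.natAbs + par x) • ((a.2 : V) ⊗ₜ coder₂ 𝒱 A B (word x)) := by
    intro x
    rw [invChain_tmul, hA.invT_coder₂ hB, invV_letter, invT_word, map_smul,
      TensorProduct.tmul_smul,
      TensorProduct.tmul_smul, ← TensorProduct.smul_tmul', smul_smul, smul_smul]
    congr 1; simp; ring
  have h2 : ∀ (n : ℕ) (y : List (Letter 𝒱)), (invT 𝒱 ^ n) (coder 𝒱 B (word y)) =
      (-1 : k) ^ (n * (1 + par y)) • coder 𝒱 B (word y) := by
    intro n y
    induction n with
    | zero => simp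
    | succ n ih =>
      rw [pow_succ', Module.End.mul_apply, ih, map_smul, hB.invT_coder, invT_word, map_smul,
        smul_smul, smul_smul]
      congr 1; simp; ring
  have h2' : ∀ (n : ℕ) (y : List (Letter 𝒱)), (invT 𝒱 ^ n) (coder₂ 𝒱 A B (word y)) =
      (-1 : k) ^ (n * par y) • coder₂ 𝒱 A B (word y) := by
    intro n y
    induction n with
    | zero => simp
    | succ n ih =>
      rw [pow_succ', Module.End.mul_apply, ih, map_smul, hA.invT_coder₂ hB, invT_word, map_smul,
        smul_smul, smul_smul]
      congr 1; simp; ring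
  have h3 : ∀ y : List (Letter 𝒱), invT 𝒱 (coder 𝒱 B (word y)) =
      (-1 : k) ^ (1 + par y) • coder 𝒱 B (word y) := by
    intro y; simpa using h2 1 y
  simp only [LinearMap.comp_apply, LinearMap.add_apply, rot_letter_word, map_splitSum, map_smul,
    TensorProduct.map_tmul, Module.End.one_apply, Module.End.mul_apply, invV_letter, h3,
    ← TensorProduct.smul_tmul', TensorProduct.tmul_smul]
  simp only [rot, LinearMap.comp_apply, LinearMap.lTensor_tmul, hA.deconc_coder₂ hB, deconc_word,
    TensorProduct.map_tmul, TensorProduct.tmul_add, map_add, map_splitSum, tmul_splitSum,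
    TensorProduct.assoc_symm_tmul, LinearEquiv.coe_coe, LinearMap.id_apply, Module.End.mul_apply,
    invT_pow_word, TensorProduct.tmul_smul, ← TensorProduct.smul_tmul', map_smul,
    koszulFlip_tmul (h1 _) (invT_mul_invT 𝒱), koszulFlip_tmul (h1' _) (invT_mul_invT 𝒱),
    koszulFlip_tmul (invChain_word (invV_letter 𝒱 a) _) (invT_mul_invT 𝒱), h2, h2', smul_add,
    smul_smul, ← pow_add]
  rw [← splitSum_add, ← splitSum_add]
  refine splitSum_congr fun x y _ => ?_
  rw [add_comm, ← add_assoc]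
  simp only [Fin.isValue, Fin.val_one, one_mul]
  congr 2
  · congr 1; apply neg_one_pow_congr; simp only [Nat.even_add, Nat.even_mul, Nat.not_even_one]; tauto
  · apply neg_one_pow_congr; simp only [Nat.even_add, Nat.even_mul, Nat.not_even_one]; tauto

theorem rTensor_ext0_comp_wrap (A : Cochain k V) :
    LinearMap.rTensor (T k V) (ext0 A) ∘ₗ wrap =
      LinearMap.rTensor (T k V) (markedEval A) ∘ₗ coactR k V := by
  rw [markedEval, LinearMap.rTensor_comp]
  rfl

theorem HasParity.lie_eq (hA : HasParity 𝒱 p A) :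
    lie 𝒱 A = TensorProduct.map (invV 𝒱 ^ (p : ℕ)) (coder 𝒱 A) +
      cyclic k V 𝒱 (markedEval A) := by
  have h0 : coder 𝒱 (0 : Cochain k V) = 0 := by
    rw [(HasParity.zero (q := 0)).coder_eq, insertAfter_zero_right]
  rw [lie, cyclic, ← LinearMap.comp_assoc, rTensor_ext0_comp_wrap, LinearMap.comp_assoc]
  congr 1
  simp only [hA.part_eq]
  rw [Finset.sum_eq_single p]
  · simp
  · intro q _ hq
    rw [if_neg hq, h0, TensorProduct.map_zero_right]
  · simp

/-- The cochain `A` acts on the part rotated in front of `a₀`, that is, to the left of the mark. -/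
theorem contr_eq (M A : Cochain k V) :
    contr 𝒱 M A = cyclic k V 𝒱 (markedEval M ∘ₗ markedLeft 𝒱 A) := by
  have : coactR k V ∘ₗ LinearMap.rTensor (Chain k V) (coder 𝒱 A) =
      LinearMap.rTensor (T k V) (markedLeft 𝒱 A) ∘ₗ coactR k V := by
    refine tmul_chain_ext (𝒱 := 𝒱) fun u a l => ?_
    simp [coactR, deconc_word, tmul_splitSum, map_splitSum]
  rw [contr, cyclic, ← LinearMap.comp_assoc, rTensor_ext0_comp_wrap, LinearMap.rTensor_comp]
  simp only [LinearMap.comp_assoc]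
  rw [← LinearMap.comp_assoc _ _ (coactR k V), this, LinearMap.comp_assoc]

theorem HasParity.rot_lie (hA : HasParity 𝒱 p A) :
    rot 𝒱 ∘ₗ lie 𝒱 A = markedLie 𝒱 p A ∘ₗ rot 𝒱 := by
  rw [hA.lie_eq, LinearMap.comp_add, hA.rot_map_coder, rot_cyclic (n := p), ← LinearMap.add_comp]
  · rfl
  · simpa using hA.markedEval_comp_tri 1

theorem HasParity.markedEval_markedLeft_comp_tri (hM : HasParity 𝒱 1 M) (hA : HasParity 𝒱 1 A) :
    (markedEval M ∘ₗ markedLeft 𝒱 A) ∘ₗ tri (invT 𝒱) (invV 𝒱) (invT 𝒱) =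
      (-1 : k) ^ 0 • invV 𝒱 ∘ₗ (markedEval M ∘ₗ markedLeft 𝒱 A) := by
  have h1 : (markedLeft 𝒱 A) ∘ₗ tri (invT 𝒱) (invV 𝒱) (invT 𝒱) =
      (-1 : k) • (tri (invT 𝒱) (invV 𝒱) (invT 𝒱) ∘ₗ markedLeft 𝒱 A) := by
    rw [← Module.End.mul_eq_comp, ← Module.End.mul_eq_comp, tri_mul_tri, tri_mul_tri,
      hA.invT_mul_coder_odd, tri_smul_left, smul_smul]
    simp
  rw [LinearMap.comp_assoc, h1, LinearMap.comp_smul, ← LinearMap.comp_assoc,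
    hM.markedEval_comp_tri_one, LinearMap.smul_comp, smul_smul]
  simp [LinearMap.comp_assoc]

theorem HasParity.markedEval_markedLeft₂_comp_tri (hM : HasParity 𝒱 1 M) (hA : HasParity 𝒱 1 A)
    (hB : HasParity 𝒱 1 B) :
    (markedEval M ∘ₗ markedLeft₂ 𝒱 A B) ∘ₗ tri (invT 𝒱) (invV 𝒱) (invT 𝒱) =
      (-1 : k) ^ 1 • invV 𝒱 ∘ₗ (markedEval M ∘ₗ markedLeft₂ 𝒱 A B) := by
  have h1 : (markedLeft₂ 𝒱 A B) ∘ₗ tri (invT 𝒱) (invV 𝒱) (invT 𝒱) =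
      tri (invT 𝒱) (invV 𝒱) (invT 𝒱) ∘ₗ markedLeft₂ 𝒱 A B := by
    rw [← Module.End.mul_eq_comp, ← Module.End.mul_eq_comp, tri_mul_tri, tri_mul_tri,
      hA.invT_mul_coder₂_odd hB]
    simp
  rw [LinearMap.comp_assoc, h1, ← LinearMap.comp_assoc,
    hM.markedEval_comp_tri_one, LinearMap.smul_comp]
  simp [LinearMap.comp_assoc]

theorem HasParity.rot_contr (hM : HasParity 𝒱 1 M) (hA : HasParity 𝒱 1 A) :
    rot 𝒱 ∘ₗ contr 𝒱 M A = markedIota 𝒱 M A ∘ₗ rot 𝒱 := by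
  rw [contr_eq, rot_cyclic (hM.markedEval_markedLeft_comp_tri hA), hA.markedIota_eq, pow_zero]

variable (𝒱) in
/-- The second order contraction. -/
def contr₂ (M A B : Cochain k V) : Module.End k (Chain k V) :=
  cyclic k V 𝒱 (markedEval M ∘ₗ markedLeft₂ 𝒱 A B)

theorem HasParity.rot_contr₂ (hM : HasParity 𝒱 1 M) (hA : HasParity 𝒱 1 A)
    (hB : HasParity 𝒱 1 B) :
    rot 𝒱 ∘ₗ contr₂ 𝒱 M A B = markedKappa 𝒱 M A B ∘ₗ rot 𝒱 := by
  rw [contr₂, rot_cyclic (hM.markedEval_markedLeft₂_comp_tri hA hB), hA.markedKappa_eq hB, pow_one]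

variable (𝒱) in
/-- The second order Lie derivative along odd cochains. -/
def lie₂ (A B : Cochain k V) : Module.End k (Chain k V) :=
  TensorProduct.map 1 (coder₂ 𝒱 A B) -
    TensorProduct.map (invV 𝒱) (coder 𝒱 B) * cyclic k V 𝒱 (markedEval A) + contr 𝒱 A B

/-- The three ingredients of `lie₂` have known lifts, so that `lie₂` exists on chains as a homotopy
between `L_{A ∪ B}` and `L_A i_B + i_A L_B`. -/
theorem HasParity.rot_lie₂ (hA : HasParity 𝒱 1 A) (hB : HasParity 𝒱 1 B) :
    rot 𝒱 ∘ₗ lie₂ 𝒱 A B = (markedLeft₂ 𝒱 A B + markedRight₂ 𝒱 A B +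
      markedRight 𝒱 A * markedLeft 𝒱 B - markedRight 𝒱 B * markedMid 𝒱 A +
      markedMid 𝒱 A * markedLeft 𝒱 B) ∘ₗ rot 𝒱 := by
  have e1 : rot 𝒱 ∘ₗ cyclic k V 𝒱 (markedEval A) = markedMid 𝒱 A ∘ₗ rot 𝒱 := by
    rw [rot_cyclic (n := 1), pow_one]
    simpa using hA.markedEval_comp_tri 1
  have e2 := hB.rot_map_coder
  simp only [Fin.isValue, Fin.val_one, pow_one] at e2
  refine LinearMap.ext fun x => ?_
  have e1' := fun y => LinearMap.congr_fun e1 y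
  have e2' := fun y => LinearMap.congr_fun e2 y
  have e3' := fun y => LinearMap.congr_fun (hA.rot_map_coder₂ hB) y
  have e4' := fun y => LinearMap.congr_fun (hA.rot_contr hB) y
  simp only [LinearMap.comp_apply, Module.End.mul_apply, LinearMap.add_apply] at e1' e2' e3' e4'
  simp only [lie₂, LinearMap.comp_apply, LinearMap.add_apply, LinearMap.sub_apply, map_add, map_sub,
    Module.End.mul_apply, e1', e2', e3', e4']
  abel

end Rot

/-! ### Convolution of power series -/

section Convolution

variable {n : ℕ}

/-- The convolution of a family that depends on two exponents. -/
def conv₂ {P : Type*} [AddCommGroup P] (F : (Fin n →₀ ℕ) → (Fin n →₀ ℕ) → P) : Series n P :=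
  fun e => ∑ p ∈ Finset.HasAntidiagonal.antidiagonal e, F p.1 p.2

/-- The convolution of a family that depends on three exponents. -/
def conv₃ {P : Type*} [AddCommGroup P]
    (F : (Fin n →₀ ℕ) → (Fin n →₀ ℕ) → (Fin n →₀ ℕ) → P) : Series n P :=
  conv₂ fun a b => conv₂ (F a) b

section Group

variable {P Q X Y : Type*} [AddCommGroup P] [AddCommGroup Q] [AddCommGroup Y]

theorem convol_eq_conv₂ (op : X → Y → P) (f : Series n X) (g : Series n Y) :
    convol op f g = conv₂ fun a b => op (f a) (g b) := rfl

theorem conv₂_swap (F : (Fin n →₀ ℕ) → (Fin n →₀ ℕ) → P) :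
    conv₂ F = conv₂ fun b a => F a b := by
  funext e
  simp only [conv₂]
  conv_lhs => rw [← Finset.HasAntidiagonal.map_swap_antidiagonal, Finset.sum_map]
  rfl

theorem conv₃_eq (F : (Fin n →₀ ℕ) → (Fin n →₀ ℕ) → (Fin n →₀ ℕ) → P) :
    conv₃ F = conv₂ fun b c => conv₂ (fun x y => F x y c) b := by
  funext e
  simp only [conv₃, conv₂]
  rw [Finset.sum_sigma', Finset.sum_sigma']
  refine Finset.sum_nbij' (fun x => ⟨(x.1.1 + x.2.1, x.2.2), (x.1.1, x.2.1)⟩)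
    (fun x => ⟨(x.2.1, x.2.2 + x.1.2), (x.2.2, x.1.2)⟩) ?_ ?_ ?_ ?_ (fun _ _ => rfl) <;>
  · rintro ⟨⟨a, b⟩, ⟨c, d⟩⟩ h
    simp only [Finset.mem_sigma, Finset.HasAntidiagonal.mem_antidiagonal] at h ⊢
    obtain ⟨rfl, rfl⟩ := h
    simp [add_assoc]

theorem conv₃_swap_right (F : (Fin n →₀ ℕ) → (Fin n →₀ ℕ) → (Fin n →₀ ℕ) → P) :
    conv₃ F = conv₃ fun a c b => F a b c := by
  simp only [conv₃]
  congr 1; funext a b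
  rw [conv₂_swap]

theorem conv₃_swap_left (F : (Fin n →₀ ℕ) → (Fin n →₀ ℕ) → (Fin n →₀ ℕ) → P) :
    conv₃ F = conv₃ fun b a c => F a b c := by
  rw [conv₃_eq, conv₃_eq]
  congr 1; funext a b
  rw [conv₂_swap]

theorem conv₂_map {φ : P → Q} (hφ : ∀ x y, φ (x + y) = φ x + φ y)
    (F : (Fin n →₀ ℕ) → (Fin n →₀ ℕ) → P) :
    (fun e => φ (conv₂ F e)) = conv₂ fun a b => φ (F a b) := by
  funext e
  exact map_sum (AddMonoidHom.mk' φ hφ) _ _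

theorem conv₃_map {φ : P → Q} (hφ : ∀ x y, φ (x + y) = φ x + φ y)
    (F : (Fin n →₀ ℕ) → (Fin n →₀ ℕ) → (Fin n →₀ ℕ) → P) :
    (fun e => φ (conv₃ F e)) = conv₃ fun a b c => φ (F a b c) := by
  rw [conv₃, conv₂_map hφ, conv₃]
  congr 1; funext a b
  exact congrFun (conv₂_map hφ _) b

theorem conv₂_map_eq_zero {φ : P → Q} (hφ : ∀ x y, φ (x + y) = φ x + φ y)
    {F : (Fin n →₀ ℕ) → (Fin n →₀ ℕ) → P} (hF : conv₂ F = 0) :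
    conv₂ (fun a b => φ (F a b)) = 0 := by
  rw [← conv₂_map hφ, hF]
  funext e
  exact map_zero (AddMonoidHom.mk' φ hφ)

theorem conv₂_add (F G : (Fin n →₀ ℕ) → (Fin n →₀ ℕ) → P) :
    conv₂ F + conv₂ G = conv₂ fun a b => F a b + G a b := by
  funext e
  simp only [conv₂, Pi.add_apply, Finset.sum_add_distrib]

theorem conv₃_add (F G : (Fin n →₀ ℕ) → (Fin n →₀ ℕ) → (Fin n →₀ ℕ) → P) :
    conv₃ F + conv₃ G = conv₃ fun a b c => F a b c + G a b c := by
  simp only [conv₃, conv₂_add]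
  funext e
  simp only [conv₂, Finset.sum_add_distrib]

theorem conv₂_sub (F G : (Fin n →₀ ℕ) → (Fin n →₀ ℕ) → P) :
    conv₂ F - conv₂ G = conv₂ fun a b => F a b - G a b := by
  funext e
  simp only [conv₂, Pi.sub_apply, Finset.sum_sub_distrib]

theorem conv₃_sub (F G : (Fin n →₀ ℕ) → (Fin n →₀ ℕ) → (Fin n →₀ ℕ) → P) :
    conv₃ F - conv₃ G = conv₃ fun a b c => F a b c - G a b c := by
  simp only [conv₃, conv₂_sub]
  funext e
  simp only [conv₂, Finset.sum_sub_distrib]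

end Group

section Ring

variable {R : Type*} [Ring R]

/-- A family of coefficients, as a power series. -/
def ser (f : Series n R) : MvPowerSeries (Fin n) R := f

theorem ser_add (f g : Series n R) : ser (f + g) = ser f + ser g := rfl

theorem ser_sub (f g : Series n R) : ser (f - g) = ser f - ser g := rfl

variable (f g h : Series n R)

theorem ser_mul : ser f * ser g = ser (conv₂ fun a b => f a * g b) :=
  MvPowerSeries.ext fun _ => MvPowerSeries.coeff_mul _ _ _

theorem ser_mul_conv₂ (G : (Fin n →₀ ℕ) → (Fin n →₀ ℕ) → R) :
    ser f * ser (conv₂ G) = ser (conv₃ fun a b c => f a * G b c) := by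
  rw [ser_mul]
  congr 1
  funext e
  simp only [conv₃, conv₂, Finset.mul_sum]

theorem conv₂_ser_mul (G : (Fin n →₀ ℕ) → (Fin n →₀ ℕ) → R) :
    ser (conv₂ G) * ser f = ser (conv₃ fun c a b => G a b * f c) := by
  rw [ser_mul, conv₃_swap_left, conv₃_swap_right, conv₃_eq]
  congr 1
  funext e
  simp only [conv₂, Finset.sum_mul]

/-- The subscript lists the exponents attached to the factors. With all six versions, products of
three series in any order become convolutions over the same triple `(a, b, c)`, where
coefficientwise identities apply. -/
theorem ser_mul_mul₁₂₃ : ser f * ser g * ser h = ser (conv₃ fun a b c => f a * g b * h c) := by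
  rw [ser_mul f g, conv₂_ser_mul, conv₃_swap_left, conv₃_swap_right]

theorem ser_mul_mul₁₃₂ : ser f * ser g * ser h = ser (conv₃ fun a b c => f a * g c * h b) := by
  rw [ser_mul_mul₁₂₃, conv₃_swap_right]

theorem ser_mul_mul₂₁₃ : ser f * ser g * ser h = ser (conv₃ fun a b c => f b * g a * h c) := by
  rw [ser_mul_mul₁₂₃, conv₃_swap_left]

theorem ser_mul_mul₃₁₂ : ser f * ser g * ser h = ser (conv₃ fun a b c => f c * g a * h b) := by
  rw [ser_mul_mul₂₁₃, conv₃_swap_right]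

theorem ser_mul_mul₂₃₁ : ser f * ser g * ser h = ser (conv₃ fun a b c => f b * g c * h a) := by
  rw [ser_mul_mul₁₃₂, conv₃_swap_left]

theorem ser_mul_mul₃₂₁ : ser f * ser g * ser h = ser (conv₃ fun a b c => f c * g b * h a) := by
  rw [ser_mul_mul₂₃₁, conv₃_swap_right]

end Ring

end Convolution


/-! ### Additivity of the operations in their cochain arguments. -/

section Additivity

variable {k V : Type*} [Field k] [AddCommGroup V] [Module k V]
variable (𝒱 : ℤ → Submodule k V) [DirectSum.Decomposition 𝒱]

theorem part_add (p : Fin 2) (A B : Cochain k V) :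
    part 𝒱 p (A + B) = part 𝒱 p A + part 𝒱 p B := by
  simp only [part, LinearMap.add_comp, LinearMap.comp_add]
  module

theorem part_smul (p : Fin 2) (c : k) (A : Cochain k V) :
    part 𝒱 p (c • A) = c • part 𝒱 p A := by
  simp only [part, LinearMap.smul_comp, LinearMap.comp_smul]
  module

theorem coder_add (A B : Cochain k V) : coder 𝒱 (A + B) = coder 𝒱 A + coder 𝒱 B := by
  simp only [coder, part_add, insertAfter_add_right, Finset.sum_add_distrib]

theorem coder_smul (c : k) (A : Cochain k V) : coder 𝒱 (c • A) = c • coder 𝒱 A := by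
  simp only [coder, part_smul, insertAfter_smul_right, Finset.smul_sum]

theorem coder₂_add_left (A A' B : Cochain k V) :
    coder₂ 𝒱 (A + A') B = coder₂ 𝒱 A B + coder₂ 𝒱 A' B := by
  simp only [coder₂, coder_add, LinearMap.add_comp, insertAfter_add_left, Finset.sum_add_distrib]

theorem coder₂_add_right (A B B' : Cochain k V) :
    coder₂ 𝒱 A (B + B') = coder₂ 𝒱 A B + coder₂ 𝒱 A B' := by
  simp only [coder₂, part_add, insertAfter_add_right, Finset.sum_add_distrib]

theorem lie_add (A B : Cochain k V) : lie 𝒱 (A + B) = lie 𝒱 A + lie 𝒱 B := by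
  simp only [lie, part_add, coder_add, TensorProduct.map_add_right, Finset.sum_add_distrib,
    ext0_add, LinearMap.rTensor_add, LinearMap.add_comp]
  abel

theorem lie_smul (c : k) (A : Cochain k V) : lie 𝒱 (c • A) = c • lie 𝒱 A := by
  simp only [lie, part_smul, coder_smul, TensorProduct.map_smul_right, Finset.smul_sum,
    ext0_smul, LinearMap.rTensor_smul, LinearMap.smul_comp, smul_add]

theorem circ_add_left (A A' B : Cochain k V) :
    circ 𝒱 (A + A') B = circ 𝒱 A B + circ 𝒱 A' B := by
  simp only [circ, ext0_add, LinearMap.add_comp]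

theorem circ_add_right (A B B' : Cochain k V) :
    circ 𝒱 A (B + B') = circ 𝒱 A B + circ 𝒱 A B' := by
  simp only [circ, coder_add, LinearMap.add_comp, LinearMap.comp_add]

theorem bracket_add_right (A B B' : Cochain k V) :
    bracket 𝒱 A (B + B') = bracket 𝒱 A B + bracket 𝒱 A B' := by
  simp only [bracket, circ_add_right, circ_add_left, part_add, smul_add, Finset.sum_add_distrib]
  abel

end Additivity

/-! ### Commutators of the Lie derivative with one-sided insertions. -/

section MarkedBase

variable {k V : Type*} [Field k] [AddCommGroup V] [Module k V] [CharZero k]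
variable {𝒱 : ℤ → Submodule k V} [DirectSum.Decomposition 𝒱] {M A B : Cochain k V}

theorem HasParity.cup_eq (hA : HasParity 𝒱 1 A) (M B : Cochain k V) :
    cup 𝒱 M A B = AInfinity.brace₂ 𝒱 M A B := by
  have : coder₂ 𝒱 (0 : Cochain k V) B = 0 := by
    have := coder₂_add_left 𝒱 0 0 B
    simpa using this
  simp [cup, hA.part_eq, Fin.sum_univ_two, AInfinity.brace₂, this]

/-- Insertions on the left give the bracket, those on the right anticommute with `markedLeft`, and
those around the mark leave `markedIota`. For a cocycle this makes `markedIota` a commutator with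
the lift of `L_m`. -/
theorem HasParity.markedLie_markedLeft (hM : HasParity 𝒱 1 M) (hA : HasParity 𝒱 1 A) :
    markedLie 𝒱 1 M * markedLeft 𝒱 A + markedLeft 𝒱 A * markedLie 𝒱 1 M =
      markedLeft 𝒱 (AInfinity.bracket 𝒱 M A) + markedIota 𝒱 M A := by
  have e1 := hM.coder_bracket hA
  simp only [Fin.isValue, Fin.val_one, mul_one, pow_one] at e1
  have e2 : markedLeft 𝒱 (AInfinity.bracket 𝒱 M A) = markedLeft 𝒱 M * markedLeft 𝒱 A +
      markedLeft 𝒱 A * markedLeft 𝒱 M := by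
    simp only [markedLeft, tri_mul_tri, ← e1, tri_sub_left, tri_smul_left, mul_one]
    refine LinearMap.ext fun x => ?_
    simp only [LinearMap.add_apply, LinearMap.sub_apply, LinearMap.smul_apply]
    module
  have e3 : markedRight 𝒱 M * markedLeft 𝒱 A = (-1 : k) • (markedLeft 𝒱 A * markedRight 𝒱 M) := by
    simp only [tri_mul_tri, hA.invT_mul_coder_odd, tri_smul_left, mul_one, one_mul]
  simp only [e2, markedLie_one, markedIota, mul_add, add_mul, e3]
  refine LinearMap.ext fun x => ?_
  simp only [LinearMap.add_apply, LinearMap.smul_apply]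
  module

theorem HasParity.markedLie_markedRight (hM : HasParity 𝒱 1 M) (hA : HasParity 𝒱 1 A) :
    markedLie 𝒱 1 M * markedRight 𝒱 A + markedRight 𝒱 A * markedLie 𝒱 1 M =
      tri 1 1 (coder 𝒱 (AInfinity.bracket 𝒱 M A)) + markedIota' 𝒱 M A := by
  have e1 := hM.coder_bracket hA
  simp only [Fin.isValue, Fin.val_one, mul_one, pow_one] at e1
  have e2 : tri 1 1 (coder 𝒱 (AInfinity.bracket 𝒱 M A)) = markedRight 𝒱 M * markedRight 𝒱 A +
      markedRight 𝒱 A * markedRight 𝒱 M := by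
    simp only [tri_mul_tri, ← e1, tri_sub_right, tri_smul_right, invT_mul_invT,
      invV_mul_invV]
    refine LinearMap.ext fun x => ?_
    simp only [LinearMap.add_apply, LinearMap.sub_apply, LinearMap.smul_apply]
    module
  have e3 : markedRight 𝒱 A * markedLeft 𝒱 M = (-1 : k) • (markedLeft 𝒱 M * markedRight 𝒱 A) := by
    simp only [tri_mul_tri, hM.invT_mul_coder_odd, tri_smul_left, mul_one, one_mul]
  simp only [e2, markedLie_one, markedIota', mul_add, add_mul]
  simp only [markedLeft] at e3
  rw [e3]
  refine LinearMap.ext fun x => ?_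
  simp only [LinearMap.add_apply, LinearMap.smul_apply]
  module

/-- Left insertions contribute `coder_brace₂`, right ones commute with the even operator
`markedLeft₂`, and the commutator with `markedMid` is kept unexpanded because it reappears in
`markedKappa`. -/
theorem HasParity.markedLie_markedLeft₂ (hM : HasParity 𝒱 1 M) (hA : HasParity 𝒱 1 A)
    (hB : HasParity 𝒱 1 B) :
    markedLie 𝒱 1 M * markedLeft₂ 𝒱 A B - markedLeft₂ 𝒱 A B * markedLie 𝒱 1 M =
      markedMid 𝒱 M * markedLeft₂ 𝒱 A B - markedLeft₂ 𝒱 A B * markedMid 𝒱 M +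
      markedLeft 𝒱 (AInfinity.brace₂ 𝒱 M A B) + markedLeft₂ 𝒱 (AInfinity.bracket 𝒱 M A) B -
        markedLeft₂ 𝒱 A (AInfinity.bracket 𝒱 M B) := by
  have e1 := hM.coder_brace₂ hA hB
  have e2 : markedLeft 𝒱 M * markedLeft₂ 𝒱 A B - markedLeft₂ 𝒱 A B * markedLeft 𝒱 M =
      markedLeft 𝒱 (AInfinity.brace₂ 𝒱 M A B) + markedLeft₂ 𝒱 (AInfinity.bracket 𝒱 M A) B -
        markedLeft₂ 𝒱 A (AInfinity.bracket 𝒱 M B) := by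
    simp only [tri_mul_tri, mul_one, ← tri_sub_left, e1]
    rw [tri_sub_left]
    congr 1
    exact TensorProduct.map_add_left _ _ _
  have e3 : markedRight 𝒱 M * markedLeft₂ 𝒱 A B = markedLeft₂ 𝒱 A B * markedRight 𝒱 M := by
    simp only [tri_mul_tri, hA.invT_mul_coder₂_odd hB, mul_one, one_mul]
  simp only [markedLie_one, mul_add, add_mul, e3]
  refine LinearMap.ext fun x => ?_
  have e2 := LinearMap.congr_fun e2 x
  simp only [LinearMap.add_apply, LinearMap.sub_apply] at e2 ⊢
  linear_combination (norm := module) e2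

theorem HasParity.markedLie_markedRight₂ (hM : HasParity 𝒱 1 M) (hA : HasParity 𝒱 1 A)
    (hB : HasParity 𝒱 1 B) :
    markedLie 𝒱 1 M * markedRight₂ 𝒱 A B - markedRight₂ 𝒱 A B * markedLie 𝒱 1 M =
      markedMid 𝒱 M * markedRight₂ 𝒱 A B - markedRight₂ 𝒱 A B * markedMid 𝒱 M +
      markedRight 𝒱 (AInfinity.brace₂ 𝒱 M A B) +
        tri (invT 𝒱) (invV 𝒱) (coder₂ 𝒱 (AInfinity.bracket 𝒱 M A) B) -
        tri (invT 𝒱) (invV 𝒱) (coder₂ 𝒱 A (AInfinity.bracket 𝒱 M B)) := by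
  have e1 := hM.coder_brace₂ hA hB
  have e2 : markedRight 𝒱 M * markedRight₂ 𝒱 A B - markedRight₂ 𝒱 A B * markedRight 𝒱 M =
      markedRight 𝒱 (AInfinity.brace₂ 𝒱 M A B) +
        tri (invT 𝒱) (invV 𝒱) (coder₂ 𝒱 (AInfinity.bracket 𝒱 M A) B) -
        tri (invT 𝒱) (invV 𝒱) (coder₂ 𝒱 A (AInfinity.bracket 𝒱 M B)) := by
    simp only [tri_mul_tri, mul_one, one_mul, ← tri_sub_right, e1]
    rw [tri_sub_right]
    congr 1
    rw [tri, TensorProduct.map_add_right, TensorProduct.map_add_right]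
  have e3 : markedRight₂ 𝒱 A B * markedLeft 𝒱 M = markedLeft 𝒱 M * markedRight₂ 𝒱 A B := by
    simp only [tri_mul_tri, mul_one, one_mul]
  simp only [markedLeft] at e3
  simp only [markedLie_one, mul_add, add_mul, e3]
  refine LinearMap.ext fun x => ?_
  have e2 := LinearMap.congr_fun e2 x
  simp only [LinearMap.add_apply, LinearMap.sub_apply] at e2 ⊢
  linear_combination (norm := module) e2

end MarkedBase


/-! ### Transfer of multilinear identities to power series -/

section Transfer

variable {n : ℕ}

theorem conv₃_eq_zero_left {P Q : Type*} [AddCommGroup P] [AddCommGroup Q]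
    {G : (Fin n →₀ ℕ) → (Fin n →₀ ℕ) → Q} (hG : conv₂ G = 0) {φ : (Fin n →₀ ℕ) → Q → P}
    (hφ : ∀ c x y, φ c (x + y) = φ c x + φ c y) :
    conv₃ (fun a b c => φ c (G a b)) = 0 := by
  rw [conv₃_eq]
  funext e
  rw [conv₂]
  exact Finset.sum_eq_zero fun p _ => congrFun (conv₂_map_eq_zero (hφ p.2) hG) p.1

theorem conv₃_eq_zero_right {P Q : Type*} [AddCommGroup P] [AddCommGroup Q]
    {G : (Fin n →₀ ℕ) → (Fin n →₀ ℕ) → Q} (hG : conv₂ G = 0) {φ : (Fin n →₀ ℕ) → Q → P}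
    (hφ : ∀ c x y, φ c (x + y) = φ c x + φ c y) :
    conv₃ (fun a b c => φ b (G a c)) = 0 := by
  rw [conv₃_swap_right]
  exact conv₃_eq_zero_left hG hφ

variable {R : Type*} [Ring R]

/-- The error term `Z`, in practice a bracket `[m_a, A_b]`, is not zero for individual coefficients.
Only its convolution vanishes, by the cocycle condition. -/
theorem ser_anticomm {f g : Series n R} {Z H : (Fin n →₀ ℕ) → (Fin n →₀ ℕ) → R}
    (h : ∀ a b, f a * g b + g b * f a = Z a b + H a b) (hZ : conv₂ Z = 0) :
    ser f * ser g + ser g * ser f = ser (conv₂ H) := by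
  rw [ser_mul, ser_mul g, conv₂_swap (fun a b => g a * f b), ← ser_add, conv₂_add]
  simp only [h]
  rw [← conv₂_add, hZ, zero_add]

theorem ser_mul_add_mul (f g : Series n R) :
    ser f * ser g + ser g * ser f = ser (conv₂ fun a b => f a * g b + g b * f a) :=
  ser_anticomm (Z := fun _ _ => 0) (fun a b => (zero_add _).symm) (by funext e; simp [conv₂])

theorem ser_comm₃ {f t : Series n R} {G : (Fin n →₀ ℕ) → (Fin n →₀ ℕ) → R}
    {H Z W : (Fin n →₀ ℕ) → (Fin n →₀ ℕ) → (Fin n →₀ ℕ) → R}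
    (h : ∀ a b c, f a * G b c - G b c * f a =
      t a * G b c - G b c * t a + H a b c + Z a b c - W a b c)
    (hZ : conv₃ Z = 0) (hW : conv₃ W = 0) :
    ser f * ser (conv₂ G) - ser (conv₂ G) * ser f =
      ser t * ser (conv₂ G) - ser (conv₂ G) * ser t + ser (conv₃ H) := by
  rw [ser_mul_conv₂, ser_mul_conv₂, conv₂_ser_mul, conv₂_ser_mul, ← ser_sub, ← ser_sub, conv₃_sub,
    conv₃_sub, ← ser_add, conv₃_add]
  simp only [h]
  rw [← conv₃_sub, ← conv₃_add, hZ, hW, add_zero, sub_zero]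

variable (t la ra ta lb rb tb : Series n R) (G H : (Fin n →₀ ℕ) → (Fin n →₀ ℕ) → R)

theorem ser_kappa :
    ser (conv₃ fun a b c => t a * G b c - G b c * t a + la b * (t a * lb c + lb c * t a)) =
      ser t * ser (conv₂ G) - ser (conv₂ G) * ser t +
        ser la * (ser t * ser lb + ser lb * ser t) := by
  rw [mul_add, ← mul_assoc, ← mul_assoc, ser_mul_conv₂, conv₂_ser_mul, ser_mul_mul₂₁₃ la t lb,
    ser_mul_mul₂₃₁ la lb t, ← ser_sub, conv₃_sub, ← ser_add, ← ser_add, conv₃_add, conv₃_add]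
  simp only [mul_add, mul_assoc]

theorem ser_xi :
    ser (conv₂ fun b c => G b c + H b c + ra b * lb c - rb c * ta b + ta b * lb c) =
      ser (conv₂ G) + ser (conv₂ H) + ser ra * ser lb - ser rb * ser ta + ser ta * ser lb := by
  rw [ser_mul, ser_mul rb, ser_mul ta, conv₂_swap (fun a b => rb a * ta b)]
  simp only [← ser_add, ← ser_sub, conv₂_add, conv₂_sub]

theorem ser_brace {C : (Fin n →₀ ℕ) → (Fin n →₀ ℕ) → (Fin n →₀ ℕ) → R}
    (h : ∀ a b c, C a b c =
      (t a * G b c - G b c * t a + la b * (t a * lb c + lb c * t a)) +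
      (t a * H b c - H b c * t a) -
      rb c * (t a * ra b + ra b * t a) +
      ((t a * la b + la b * t a) * rb c - rb c * (t a * la b + la b * t a)) +
      (t a * la b + la b * t a) * tb c - (t a * rb c + rb c * t a) * ta b) :
    ser (conv₃ C) =
      (ser t * ser (conv₂ G) - ser (conv₂ G) * ser t +
        ser la * (ser t * ser lb + ser lb * ser t)) +
      (ser t * ser (conv₂ H) - ser (conv₂ H) * ser t) -
      ser rb * (ser t * ser ra + ser ra * ser t) +
      ((ser t * ser la + ser la * ser t) * ser rb - ser rb * (ser t * ser la + ser la * ser t)) +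
      (ser t * ser la + ser la * ser t) * ser tb - (ser t * ser rb + ser rb * ser t) * ser ta := by
  have hC := funext fun a => funext fun b => funext fun c => h a b c
  rw [hC, ← ser_kappa]
  simp only [mul_add, add_mul, ← mul_assoc]
  rw [ser_mul_conv₂, conv₂_ser_mul, ser_mul_mul₃₁₂ rb t ra, ser_mul_mul₃₂₁ rb ra t,
    ser_mul_mul₁₂₃ t la rb, ser_mul_mul₂₁₃ la t rb, ser_mul_mul₃₁₂ rb t la,
    ser_mul_mul₃₂₁ rb la t, ser_mul_mul₁₂₃ t la tb, ser_mul_mul₂₁₃ la t tb,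
    ser_mul_mul₁₃₂ t rb ta, ser_mul_mul₃₁₂ rb t ta]
  simp only [← ser_add, ← ser_sub, conv₃_add, conv₃_sub]

end Transfer

/-! ### Calculus identities in a ring -/

section RingIdentities

variable {R : Type*} [Ring R] {n : ℕ}
  {L t la ra ta lb rb tb lc rc tc lab rab ia ib ic ia' ib' : MvPowerSeries (Fin n) R}

/-- A commutator with an element of square zero commutes with it. This is how `[L_m, i_A] = 0` is
obtained. -/
theorem anticomm_comm (hL : L * L = 0) (h : L * la + la * L = ia) : L * ia = ia * L := by
  rw [← h]
  linear_combination (norm := noncomm_ring) hL * la - la * hL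

theorem neg_comm_identity {X : MvPowerSeries (Fin n) R} (h : la * ia + L * X = X * L + ia * la) :
    la * ia - ia * la = L * (-X) - (-X) * L := by
  linear_combination (norm := noncomm_ring) h

theorem comm_anticomm (hL : L * L = 0) (h : L * la - la * L = ia) : L * ia + ia * L = 0 := by
  rw [← h]
  linear_combination (norm := noncomm_ring) hL * la - la * hL

/-- By `hab` the element in question is `[L, lab] - lc + la * ib`. The first term is closed as `L *
L = 0`, the second gives `-ic`, and the third gives `ia * ib` because `ib` commutes with `L`. -/
theorem kappa_identity (hL : L * L = 0) (hab : L * lab - lab * L = t * lab - lab * t + lc)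
    (ha : L * la + la * L = ia) (hb : L * ib = ib * L) (hc : L * lc + lc * L = ic) :
    L * (t * lab - lab * t + la * ib) + (t * lab - lab * t + la * ib) * L = ia * ib - ic := by
  linear_combination (norm := noncomm_ring)
    hL * lab - lab * hL - hc + ha * ib - la * hb - (L * hab + hab * L)

/-- In these identities `l`, `r`, `t` stand for insertions to the left, to the right and around the
mark, with suffix `a`, `b`, `c` for `A`, `B`, `A ∪ B`; a bare `t` belongs to `m`. The Leibniz rule
is applied to every summand, and `htc`, the expansion of the brace around the mark, collects the
result. -/
theorem xi_identity (hab : L * lab - lab * L = t * lab - lab * t + lc)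
    (hab' : L * rab - rab * L = t * rab - rab * t + rc)
    (hla : L * la + la * L = ia) (hra : L * ra + ra * L = ia')
    (hlb : L * lb + lb * L = ib) (hrb : L * rb + rb * L = ib')
    (hLa : L * (la + ra + ta) + (la + ra + ta) * L = 0)
    (htc : tc = (t * lab - lab * t + la * ib) + (t * rab - rab * t) - rb * ia' +
      (ia * rb - rb * ia) + ia * tb - ib' * ta) :
    L * (lab + rab + ra * lb - rb * ta + ta * lb) - (lab + rab + ra * lb - rb * ta + ta * lb) * L =
      (lc + rc + tc) - (la + ra + ta) * ib - ia * (lb + rb + tb) := by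
  -- The insertion around the mark has no commutator formula of its own; its commutator is read off
  -- from the closedness of the whole `L_A`.
  have hta : L * ta + ta * L = - ia - ia' := by
    linear_combination (norm := noncomm_ring) hLa - hla - hra
  linear_combination (norm := noncomm_ring) hab + hab' + hra * lb - ra * hlb - hrb * ta + rb * hta
    + hta * lb - ta * hlb - htc

end RingIdentities


/-! ### Cartan calculus of a family of `A_∞`-algebras -/

section Lifts

variable {k M N : Type*} [Field k] [AddCommGroup M] [Module k M] [AddCommGroup N] [Module k N]
variable {n : ℕ}

/-- `i` intertwines the coefficients of two power series of endomorphisms. -/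
def Lifts (i : M →ₗ[k] N) (x : MvPowerSeries (Fin n) (Module.End k M))
    (X : MvPowerSeries (Fin n) (Module.End k N)) : Prop :=
  ∀ e, i ∘ₗ (show Module.End k M from x e) = (show Module.End k N from X e) ∘ₗ i

variable {i : M →ₗ[k] N} {x y : MvPowerSeries (Fin n) (Module.End k M)}
  {X Y : MvPowerSeries (Fin n) (Module.End k N)}

theorem Lifts.add (h : Lifts i x X) (h' : Lifts i y Y) : Lifts i (x + y) (X + Y) := fun e => by
  refine LinearMap.ext fun z => ?_
  have h1 := LinearMap.congr_fun (h e) z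
  have h2 := LinearMap.congr_fun (h' e) z
  exact (map_add i _ _).trans (congrArg₂ _ h1 h2)

theorem Lifts.sub (h : Lifts i x X) (h' : Lifts i y Y) : Lifts i (x - y) (X - Y) := fun e => by
  refine LinearMap.ext fun z => ?_
  have h1 := LinearMap.congr_fun (h e) z
  have h2 := LinearMap.congr_fun (h' e) z
  exact (map_sub i _ _).trans (congrArg₂ _ h1 h2)

theorem lifts_zero : Lifts i (0 : MvPowerSeries (Fin n) (Module.End k M)) 0 := fun _ =>
  LinearMap.ext fun _ => map_zero i

theorem lifts_conv₂ {F : (Fin n →₀ ℕ) → (Fin n →₀ ℕ) → Module.End k M}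
    {G : (Fin n →₀ ℕ) → (Fin n →₀ ℕ) → Module.End k N}
    (h : ∀ a b, i ∘ₗ F a b = G a b ∘ₗ i) : Lifts i (ser (conv₂ F)) (ser (conv₂ G)) := fun e => by
  refine LinearMap.ext fun z => ?_
  have h' : ∀ a b z, i (F a b z) = G a b (i z) := fun a b z => LinearMap.congr_fun (h a b) z
  simp only [ser, conv₂, LinearMap.comp_apply, LinearMap.sum_apply, map_sum, h']

theorem lifts_conv₃ {F : (Fin n →₀ ℕ) → (Fin n →₀ ℕ) → (Fin n →₀ ℕ) → Module.End k M}
    {G : (Fin n →₀ ℕ) → (Fin n →₀ ℕ) → (Fin n →₀ ℕ) → Module.End k N}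
    (h : ∀ a b c, i ∘ₗ F a b c = G a b c ∘ₗ i) : Lifts i (ser (conv₃ F)) (ser (conv₃ G)) :=
  lifts_conv₂ fun a e => lifts_conv₂ (F := F a) (G := G a) (h a) e

theorem Lifts.mul (h : Lifts i x X) (h' : Lifts i y Y) : Lifts i (x * y) (X * Y) := by
  have h3 : x * y = _ := ser_mul x y
  have h4 : X * Y = _ := ser_mul X Y
  rw [h3, h4]
  refine lifts_conv₂ fun a b => LinearMap.ext fun z => ?_
  have h1 := LinearMap.congr_fun (h a) (y b z)
  have h2 := LinearMap.congr_fun (h' b) z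
  exact h1.trans (congrArg (X a) h2)

/-- With `i` equal to `rot`, identities of series on marked words descend to chains. -/
theorem Lifts.ext (hi : Function.Injective i) (h : Lifts i x X) (h' : Lifts i y Y) (hXY : X = Y) :
    x = y := by
  subst hXY
  funext e
  refine LinearMap.ext fun z => hi ?_
  have h1 := LinearMap.congr_fun (h e) z
  have h2 := LinearMap.congr_fun (h' e) z
  exact h1.trans h2.symm

end Lifts

/-! ### Odd cocycles and the calculus on marked words, as power series. -/

section Calculus

instance {k V : Type*} [Field k] [AddCommGroup V] [Module k V] :
    Semiring (Module.End k (T k V)) := Ring.toSemiring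

instance {k V : Type*} [Field k] [AddCommGroup V] [Module k V] :
    Semiring (Module.End k (Chain k V)) := Ring.toSemiring

instance {k V : Type*} [Field k] [AddCommGroup V] [Module k V] :
    Semiring (Module.End k (Marked k V)) := Ring.toSemiring

variable {k V : Type*} [Field k] [AddCommGroup V] [Module k V]
variable (𝒱 : ℤ → Submodule k V) [DirectSum.Decomposition 𝒱] {n : ℕ}

/-- The series of coefficients of `L_A`. -/
def serLie (A : Series n (Cochain k V)) : MvPowerSeries (Fin n) (Module.End k (Chain k V)) :=
  ser fun e => lie 𝒱 (A e)

/-- The series of coefficients of `i_A`. -/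
def serContr (m A : Series n (Cochain k V)) : MvPowerSeries (Fin n) (Module.End k (Chain k V)) :=
  ser (conv₂ fun a b => contr 𝒱 (m a) (A b))

/-- An odd cocycle with respect to `δ`. -/
structure IsOddCocycle (m A : Series n (Cochain k V)) : Prop where
  odd : ∀ e, HasParity 𝒱 1 (A e)
  closed : delta 𝒱 m A = 0

variable {𝒱} [CharZero k] {m A B : Series n (Cochain k V)}

theorem lifts_serLie (hA : ∀ e, HasParity 𝒱 1 (A e)) :
    Lifts (rot 𝒱) (serLie 𝒱 A) (ser fun e => markedLie 𝒱 1 (A e)) := fun e => (hA e).rot_lie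

theorem lifts_serContr (hm : ∀ e, HasParity 𝒱 1 (m e)) (hA : ∀ e, HasParity 𝒱 1 (A e)) :
    Lifts (rot 𝒱) (serContr 𝒱 m A) (ser (conv₂ fun a b => markedIota 𝒱 (m a) (A b))) :=
  lifts_conv₂ fun a b => (hm a).rot_contr (hA b)

variable (𝒱) in
theorem tri_coder_add_left (A B : Cochain k V) :
    markedLeft 𝒱 (A + B) = markedLeft 𝒱 A + markedLeft 𝒱 B := by
  rw [markedLeft, coder_add]
  exact TensorProduct.map_add_left _ _ _

theorem tri_add_right (P : Module.End k (T k V)) (t : Module.End k V)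
    (Q Q' : Module.End k (T k V)) :
    tri P t (Q + Q') = tri P t Q + tri P t Q' := by
  simp only [tri, TensorProduct.map_add_right]

theorem tri_add_left (P P' : Module.End k (T k V)) (t : Module.End k V) (Q : Module.End k (T k V)) :
    tri (P + P') t Q = tri P t Q + tri P' t Q := by
  simp only [tri, TensorProduct.map_add_left]

variable (𝒱) in
theorem markedLie_add (p : Fin 2) (A B : Cochain k V) :
    markedLie 𝒱 p (A + B) = markedLie 𝒱 p A + markedLie 𝒱 p B := by
  have h : markedEval (A + B) = markedEval A + markedEval B := by
    rw [markedEval, ext0_add, LinearMap.add_comp]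
    rfl
  simp only [markedLie, h, theta_add, coder_add, tri_add_right, tri_add_left]
  refine LinearMap.ext fun x => ?_
  simp only [LinearMap.add_apply]
  abel

theorem ser_markedLie_anticomm (hm : ∀ e, HasParity 𝒱 1 (m e)) (hA : IsOddCocycle 𝒱 m A) :
    (ser fun e => markedLie 𝒱 1 (m e)) * (ser fun e => markedLie 𝒱 1 (A e)) +
      (ser fun e => markedLie 𝒱 1 (A e)) * (ser fun e => markedLie 𝒱 1 (m e)) = 0 := by
  have h0 : (conv₂ fun _ _ => 0 : Series n (Module.End k (Marked k V))) = 0 := by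
    funext e
    simp [conv₂]
  rw [ser_anticomm (Z := fun a b => markedLie 𝒱 0 (bracket 𝒱 (m a) (A b)))
    (H := fun _ _ => 0) ?_ ?_, h0]
  · rfl
  · intro a b
    have h := (hm a).markedLie_bracket (hA.odd b)
    refine LinearMap.ext fun x => ?_
    have h' := LinearMap.congr_fun h x
    simp only [Fin.isValue, Fin.val_one, mul_one, pow_one, LinearMap.sub_apply,
      LinearMap.smul_apply] at h'
    refine .trans ?_ (h'.trans (add_zero _).symm)
    simp only [LinearMap.add_apply]
    module
  · exact conv₂_map_eq_zero (markedLie_add 𝒱 0) hA.closed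

theorem ser_markedLeft_anticomm (hm : ∀ e, HasParity 𝒱 1 (m e)) (hA : IsOddCocycle 𝒱 m A) :
    (ser fun e => markedLie 𝒱 1 (m e)) * (ser fun e => markedLeft 𝒱 (A e)) +
      (ser fun e => markedLeft 𝒱 (A e)) * (ser fun e => markedLie 𝒱 1 (m e)) =
      ser (conv₂ fun a b => markedIota 𝒱 (m a) (A b)) :=
  ser_anticomm (Z := fun a b => markedLeft 𝒱 (bracket 𝒱 (m a) (A b)))
    (fun a b => (hm a).markedLie_markedLeft (hA.odd b))
    (conv₂_map_eq_zero (tri_coder_add_left 𝒱) hA.closed)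

theorem ser_markedRight_anticomm (hm : ∀ e, HasParity 𝒱 1 (m e)) (hA : IsOddCocycle 𝒱 m A) :
    (ser fun e => markedLie 𝒱 1 (m e)) * (ser fun e => markedRight 𝒱 (A e)) +
      (ser fun e => markedRight 𝒱 (A e)) * (ser fun e => markedLie 𝒱 1 (m e)) =
      ser (conv₂ fun a b => markedIota' 𝒱 (m a) (A b)) :=
  ser_anticomm (Z := fun a b => tri 1 1 (coder 𝒱 (bracket 𝒱 (m a) (A b))))
    (fun a b => (hm a).markedLie_markedRight (hA.odd b))
    (conv₂_map_eq_zero (φ := fun A => tri 1 1 (coder 𝒱 A))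
      (fun A B => by rw [coder_add, tri_add_right]) hA.closed)

theorem ser_markedLeft₂_comm (hm : ∀ e, HasParity 𝒱 1 (m e)) (hA : IsOddCocycle 𝒱 m A)
    (hB : IsOddCocycle 𝒱 m B) :
    (ser fun e => markedLie 𝒱 1 (m e)) * ser (conv₂ fun a b => markedLeft₂ 𝒱 (A a) (B b)) -
      ser (conv₂ fun a b => markedLeft₂ 𝒱 (A a) (B b)) * (ser fun e => markedLie 𝒱 1 (m e)) =
    (ser fun e => markedMid 𝒱 (m e)) * ser (conv₂ fun a b => markedLeft₂ 𝒱 (A a) (B b)) -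
      ser (conv₂ fun a b => markedLeft₂ 𝒱 (A a) (B b)) * (ser fun e => markedMid 𝒱 (m e)) +
      ser (conv₃ fun a b c => markedLeft 𝒱 (brace₂ 𝒱 (m a) (A b) (B c))) := by
  refine ser_comm₃ (f := fun e => markedLie 𝒱 1 (m e)) (t := fun e => markedMid 𝒱 (m e))
    (G := fun a b => markedLeft₂ 𝒱 (A a) (B b))
    (H := fun a b c => markedLeft 𝒱 (brace₂ 𝒱 (m a) (A b) (B c)))
    (Z := fun a b c => markedLeft₂ 𝒱 (bracket 𝒱 (m a) (A b)) (B c))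
    (W := fun a b c => markedLeft₂ 𝒱 (A b) (bracket 𝒱 (m a) (B c)))
    ?_ ?_ ?_
  · intro a b c
    exact (hm a).markedLie_markedLeft₂ (hA.odd b) (hB.odd c)
  · exact conv₃_eq_zero_left (G := fun a b => bracket 𝒱 (m a) (A b))
      (φ := fun c A => markedLeft₂ 𝒱 A (B c)) hA.closed
      fun c x y => by rw [markedLeft₂, coder₂_add_left, tri_add_left]
  · exact conv₃_eq_zero_right (G := fun a b => bracket 𝒱 (m a) (B b))
      (φ := fun b A' => markedLeft₂ 𝒱 (A b) A') hB.closed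
      fun c x y => by rw [markedLeft₂, coder₂_add_right, tri_add_left]

theorem ser_markedRight₂_comm (hm : ∀ e, HasParity 𝒱 1 (m e)) (hA : IsOddCocycle 𝒱 m A)
    (hB : IsOddCocycle 𝒱 m B) :
    (ser fun e => markedLie 𝒱 1 (m e)) * ser (conv₂ fun a b => markedRight₂ 𝒱 (A a) (B b)) -
      ser (conv₂ fun a b => markedRight₂ 𝒱 (A a) (B b)) * (ser fun e => markedLie 𝒱 1 (m e)) =
    (ser fun e => markedMid 𝒱 (m e)) * ser (conv₂ fun a b => markedRight₂ 𝒱 (A a) (B b)) -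
      ser (conv₂ fun a b => markedRight₂ 𝒱 (A a) (B b)) * (ser fun e => markedMid 𝒱 (m e)) +
      ser (conv₃ fun a b c => markedRight 𝒱 (brace₂ 𝒱 (m a) (A b) (B c))) := by
  refine ser_comm₃ (f := fun e => markedLie 𝒱 1 (m e)) (t := fun e => markedMid 𝒱 (m e))
    (G := fun a b => markedRight₂ 𝒱 (A a) (B b))
    (H := fun a b c => markedRight 𝒱 (brace₂ 𝒱 (m a) (A b) (B c)))
    (Z := fun a b c => tri (invT 𝒱) (invV 𝒱) (coder₂ 𝒱 (bracket 𝒱 (m a) (A b)) (B c)))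
    (W := fun a b c => tri (invT 𝒱) (invV 𝒱) (coder₂ 𝒱 (A b) (bracket 𝒱 (m a) (B c))))
    ?_ ?_ ?_
  · intro a b c
    exact (hm a).markedLie_markedRight₂ (hA.odd b) (hB.odd c)
  · exact conv₃_eq_zero_left (G := fun a b => bracket 𝒱 (m a) (A b))
      (φ := fun c A => tri (invT 𝒱) (invV 𝒱) (coder₂ 𝒱 A (B c))) hA.closed
      fun c x y => by rw [coder₂_add_left, tri_add_right]
  · exact conv₃_eq_zero_right (G := fun a b => bracket 𝒱 (m a) (B b))
      (φ := fun b A' => tri (invT 𝒱) (invV 𝒱) (coder₂ 𝒱 (A b) A')) hB.closed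
      fun c x y => by rw [coder₂_add_right, tri_add_right]

theorem cupSeries_eq (hA : ∀ e, HasParity 𝒱 1 (A e)) :
    cupSeries 𝒱 m A B = conv₃ fun a b c => brace₂ 𝒱 (m a) (A b) (B c) := by
  rw [conv₃_eq]
  funext e
  simp only [cupSeries, convol, conv₂, Finset.sum_apply, (hA _).cup_eq]

/-- Supplies the division by `2` that turns `[D, D] = 0` for odd `D` into `D * D = 0`. -/
theorem eq_zero_of_add_self {M : Type*} [AddCommGroup M] [Module k M]
    {x : MvPowerSeries (Fin n) (Module.End k M)} (h : x + x = 0) : x = 0 := by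
  funext e
  refine LinearMap.ext fun z => ?_
  have h1 : (show Module.End k M from x e) z + (show Module.End k M from x e) z = 0 :=
    LinearMap.congr_fun (congrFun h e) z
  rw [← two_smul k] at h1
  exact (smul_eq_zero.mp h1).resolve_left two_ne_zero

/-- The parameters have even degree, so all coefficients of `m` are odd, and then `δm = [m, m] = 2 m
∘ m`. -/
theorem isOddCocycle_self {τ : Fin n → ℤ} (hτ : ∀ i, Even (τ i)) (hm : IsFamily 𝒱 τ m) :
    IsOddCocycle 𝒱 m m := by
  have h : ∀ e, HasParity 𝒱 1 (m e) := fun e => by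
    refine (hm.degree e).hasParity_one ?_
    exact odd_one.sub_even (Finset.even_sum _ fun i _ => (hτ i).mul_left _)
  refine ⟨h, ?_⟩
  have h2 : delta 𝒱 m m = convol (circ 𝒱) m m + convol (circ 𝒱) m m := by
    simp only [delta, convol_eq_conv₂]
    conv_rhs => enter [2]; rw [conv₂_swap]
    rw [conv₂_add]
    congr 1; funext a b
    rw [(h a).bracket_eq (h b)]
    simp
  rw [h2, hm.maurerCartan, add_zero]

theorem ser_coder_anticomm (hm : ∀ e, HasParity 𝒱 1 (m e)) (hA : ∀ e, HasParity 𝒱 1 (A e)) :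
    (ser fun e => coder 𝒱 (m e)) * (ser fun e => coder 𝒱 (A e)) +
      (ser fun e => coder 𝒱 (A e)) * (ser fun e => coder 𝒱 (m e)) =
    ser (conv₂ fun a b => coder 𝒱 (bracket 𝒱 (m a) (A b))) := by
  refine ser_anticomm (Z := fun _ _ => 0) (fun a b => ?_) ?_
  · have h := (hm a).coder_bracket (hA b)
    refine LinearMap.ext fun x => ?_
    have h' := LinearMap.congr_fun h x
    simp only [Fin.isValue, Fin.val_one, mul_one, pow_one, LinearMap.sub_apply,
      LinearMap.smul_apply] at h'
    refine .trans ?_ (h'.trans (zero_add _).symm)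
    simp only [LinearMap.add_apply]
    module
  · funext e
    simp [conv₂]

theorem ser_coder_mul_self (hm : IsOddCocycle 𝒱 m m) :
    (ser fun e => coder 𝒱 (m e)) * (ser fun e => coder 𝒱 (m e)) = 0 := by
  refine eq_zero_of_add_self ((ser_coder_anticomm hm.odd hm.odd).trans ?_)
  exact conv₂_map_eq_zero (F := fun a b => bracket 𝒱 (m a) (m b)) (coder_add 𝒱) hm.closed

theorem ser_coder₂_comm (hm : ∀ e, HasParity 𝒱 1 (m e)) (hA : IsOddCocycle 𝒱 m A)
    (hB : IsOddCocycle 𝒱 m B) :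
    (ser fun e => coder 𝒱 (m e)) * ser (conv₂ fun a b => coder₂ 𝒱 (A a) (B b)) -
      ser (conv₂ fun a b => coder₂ 𝒱 (A a) (B b)) * (ser fun e => coder 𝒱 (m e)) =
      ser (conv₃ fun a b c => coder 𝒱 (brace₂ 𝒱 (m a) (A b) (B c))) := by
  have h0 : (ser fun _ => 0 : MvPowerSeries (Fin n) (Module.End k (T k V))) = 0 := rfl
  have := ser_comm₃ (f := fun e => coder 𝒱 (m e)) (t := fun e => 0)
    (G := fun a b => coder₂ 𝒱 (A a) (B b))
    (H := fun a b c => coder 𝒱 (brace₂ 𝒱 (m a) (A b) (B c)))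
    (Z := fun a b c => coder₂ 𝒱 (bracket 𝒱 (m a) (A b)) (B c))
    (W := fun a b c => coder₂ 𝒱 (A b) (bracket 𝒱 (m a) (B c))) ?_ ?_ ?_
  · simpa [h0] using this
  · intro a b c
    refine ((hm a).coder_brace₂ (hA.odd b) (hB.odd c)).trans ?_
    refine LinearMap.ext fun x => ?_
    simp
  · exact conv₃_eq_zero_left (G := fun a b => bracket 𝒱 (m a) (A b))
      (φ := fun c A => coder₂ 𝒱 A (B c)) hA.closed fun c x y => coder₂_add_left _ _ _ _
  · exact conv₃_eq_zero_right (G := fun a b => bracket 𝒱 (m a) (B b))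
      (φ := fun b A' => coder₂ 𝒱 (A b) A') hB.closed fun c x y => coder₂_add_right _ _ _ _

theorem ser_coder_cup (hA : ∀ e, HasParity 𝒱 1 (A e)) :
    (ser fun e => coder 𝒱 (cupSeries 𝒱 m A B e)) =
      ser (conv₃ fun a b c => coder 𝒱 (brace₂ 𝒱 (m a) (A b) (B c))) := by
  rw [cupSeries_eq hA]
  exact congrArg ser (conv₃_map (coder_add 𝒱) _)

theorem hasParity_cupSeries (hm : ∀ e, HasParity 𝒱 1 (m e)) (hA : ∀ e, HasParity 𝒱 1 (A e))
    (hB : ∀ e, HasParity 𝒱 1 (B e)) (e : Fin n →₀ ℕ) : HasParity 𝒱 1 (cupSeries 𝒱 m A B e) := by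
  rw [cupSeries_eq hA]
  exact HasParity.sum _ fun p _ => HasParity.sum _ fun q _ => (hm _).brace₂ (hA _) (hB _)

theorem ser_coder_anticomm_cup (hm : IsOddCocycle 𝒱 m m) (hA : IsOddCocycle 𝒱 m A)
    (hB : IsOddCocycle 𝒱 m B) :
    (ser fun e => coder 𝒱 (m e)) *
        ser (conv₃ fun a b c => coder 𝒱 (brace₂ 𝒱 (m a) (A b) (B c))) +
      ser (conv₃ fun a b c => coder 𝒱 (brace₂ 𝒱 (m a) (A b) (B c))) *
        (ser fun e => coder 𝒱 (m e)) = 0 := by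
  have h0 := ser_coder_mul_self hm
  have h1 := ser_coder₂_comm hm.odd hA hB
  exact comm_anticomm h0 h1

theorem ser_coder_delta (hm : ∀ e, HasParity 𝒱 1 (m e)) (hA : ∀ e, HasParity 𝒱 1 (A e)) :
    (ser fun e => coder 𝒱 (m e)) * (ser fun e => coder 𝒱 (A e)) +
      (ser fun e => coder 𝒱 (A e)) * (ser fun e => coder 𝒱 (m e)) =
    ser (fun e => coder 𝒱 (delta 𝒱 m A e)) := by
  rw [ser_coder_anticomm hm hA]
  exact congrArg ser (conv₂_map (coder_add 𝒱) fun a b => bracket 𝒱 (m a) (A b)).symm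

theorem hasParity_delta (hm : ∀ e, HasParity 𝒱 1 (m e)) {q : Fin 2}
    (hA : ∀ e, HasParity 𝒱 q (A e)) (e : Fin n →₀ ℕ) : HasParity 𝒱 (1 + q) (delta 𝒱 m A e) :=
  HasParity.sum _ (f := fun p : (Fin n →₀ ℕ) × (Fin n →₀ ℕ) => bracket 𝒱 (m p.1) (A p.2))
    fun p _ => (hm p.1).bracket (hA p.2)

/-- The coderivation of `A ∪ B` is the commutator of that of `m`, which squares to zero, with the
series `coder₂` of `A` and `B`; hence it anticommutes with that of `m`. So `δ(A ∪ B)` has zero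
coderivation, and a cochain of definite parity is determined by its coderivation. -/
theorem IsOddCocycle.cup (hm : IsOddCocycle 𝒱 m m) (hA : IsOddCocycle 𝒱 m A)
    (hB : IsOddCocycle 𝒱 m B) : IsOddCocycle 𝒱 m (cupSeries 𝒱 m A B) := by
  have hC := hasParity_cupSeries hm.odd hA.odd hB.odd
  refine ⟨hC, ?_⟩
  have h1 := ser_coder_delta hm.odd hC
  rw [ser_coder_cup hA.odd, ser_coder_anticomm_cup hm hA hB] at h1
  funext e
  have h2 : coder 𝒱 (delta 𝒱 m (cupSeries 𝒱 m A B) e) = 0 := (congrFun h1 e).symm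
  exact (hasParity_delta hm.odd hC e).eq_zero_of_coder h2

end Calculus


/-! ### The Cartan homotopy formulas on chains. -/

section ChainCalculus

variable {k V : Type*} [Field k] [AddCommGroup V] [Module k V] [CharZero k]
variable {𝒱 : ℤ → Submodule k V} [DirectSum.Decomposition 𝒱] {n : ℕ}
variable {m A B : Series n (Cochain k V)}

theorem ser_markedLie_mul_self (hm : IsOddCocycle 𝒱 m m) :
    (ser fun e => markedLie 𝒱 1 (m e)) * (ser fun e => markedLie 𝒱 1 (m e)) = 0 :=
  eq_zero_of_add_self (ser_markedLie_anticomm hm.odd hm)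

theorem serLie_anticomm (hm : IsOddCocycle 𝒱 m m) (hA : IsOddCocycle 𝒱 m A) :
    serLie 𝒱 m * serLie 𝒱 A + serLie 𝒱 A * serLie 𝒱 m = 0 :=
  (((lifts_serLie hm.odd).mul (lifts_serLie hA.odd)).add
    ((lifts_serLie hA.odd).mul (lifts_serLie hm.odd))).ext (rot_injective 𝒱) lifts_zero
    (ser_markedLie_anticomm hm.odd hA)

theorem ser_markedIota_comm (hm : IsOddCocycle 𝒱 m m) (hA : IsOddCocycle 𝒱 m A) :
    (ser fun e => markedLie 𝒱 1 (m e)) * ser (conv₂ fun a b => markedIota 𝒱 (m a) (A b)) =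
      ser (conv₂ fun a b => markedIota 𝒱 (m a) (A b)) * (ser fun e => markedLie 𝒱 1 (m e)) := by
  have h1 := ser_markedLie_mul_self hm
  have h2 := ser_markedLeft_anticomm hm.odd hA
  exact anticomm_comm h1 h2

/-- On marked words `i_A` is a commutator with the lift of `L_m`, hence closed; `rot` transports
this to chains. -/
theorem serLie_comm_serContr (hm : IsOddCocycle 𝒱 m m) (hA : IsOddCocycle 𝒱 m A) :
    serLie 𝒱 m * serContr 𝒱 m A = serContr 𝒱 m A * serLie 𝒱 m :=
  ((lifts_serLie hm.odd).mul (lifts_serContr hm.odd hA.odd)).ext (rot_injective 𝒱)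
    ((lifts_serContr hm.odd hA.odd).mul (lifts_serLie hm.odd)) (ser_markedIota_comm hm hA)

theorem ser_markedLeft_cup (hA : ∀ e, HasParity 𝒱 1 (A e)) :
    (ser fun e => markedLeft 𝒱 (cupSeries 𝒱 m A B e)) =
      ser (conv₃ fun a b c => markedLeft 𝒱 (brace₂ 𝒱 (m a) (A b) (B c))) := by
  rw [cupSeries_eq hA]
  exact congrArg ser (conv₃_map (tri_coder_add_left 𝒱) _)

theorem ser_markedRight_cup (hA : ∀ e, HasParity 𝒱 1 (A e)) :
    (ser fun e => markedRight 𝒱 (cupSeries 𝒱 m A B e)) =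
      ser (conv₃ fun a b c => markedRight 𝒱 (brace₂ 𝒱 (m a) (A b) (B c))) := by
  rw [cupSeries_eq hA]
  exact congrArg ser (conv₃_map (φ := markedRight 𝒱)
    (fun A B => by rw [markedRight, coder_add, tri_add_right]) _)

theorem ser_markedIota (m A : Series n (Cochain k V)) :
    ser (conv₂ fun a b => markedIota 𝒱 (m a) (A b)) =
      (ser fun e => markedMid 𝒱 (m e)) * (ser fun e => markedLeft 𝒱 (A e)) +
        (ser fun e => markedLeft 𝒱 (A e)) * (ser fun e => markedMid 𝒱 (m e)) :=
  (ser_mul_add_mul (fun e => markedMid 𝒱 (m e)) (fun e => markedLeft 𝒱 (A e))).symm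

theorem ser_markedIota' (m A : Series n (Cochain k V)) :
    ser (conv₂ fun a b => markedIota' 𝒱 (m a) (A b)) =
      (ser fun e => markedMid 𝒱 (m e)) * (ser fun e => markedRight 𝒱 (A e)) +
        (ser fun e => markedRight 𝒱 (A e)) * (ser fun e => markedMid 𝒱 (m e)) :=
  (ser_mul_add_mul (fun e => markedMid 𝒱 (m e)) (fun e => markedRight 𝒱 (A e))).symm

theorem ser_markedKappa (m A B : Series n (Cochain k V)) :
    ser (conv₃ fun a b c => markedKappa 𝒱 (m a) (A b) (B c)) =
      (ser fun e => markedMid 𝒱 (m e)) * ser (conv₂ fun a b => markedLeft₂ 𝒱 (A a) (B b)) -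
        ser (conv₂ fun a b => markedLeft₂ 𝒱 (A a) (B b)) * (ser fun e => markedMid 𝒱 (m e)) +
      (ser fun e => markedLeft 𝒱 (A e)) *
        ser (conv₂ fun a b => markedIota 𝒱 (m a) (B b)) := by
  rw [ser_markedIota]
  exact ser_kappa (fun e => markedMid 𝒱 (m e)) (fun e => markedLeft 𝒱 (A e))
    (fun e => markedLeft 𝒱 (B e)) (fun a b => markedLeft₂ 𝒱 (A a) (B b))

theorem ser_markedKappa_anticomm (hm : IsOddCocycle 𝒱 m m) (hA : IsOddCocycle 𝒱 m A)
    (hB : IsOddCocycle 𝒱 m B) :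
    (ser fun e => markedLie 𝒱 1 (m e)) *
        ser (conv₃ fun a b c => markedKappa 𝒱 (m a) (A b) (B c)) +
      ser (conv₃ fun a b c => markedKappa 𝒱 (m a) (A b) (B c)) *
        (ser fun e => markedLie 𝒱 1 (m e)) =
      ser (conv₂ fun a b => markedIota 𝒱 (m a) (A b)) *
          ser (conv₂ fun a b => markedIota 𝒱 (m a) (B b)) -
        ser (conv₂ fun a b => markedIota 𝒱 (m a) (cupSeries 𝒱 m A B b)) := by
  have hc := ser_markedLeft_anticomm hm.odd (hm.cup hA hB)
  rw [ser_markedLeft_cup hA.odd] at hc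
  rw [ser_markedKappa]
  have h0 := ser_markedLie_mul_self hm
  have hab := ser_markedLeft₂_comm hm.odd hA hB
  have ha := ser_markedLeft_anticomm hm.odd hA
  have hb := ser_markedIota_comm hm hB
  exact kappa_identity h0 hab ha hb hc

/-- The homotopy is the series of the `contr₂`, whose lift `markedKappa` satisfies `kappa_identity`.
-/
theorem exists_serContr_cup (hm : IsOddCocycle 𝒱 m m) (hA : IsOddCocycle 𝒱 m A)
    (hB : IsOddCocycle 𝒱 m B) :
    ∃ K, serLie 𝒱 m * K + K * serLie 𝒱 m =
      serContr 𝒱 m A * serContr 𝒱 m B - serContr 𝒱 m (cupSeries 𝒱 m A B) := by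
  have h1 := lifts_serLie hm.odd
  have h2 : Lifts (rot 𝒱) (ser (conv₃ fun a b c => contr₂ 𝒱 (m a) (A b) (B c)))
      (ser (conv₃ fun a b c => markedKappa 𝒱 (m a) (A b) (B c))) :=
    lifts_conv₃ fun a b c => (hm.odd a).rot_contr₂ (hA.odd b) (hB.odd c)
  exact ⟨_, ((h1.mul h2).add (h2.mul h1)).ext (rot_injective 𝒱)
    (((lifts_serContr hm.odd hA.odd).mul (lifts_serContr hm.odd hB.odd)).sub
      (lifts_serContr hm.odd (hm.cup hA hB).odd)) (ser_markedKappa_anticomm hm hA hB)⟩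

theorem ser_markedLie_eq (A : Series n (Cochain k V)) :
    (ser fun e => markedLie 𝒱 1 (A e)) = (ser fun e => markedLeft 𝒱 (A e)) +
      (ser fun e => markedRight 𝒱 (A e)) + (ser fun e => markedMid 𝒱 (A e)) := by
  funext e
  exact markedLie_one (A e)

theorem ser_markedMid_cup (hm : ∀ e, HasParity 𝒱 1 (m e)) (hA : ∀ e, HasParity 𝒱 1 (A e))
    (hB : ∀ e, HasParity 𝒱 1 (B e)) :
    (ser fun e => markedMid 𝒱 (cupSeries 𝒱 m A B e)) =
      ((ser fun e => markedMid 𝒱 (m e)) * ser (conv₂ fun a b => markedLeft₂ 𝒱 (A a) (B b)) -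
        ser (conv₂ fun a b => markedLeft₂ 𝒱 (A a) (B b)) * (ser fun e => markedMid 𝒱 (m e)) +
        (ser fun e => markedLeft 𝒱 (A e)) * ser (conv₂ fun a b => markedIota 𝒱 (m a) (B b))) +
      ((ser fun e => markedMid 𝒱 (m e)) * ser (conv₂ fun a b => markedRight₂ 𝒱 (A a) (B b)) -
        ser (conv₂ fun a b => markedRight₂ 𝒱 (A a) (B b)) * (ser fun e => markedMid 𝒱 (m e))) -
      (ser fun e => markedRight 𝒱 (B e)) * ser (conv₂ fun a b => markedIota' 𝒱 (m a) (A b)) +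
      (ser (conv₂ fun a b => markedIota 𝒱 (m a) (A b)) * (ser fun e => markedRight 𝒱 (B e)) -
        (ser fun e => markedRight 𝒱 (B e)) * ser (conv₂ fun a b => markedIota 𝒱 (m a) (A b))) +
      ser (conv₂ fun a b => markedIota 𝒱 (m a) (A b)) * (ser fun e => markedMid 𝒱 (B e)) -
      ser (conv₂ fun a b => markedIota' 𝒱 (m a) (B b)) * (ser fun e => markedMid 𝒱 (A e)) := by
  have h : (ser fun e => markedMid 𝒱 (cupSeries 𝒱 m A B e)) =
      ser (conv₃ fun a b c => markedMid 𝒱 (brace₂ 𝒱 (m a) (A b) (B c))) := by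
    rw [cupSeries_eq hA]
    refine congrArg ser (conv₃_map (φ := markedMid 𝒱) (fun A B => ?_) _)
    rw [markedMid, ← theta_add, markedEval, ext0_add, LinearMap.add_comp]
    rfl
  rw [h, ser_markedIota, ser_markedIota, ser_markedIota', ser_markedIota']
  refine (ser_brace (fun a => markedMid 𝒱 (m a)) (fun a => markedLeft 𝒱 (A a))
    (fun a => markedRight 𝒱 (A a)) (fun a => markedMid 𝒱 (A a)) (fun a => markedLeft 𝒱 (B a))
    (fun a => markedRight 𝒱 (B a)) (fun a => markedMid 𝒱 (B a))
    (fun a b => markedLeft₂ 𝒱 (A a) (B b)) (fun a b => markedRight₂ 𝒱 (A a) (B b)) ?_)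
  intro a b c
  refine ((hm a).markedMid_brace₂ (hA b) (hB c)).trans ?_
  rfl

variable (𝒱) in
/-- The lift of `lie₂` to marked words. -/
def markedXi (A B : Cochain k V) : Module.End k (Marked k V) :=
  markedLeft₂ 𝒱 A B + markedRight₂ 𝒱 A B + markedRight 𝒱 A * markedLeft 𝒱 B -
    markedRight 𝒱 B * markedMid 𝒱 A + markedMid 𝒱 A * markedLeft 𝒱 B

theorem ser_markedXi (A B : Series n (Cochain k V)) :
    ser (conv₂ fun a b => markedXi 𝒱 (A a) (B b)) =
      ser (conv₂ fun a b => markedLeft₂ 𝒱 (A a) (B b)) +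
      ser (conv₂ fun a b => markedRight₂ 𝒱 (A a) (B b)) +
      (ser fun e => markedRight 𝒱 (A e)) * (ser fun e => markedLeft 𝒱 (B e)) -
      (ser fun e => markedRight 𝒱 (B e)) * (ser fun e => markedMid 𝒱 (A e)) +
      (ser fun e => markedMid 𝒱 (A e)) * (ser fun e => markedLeft 𝒱 (B e)) :=
  ser_xi (fun e => markedRight 𝒱 (A e)) (fun e => markedMid 𝒱 (A e)) (fun e => markedLeft 𝒱 (B e))
    (fun e => markedRight 𝒱 (B e)) (fun a b => markedLeft₂ 𝒱 (A a) (B b))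
    (fun a b => markedRight₂ 𝒱 (A a) (B b))

/-- All commutators of `L_m` with the pieces of `markedXi` are known, so this is an instance of
`xi_identity`. -/
theorem ser_markedXi_comm (hm : IsOddCocycle 𝒱 m m) (hA : IsOddCocycle 𝒱 m A)
    (hB : IsOddCocycle 𝒱 m B) :
    (ser fun e => markedLie 𝒱 1 (m e)) * ser (conv₂ fun a b => markedXi 𝒱 (A a) (B b)) -
      ser (conv₂ fun a b => markedXi 𝒱 (A a) (B b)) * (ser fun e => markedLie 𝒱 1 (m e)) =
      (ser fun e => markedLie 𝒱 1 (cupSeries 𝒱 m A B e)) -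
        (ser fun e => markedLie 𝒱 1 (A e)) * ser (conv₂ fun a b => markedIota 𝒱 (m a) (B b)) -
        ser (conv₂ fun a b => markedIota 𝒱 (m a) (A b)) * (ser fun e => markedLie 𝒱 1 (B e)) := by
  have hab := ser_markedLeft₂_comm hm.odd hA hB
  have hab' := ser_markedRight₂_comm hm.odd hA hB
  rw [← ser_markedLeft_cup hA.odd] at hab
  rw [← ser_markedRight_cup hA.odd] at hab'
  have hLa := ser_markedLie_anticomm hm.odd hA
  rw [ser_markedLie_eq A] at hLa
  rw [ser_markedXi, ser_markedLie_eq A, ser_markedLie_eq B, ser_markedLie_eq (cupSeries 𝒱 m A B)]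
  have h1 := ser_markedLeft_anticomm hm.odd hA
  have h2 := ser_markedRight_anticomm hm.odd hA
  have h3 := ser_markedLeft_anticomm hm.odd hB
  have h4 := ser_markedRight_anticomm hm.odd hB
  have h5 := ser_markedMid_cup hm.odd hA.odd hB.odd
  -- With the series replaced by variables, only an identity in a noncommutative ring is left.
  generalize (ser fun e => markedLie 𝒱 1 (m e)) = L at *
  generalize (ser fun e => markedMid 𝒱 (m e)) = t at *
  generalize (ser fun e => markedMid 𝒱 (cupSeries 𝒱 m A B e)) = tc at *
  generalize (ser fun e => markedRight 𝒱 (cupSeries 𝒱 m A B e)) = rc at *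
  generalize (ser fun e => markedLeft 𝒱 (cupSeries 𝒱 m A B e)) = lc at *
  generalize (ser fun e => markedLeft 𝒱 (A e)) = la at *
  generalize (ser fun e => markedRight 𝒱 (A e)) = ra at *
  generalize (ser fun e => markedMid 𝒱 (A e)) = ta at *
  generalize (ser fun e => markedLeft 𝒱 (B e)) = lb at *
  generalize (ser fun e => markedRight 𝒱 (B e)) = rb at *
  generalize (ser fun e => markedMid 𝒱 (B e)) = tb at *
  generalize ser (conv₂ fun a b => markedIota 𝒱 (m a) (A b)) = ia at *
  generalize ser (conv₂ fun a b => markedIota 𝒱 (m a) (B b)) = ib at *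
  generalize ser (conv₂ fun a b => markedIota' 𝒱 (m a) (A b)) = ia' at *
  generalize ser (conv₂ fun a b => markedIota' 𝒱 (m a) (B b)) = ib' at *
  generalize ser (conv₂ fun a b => markedLeft₂ 𝒱 (A a) (B b)) = lab at *
  generalize ser (conv₂ fun a b => markedRight₂ 𝒱 (A a) (B b)) = rab at *
  exact xi_identity hab hab' h1 h2 h3 h4 hLa h5

/-- The homotopy is the series of the `lie₂`, whose lift is `markedXi`. -/
theorem exists_serLie_cup (hm : IsOddCocycle 𝒱 m m) (hA : IsOddCocycle 𝒱 m A)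
    (hB : IsOddCocycle 𝒱 m B) :
    ∃ X, serLie 𝒱 m * X - X * serLie 𝒱 m = serLie 𝒱 (cupSeries 𝒱 m A B) -
      serLie 𝒱 A * serContr 𝒱 m B - serContr 𝒱 m A * serLie 𝒱 B := by
  have h1 := lifts_serLie hm.odd
  have h2 : Lifts (rot 𝒱) (ser (conv₂ fun a b => lie₂ 𝒱 (A a) (B b)))
      (ser (conv₂ fun a b => markedXi 𝒱 (A a) (B b))) :=
    lifts_conv₂ fun a b => (hA.odd a).rot_lie₂ (hB.odd b)
  exact ⟨_, ((h1.mul h2).sub (h2.mul h1)).ext (rot_injective 𝒱)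
    (((lifts_serLie (hm.cup hA hB).odd).sub
      ((lifts_serLie hA.odd).mul (lifts_serContr hm.odd hB.odd))).sub
      ((lifts_serContr hm.odd hA.odd).mul (lifts_serLie hB.odd))) (ser_markedXi_comm hm hA hB)⟩

end ChainCalculus


/-! ### Differentiation with respect to the parameters -/

section Derivative

variable {n : ℕ} {P : Type*} [AddCommGroup P]

/-- The weight kills the pairs with `p.1 j = 0`, and the remaining pairs are exactly the shifts by
`single j 1` of the pairs with sum `e`. -/
theorem sum_antidiagonal_add_single (F : (Fin n →₀ ℕ) → (Fin n →₀ ℕ) → P) (j : Fin n)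
    (e : Fin n →₀ ℕ) :
    ∑ p ∈ Finset.HasAntidiagonal.antidiagonal (e + Finsupp.single j 1),
        (p.1 : Fin n →₀ ℕ) j • F p.1 p.2 =
      ∑ p ∈ Finset.HasAntidiagonal.antidiagonal e,
        (p.1 j + 1) • F (p.1 + Finsupp.single j 1) p.2 := by
  obtain ⟨φ, hφ⟩ : ∃ φ : (Fin n →₀ ℕ) × (Fin n →₀ ℕ) ↪ (Fin n →₀ ℕ) × (Fin n →₀ ℕ),
      ∀ p, φ p = (p.1 + Finsupp.single j 1, p.2) :=
    ⟨⟨fun p => (p.1 + Finsupp.single j 1, p.2), fun p q h => by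
      simp only [Prod.mk.injEq, add_left_inj] at h
      exact Prod.ext h.1 h.2⟩, fun _ => rfl⟩
  have h : ∑ p ∈ Finset.HasAntidiagonal.antidiagonal e,
        (p.1 j + 1) • F (p.1 + Finsupp.single j 1) p.2 =
      ∑ p ∈ (Finset.HasAntidiagonal.antidiagonal e).map φ, p.1 j • F p.1 p.2 := by
    rw [Finset.sum_map]
    refine Finset.sum_congr rfl fun p _ => ?_
    simp only [hφ, Finsupp.add_apply, Finsupp.single_eq_same]
  rw [h]
  refine (Finset.sum_subset ?_ ?_).symm
  · intro p hp
    simp only [Finset.mem_map, Finset.HasAntidiagonal.mem_antidiagonal] at hp ⊢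
    obtain ⟨q, hq, rfl⟩ := hp
    rw [hφ, ← hq, add_right_comm]
  · intro p hp hp'
    by_cases h0 : p.1 j = 0
    · simp [h0]
    · refine absurd ?_ hp'
      have h1 : Finsupp.single j 1 ≤ p.1 := by
        rw [Finsupp.single_le_iff]; omega
      simp only [Finset.mem_map, Finset.HasAntidiagonal.mem_antidiagonal] at hp ⊢
      refine ⟨(p.1 - Finsupp.single j 1, p.2), ?_, ?_⟩
      · have h2 := tsub_add_cancel_of_le h1
        refine add_right_cancel (b := Finsupp.single j 1) ?_
        rw [← hp, add_right_comm, h2]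
      · rw [hφ, tsub_add_cancel_of_le h1]

theorem sum_antidiagonal_add_single' (F : (Fin n →₀ ℕ) → (Fin n →₀ ℕ) → P) (j : Fin n)
    (e : Fin n →₀ ℕ) :
    ∑ p ∈ Finset.HasAntidiagonal.antidiagonal (e + Finsupp.single j 1),
        (p.2 : Fin n →₀ ℕ) j • F p.1 p.2 =
      ∑ p ∈ Finset.HasAntidiagonal.antidiagonal e,
        (p.2 j + 1) • F p.1 (p.2 + Finsupp.single j 1) := by
  have h := sum_antidiagonal_add_single (fun a b => F b a) j e
  have h1 := congrFun (conv₂_swap fun a b => b j • F a b) (e + Finsupp.single j 1)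
  have h2 := congrFun (conv₂_swap fun a b => (b j + 1) • F a (b + Finsupp.single j 1)) e
  exact (h1.trans h).trans h2.symm

theorem pderiv_convol {X Y : Type*} [AddCommGroup X] [AddCommGroup Y] {op : X → Y → P}
    (hl : ∀ x x' y, op (x + x') y = op x y + op x' y)
    (hr : ∀ x y y', op x (y + y') = op x y + op x y') (j : Fin n) (f : Series n X)
    (g : Series n Y) :
    pderiv j (convol op f g) = convol op (pderiv j f) g + convol op f (pderiv j g) := by
  have hl' : ∀ (r : ℕ) x y, op (r • x) y = r • op x y := fun r x y =>
    map_nsmul (AddMonoidHom.mk' (fun x => op x y) fun x x' => hl x x' y) r x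
  have hr' : ∀ (r : ℕ) x y, op x (r • y) = r • op x y := fun r x y =>
    map_nsmul (AddMonoidHom.mk' (op x) (hr x)) r y
  funext e
  simp only [pderiv, convol, Pi.add_apply, hl', hr']
  -- Both sides become sums over the pairs with sum `e + single j 1`, where the weight `e j + 1`
  -- equals `p.1 j + p.2 j`.
  rw [← sum_antidiagonal_add_single (fun a b => op (f a) (g b)),
    ← sum_antidiagonal_add_single' (fun a b => op (f a) (g b)), ← Finset.sum_add_distrib,
    Finset.smul_sum]
  refine Finset.sum_congr rfl fun p hp => ?_
  rw [← add_smul]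
  congr 1
  have := DFunLike.congr_fun (Finset.HasAntidiagonal.mem_antidiagonal.mp hp) j
  simpa using this.symm

theorem pderiv_map {Q : Type*} [AddCommGroup Q] {φ : P → Q} (hφ : ∀ x y, φ (x + y) = φ x + φ y)
    (j : Fin n) (f : Series n P) : pderiv j (fun e => φ (f e)) = fun e => φ (pderiv j f e) := by
  funext e
  exact (map_nsmul (AddMonoidHom.mk' φ hφ) _ _).symm

theorem ser_pderiv_mul {R : Type*} [Ring R] (j : Fin n) (f g : Series n R) :
    ser (pderiv j (ser f * ser g)) = ser (pderiv j f) * ser g + ser f * ser (pderiv j g) := by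
  rw [ser_mul f g, ser_mul, ser_mul, ← ser_add]
  exact congrArg ser (pderiv_convol (op := fun x y : R => x * y) (fun _ _ _ => add_mul _ _ _)
    (fun _ _ _ => mul_add _ _ _) j f g)

end Derivative

/-! ### Derivatives of the family and of the Cartan identities. -/

section DerivativeCalculus

variable {k V : Type*} [Field k] [AddCommGroup V] [Module k V] [CharZero k]
variable {𝒱 : ℤ → Submodule k V} [DirectSum.Decomposition 𝒱] {n : ℕ}
variable {m : Series n (Cochain k V)}

theorem hasParity_pderiv {A : Series n (Cochain k V)} {q : Fin 2} (hA : ∀ e, HasParity 𝒱 q (A e))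
    (j : Fin n) (e : Fin n →₀ ℕ) : HasParity 𝒱 q (pderiv j A e) := by
  rw [pderiv, ← Nat.cast_smul_eq_nsmul k]
  exact (hA _).smul _

theorem delta_eq_of_odd {A : Series n (Cochain k V)} (hm : ∀ e, HasParity 𝒱 1 (m e))
    (hA : ∀ e, HasParity 𝒱 1 (A e)) :
    delta 𝒱 m A = convol (circ 𝒱) A m + convol (circ 𝒱) m A := by
  simp only [delta, convol_eq_conv₂]
  conv_rhs => enter [1]; rw [conv₂_swap]
  rw [conv₂_add]
  congr 1; funext a b
  rw [(hm a).bracket_eq (hA b)]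
  simp [add_comm]

/-- For odd `A` one has `δA = A ∘ m + m ∘ A`, so `δ m_(j)` is the derivative of `m ∘ m = 0`. -/
theorem isOddCocycle_pderiv {τ : Fin n → ℤ} (hτ : ∀ i, Even (τ i)) (hm : IsFamily 𝒱 τ m)
    (j : Fin n) : IsOddCocycle 𝒱 m (pderiv j m) := by
  have h := isOddCocycle_self hτ hm
  have h2 := hasParity_pderiv h.odd j
  refine ⟨h2, ?_⟩
  rw [delta_eq_of_odd h.odd h2, ← pderiv_convol (circ_add_left 𝒱) (circ_add_right 𝒱),
    hm.maurerCartan]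
  funext e
  simp [pderiv]

theorem serLie_pderiv (j : Fin n) (A : Series n (Cochain k V)) :
    serLie 𝒱 (pderiv j A) = ser (pderiv j (serLie 𝒱 A)) :=
  congrArg ser (pderiv_map (lie_add 𝒱) j A).symm

/-- Differentiating `[L_m, i_A] = 0` gives `[L_{m_(j)}, i_A] = -[L_m, (i_A)_(j)]`. -/
theorem exists_serLie_comm_serContr {A : Series n (Cochain k V)} (hm : IsOddCocycle 𝒱 m m)
    (hA : IsOddCocycle 𝒱 m A) (j : Fin n) :
    ∃ J, serLie 𝒱 (pderiv j m) * serContr 𝒱 m A - serContr 𝒱 m A * serLie 𝒱 (pderiv j m) =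
      serLie 𝒱 m * J - J * serLie 𝒱 m := by
  have h := serLie_comm_serContr hm hA
  have h2 := congrArg (fun x => ser (pderiv j x)) h
  have h3 := ser_pderiv_mul j (serLie 𝒱 m) (serContr 𝒱 m A)
  have h4 := ser_pderiv_mul j (serContr 𝒱 m A) (serLie 𝒱 m)
  have h5 := (h3.symm.trans h2).trans h4
  rw [← serLie_pderiv] at h5
  refine ⟨- ser (pderiv j (serContr 𝒱 m A)), ?_⟩
  generalize ser (pderiv j (serContr 𝒱 m A)) = J at *
  change serLie 𝒱 (pderiv j m) * serContr 𝒱 m A + serLie 𝒱 m * J =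
    J * serLie 𝒱 m + serContr 𝒱 m A * serLie 𝒱 (pderiv j m) at h5
  exact neg_comm_identity h5

end DerivativeCalculus


/-! ### Iterated cup products -/

section Iterated

variable {R : Type*} [Ring R] {n : ℕ} {L : MvPowerSeries (Fin n) R}

/-- For a list of pairs `(xᵢ, yᵢ)`, the sum of the products `x₁ ⋯ x̂ᵢ ⋯ xₗ yᵢ`. -/
def sumErase {R : Type*} [Ring R] : List (R × R) → R
  | [] => 0
  | x :: l => x.1 * sumErase l + (l.map Prod.fst).prod * x.2

theorem sumErase_ofFn {R : Type*} [Ring R] {l : ℕ} (g : Fin (l + 1) → R × R) :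
    sumErase (List.ofFn g) =
      ∑ r, (List.ofFn fun s => (g (r.succAbove s)).1).prod * (g r).2 := by
  induction l with
  | zero => simp [sumErase, List.ofFn_succ]
  | succ l ih =>
    rw [List.ofFn_succ, sumErase, ih]
    conv_rhs => rw [Fin.sum_univ_succ]
    rw [Finset.mul_sum, add_comm]
    congr 1
    · simp [List.map_ofFn, Function.comp_def]
    · refine Finset.sum_congr rfl fun r _ => ?_
      rw [List.ofFn_succ (f := fun s => (g (r.succ.succAbove s)).1), List.prod_cons, mul_assoc]
      simp [Fin.succ_succAbove_succ]

theorem exists_comm_mul {a x y : MvPowerSeries (Fin n) R} (hx : L * x = x * L)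
    (hy : L * y = y * L) (h : ∃ J, a * x - x * a = L * J - J * L)
    (h' : ∃ J, a * y - y * a = L * J - J * L) : ∃ J, a * (x * y) - x * y * a = L * J - J * L := by
  obtain ⟨J, h⟩ := h
  obtain ⟨J', h'⟩ := h'
  refine ⟨J * y + x * J', ?_⟩
  linear_combination (norm := noncomm_ring) h * y + x * h' - J * hy - hx * J'

theorem exists_comm_prod (a : MvPowerSeries (Fin n) R) (l : List (MvPowerSeries (Fin n) R))
    (hl : ∀ x ∈ l, L * x = x * L) (h : ∀ x ∈ l, ∃ J, a * x - x * a = L * J - J * L) :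
    L * l.prod = l.prod * L ∧ ∃ J, a * l.prod - l.prod * a = L * J - J * L := by
  induction l with
  | nil => exact ⟨by simp, 0, by simp⟩
  | cons x l ih =>
    obtain ⟨h1, h2⟩ := ih (fun y hy => hl y (List.mem_cons_of_mem _ hy))
      fun y hy => h y (List.mem_cons_of_mem _ hy)
    have hx := hl x List.mem_cons_self
    rw [List.prod_cons]
    exact ⟨by rw [← mul_assoc, hx, mul_assoc, h1, mul_assoc],
      exists_comm_mul hx h1 (h x List.mem_cons_self) h2⟩

theorem contr_cons {i j K K' p C : MvPowerSeries (Fin n) R} (hi : L * i = i * L)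
    (hK : L * K + K * L = i * j - C) (hj : j = p + (L * K' + K' * L)) :
    C = i * p + (L * (i * K' - K) + (i * K' - K) * L) := by
  linear_combination (norm := noncomm_ring) i * hj + hK - hi * K'

/-- The inductive step for `A ∪ B`, with `B` the cup product of the tail. Here `a`, `i` are `L_A`,
`i_A`; `b`, `j` are `L_B`, `i_B`; `p` is the product of contractions homotopic to `j`, and `r` is
the `sumErase` homotopic to `b`. The homotopy `J` moves `a` to the right of `p`. -/
theorem lie_cons {a i j b K J W X p r C : MvPowerSeries (Fin n) R} (hi : L * i = i * L)
    (ha : L * a + a * L = 0) (hX : L * X - X * L = C - a * j - i * b)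
    (hj : j = p + (L * K + K * L)) (hb : b = L * W - W * L + r)
    (hJ : a * p - p * a = L * J - J * L) :
    C = L * (X - a * K + J + i * W) - (X - a * K + J + i * W) * L + (i * r + p * a) := by
  linear_combination (norm := noncomm_ring) a * hj + i * hb - hX + hJ + ha * K - hi * W

/-- Contraction and Lie derivative of an iterated cup product. -/
theorem exists_cupList {S : Type*} {lf cf : S → MvPowerSeries (Fin n) R} {P : S → Prop}
    {cup : S → S → S} {cl : List S → S} (h1 : ∀ A, cl [A] = A)
    (h2 : ∀ A B l, cl (A :: B :: l) = cup A (cl (B :: l)))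
    (hcup : ∀ A B, P A → P B → P (cup A B))
    (hl : ∀ A, P A → L * lf A + lf A * L = 0)
    (hc : ∀ A, P A → L * cf A = cf A * L)
    (hK : ∀ A B, P A → P B → ∃ K, L * K + K * L = cf A * cf B - cf (cup A B))
    (hX : ∀ A B, P A → P B → ∃ X, L * X - X * L = lf (cup A B) - lf A * cf B - cf A * lf B)
    (l : List S) (hP : ∀ A ∈ l, P A)
    (hJ : ∀ A ∈ l, ∀ B ∈ l, ∃ J, lf A * cf B - cf B * lf A = L * J - J * L) (hne : l ≠ []) :
    P (cl l) ∧ (∃ K, cf (cl l) = (l.map cf).prod + (L * K + K * L)) ∧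
      ∃ W, lf (cl l) = L * W - W * L + sumErase (l.map fun A => (cf A, lf A)) := by
  induction l with
  | nil => exact absurd rfl hne
  | cons A l ih =>
    have hA := hP A List.mem_cons_self
    cases l with
    | nil => exact ⟨by rwa [h1], ⟨0, by simp [h1]⟩, 0, by simp [h1, sumErase]⟩
    | cons B l =>
      obtain ⟨i1, ⟨K', hK'⟩, W, hW⟩ := ih (fun C hC => hP C (List.mem_cons_of_mem _ hC))
        (fun C hC D hD => hJ C (List.mem_cons_of_mem _ hC) D (List.mem_cons_of_mem _ hD)) (by simp)
      obtain ⟨K, hK⟩ := hK A _ hA i1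
      obtain ⟨X, hX⟩ := hX A _ hA i1
      obtain ⟨-, J, hJ'⟩ := exists_comm_prod (L := L) (lf A) ((B :: l).map cf)
        (by
          intro x hx
          obtain ⟨C, hC, rfl⟩ := List.mem_map.mp hx
          exact hc C (hP C (List.mem_cons_of_mem _ hC)))
        (by
          intro x hx
          obtain ⟨C, hC, rfl⟩ := List.mem_map.mp hx
          exact hJ A List.mem_cons_self C (List.mem_cons_of_mem _ hC))
      rw [h2]
      refine ⟨hcup _ _ hA i1, ⟨cf A * K' - K, ?_⟩, X - lf A * K' + J + cf A * W, ?_⟩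
      · rw [List.map_cons, List.prod_cons]
        exact contr_cons (hc A hA) hK hK'
      · rw [List.map_cons, sumErase]
        have e : ((B :: l).map fun A => (cf A, lf A)).map Prod.fst = (B :: l).map cf := by
          simp [List.map_map, Function.comp_def]
        rw [e]
        exact lie_cons (hc A hA) (hl A hA) hX hK' hW hJ'

/-- Symmetrization of the sums in the Lie derivative of a cup polynomial. -/
theorem sum_sumErase {R : Type*} [Ring R] {l : ℕ} (c : (Fin (l + 1) → Fin n) → R)
    (hc : ∀ (π : Equiv.Perm (Fin (l + 1))) (J : Fin (l + 1) → Fin n), c (J ∘ π) = c J)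
    (x y : Fin n → R) :
    ∑ J, c J * sumErase (List.ofFn fun r => (x (J r), y (J r))) =
      ∑ j, ((l + 1) • ∑ J : Fin l → Fin n, c (Fin.snoc J j) *
        (List.ofFn fun r => x (J r)).prod) * y j := by
  have key : ∀ r : Fin (l + 1), ∑ J : Fin (l + 1) → Fin n,
      c J * ((List.ofFn fun s => x (J (r.succAbove s))).prod * y (J r)) =
      ∑ j, (∑ J : Fin l → Fin n, c (Fin.snoc J j) * (List.ofFn fun r => x (J r)).prod) * y j := by
    intro r
    -- The multi-index is recorded as its `r`-th entry `j` together with the remaining entries.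
    rw [← (Fin.insertNthEquiv (fun _ => Fin n) r).sum_comp, Fintype.sum_prod_type]
    refine Finset.sum_congr rfl fun j _ => ?_
    rw [Finset.sum_mul]
    refine Finset.sum_congr rfl fun J _ => ?_
    -- Moving position `r` to the end is a permutation, so by symmetry the coefficient does not
    -- depend on `r`. The sum over `r` then gives the factor `l + 1`.
    have hπ : r.insertNth j J = (Fin.snoc J j : Fin (l + 1) → Fin n) ∘
        ((finSuccEquiv' r).trans (finSuccEquiv' (Fin.last l)).symm) := by
      funext s
      refine Fin.succAboveCases r ?_ (fun s => ?_) s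
      · simp [finSuccEquiv'_symm_none]
      · simp [finSuccEquiv'_symm_some]
    simp only [Fin.insertNthEquiv_apply, Fin.insertNth_apply_same, Fin.insertNth_apply_succAbove]
    change c (r.insertNth j J) * _ = _
    rw [hπ, hc, mul_assoc]
  simp only [sumErase_ofFn, Finset.mul_sum]
  rw [Finset.sum_comm]
  simp only [key, Finset.sum_const, Finset.card_univ, Fintype.card_fin, Finset.smul_sum,
    smul_mul_assoc, Finset.sum_mul]

end Iterated

/-! ### The action of power series of endomorphisms -/

section Act

variable {k M : Type*} [Field k] [AddCommGroup M] [Module k M] {n : ℕ}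

theorem act_add (X Y : MvPowerSeries (Fin n) (Module.End k M)) : act (X + Y) = act X + act Y := by
  refine LinearMap.ext fun f => funext fun e => ?_
  exact Finset.sum_add_distrib (s := Finset.HasAntidiagonal.antidiagonal e)
    (f := fun p => X p.1 (f p.2)) (g := fun p => Y p.1 (f p.2))

theorem act_mul (X Y : MvPowerSeries (Fin n) (Module.End k M)) : act (X * Y) = act X * act Y := by
  refine LinearMap.ext fun f => ?_
  have h1 : X * Y = _ := ser_mul X Y
  have h2 : act (X * Y) f = conv₂ fun b c => conv₂ (fun x y => (X x * Y y) (f c)) b := by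
    rw [h1]
    funext e
    change ∑ p ∈ Finset.HasAntidiagonal.antidiagonal e,
      (∑ q ∈ Finset.HasAntidiagonal.antidiagonal p.1, X q.1 * Y q.2) (f p.2) = _
    simp only [LinearMap.sum_apply]
    rfl
  rw [h2, ← conv₃_eq fun x y c => (X x * Y y) (f c)]
  funext e
  exact Finset.sum_congr rfl fun p _ => (map_sum (X p.1) _ _).symm

/-- The action of power series of endomorphisms, as a ring homomorphism. -/
def actHom : MvPowerSeries (Fin n) (Module.End k M) →+* Module.End k (Series n M) where
  toFun X := act X
  map_one' := by
    refine LinearMap.ext fun f => funext fun e => ?_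
    change ∑ p ∈ Finset.HasAntidiagonal.antidiagonal e,
      (MvPowerSeries.coeff p.1 (1 : MvPowerSeries (Fin n) (Module.End k M))) (f p.2) = f e
    rw [Finset.sum_eq_single (0, e)]
    · simp
    · rintro ⟨a, b⟩ hp hne
      have ha : a ≠ 0 := by
        rintro rfl
        exact hne (by simpa using hp)
      simp [MvPowerSeries.coeff_one, ha]
    · simp
  map_mul' := act_mul
  map_zero' := by
    refine LinearMap.ext fun f => funext fun e => ?_
    exact Finset.sum_eq_zero fun _ _ => rfl
  map_add' := act_add

/-- A scalar power series, as a power series of endomorphisms. -/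
def serScal (M : Type*) [AddCommGroup M] [Module k M] (c : MvPowerSeries (Fin n) k) :
    MvPowerSeries (Fin n) (Module.End k M) :=
  ser fun e => MvPowerSeries.coeff e c • (1 : Module.End k M)

theorem serScal_comm (c : MvPowerSeries (Fin n) k) (X : MvPowerSeries (Fin n) (Module.End k M)) :
    serScal M c * X = X * serScal M c := by
  have h1 : serScal M c * X = _ := ser_mul (serScal M c) X
  have h2 : X * serScal M c = _ := ser_mul X (serScal M c)
  rw [h1, h2, conv₂_swap fun a b => X a * serScal M c b]
  congr 2
  funext a b
  refine LinearMap.ext fun x => ?_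
  exact (map_smul (X b) _ x).symm

end Act


/-! ### The homotopy for the cup polynomial. -/

section Homotopy

variable {k V : Type*} [Field k] [AddCommGroup V] [Module k V]
variable (𝒱 : ℤ → Submodule k V) [DirectSum.Decomposition 𝒱] {n : ℕ}

/-- The series of coefficients of `opV`. -/
def serV (m : Series n (Cochain k V)) (N : ℕ)
    (c : (l : ℕ) → (Fin (l + 1) → Fin n) → MvPowerSeries (Fin n) k) (j : Fin n) :
    MvPowerSeries (Fin n) (Module.End k (Chain k V)) :=
  ∑ l ∈ Finset.range N, (l + 1) • ∑ J : Fin l → Fin n, serScal (Chain k V) (c l (Fin.snoc J j)) *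
    (List.ofFn fun r => serContr 𝒱 m (pderiv (J r) m)).prod

theorem opV_eq (m : Series n (Cochain k V)) (N : ℕ)
    (c : (l : ℕ) → (Fin (l + 1) → Fin n) → MvPowerSeries (Fin n) k) (j : Fin n) :
    opV 𝒱 m N c j = act (serV 𝒱 m N c j) := by
  change _ = actHom _
  simp only [serV, map_sum, map_nsmul, map_mul, map_list_prod, List.map_ofFn]
  rfl

theorem serLie_sum {ι : Type*} (s : Finset ι) (f : ι → Series n (Cochain k V)) :
    serLie 𝒱 (∑ i ∈ s, f i) = ∑ i ∈ s, serLie 𝒱 (f i) :=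
  map_sum (AddMonoidHom.mk' (serLie 𝒱) fun A B => funext fun e => lie_add 𝒱 (A e) (B e)) f s

theorem serLie_scal (c : MvPowerSeries (Fin n) k) (A : Series n (Cochain k V)) :
    serLie 𝒱 (scal c A) = serScal (Chain k V) c * serLie 𝒱 A := by
  rw [serScal, serLie, serLie, ser_mul]
  refine congrArg ser ?_
  refine (conv₂_map (lie_add 𝒱) fun a b =>
    (MvPowerSeries.coeff a c • (1 : Module.End k (Cochain k V))) (A b)).trans ?_
  congr 1
  funext a b
  exact lie_smul 𝒱 _ _

theorem serLie_cupPoly (m : Series n (Cochain k V)) (N : ℕ)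
    (c : (l : ℕ) → (Fin (l + 1) → Fin n) → MvPowerSeries (Fin n) k) :
    serLie 𝒱 (cupPoly 𝒱 m N c) = ∑ l ∈ Finset.range N, ∑ J : Fin (l + 1) → Fin n,
      serScal (Chain k V) (c l J) *
        serLie 𝒱 (cupList 𝒱 m (List.ofFn fun r => pderiv (J r) m)) := by
  simp only [cupPoly, serLie_sum, serLie_scal]

theorem exists_of_comm {R ι : Type*} [Ring R] {L : MvPowerSeries (Fin n) R} (s : Finset ι)
    {x y z : ι → MvPowerSeries (Fin n) R}
    (h : ∀ i, ∃ W, x i = L * W - W * L + y i) (hz : ∀ i, z i * L = L * z i) :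
    ∃ W, ∑ i ∈ s, z i * x i = L * W - W * L + ∑ i ∈ s, z i * y i := by
  choose W hW using h
  refine ⟨∑ i ∈ s, z i * W i, ?_⟩
  rw [Finset.mul_sum, Finset.sum_mul, ← Finset.sum_sub_distrib, ← Finset.sum_add_distrib]
  refine Finset.sum_congr rfl fun i _ => ?_
  rw [hW]
  linear_combination (norm := noncomm_ring) hz i * W i

variable [CharZero k] {𝒱} {m : Series n (Cochain k V)} {τ : Fin n → ℤ}

theorem exists_serLie_cupList (hτ : ∀ i, Even (τ i)) (hm : IsFamily 𝒱 τ m)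
    (l : List (Fin n)) (hl : l ≠ []) :
    IsOddCocycle 𝒱 m (cupList 𝒱 m (l.map fun j => pderiv j m)) ∧
    ∃ W, serLie 𝒱 (cupList 𝒱 m (l.map fun j => pderiv j m)) =
      serLie 𝒱 m * W - W * serLie 𝒱 m +
        sumErase (l.map fun j => (serContr 𝒱 m (pderiv j m), serLie 𝒱 (pderiv j m))) := by
  have h0 := isOddCocycle_self hτ hm
  have hd := isOddCocycle_pderiv hτ hm
  obtain ⟨h1, -, h2⟩ := exists_cupList (L := serLie 𝒱 m) (lf := serLie 𝒱) (cf := serContr 𝒱 m)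
    (P := IsOddCocycle 𝒱 m) (cup := cupSeries 𝒱 m) (cl := cupList 𝒱 m) (fun _ => rfl)
    (fun _ _ _ => rfl) (fun A B hA hB => h0.cup hA hB) (fun A hA => serLie_anticomm h0 hA)
    (fun A hA => serLie_comm_serContr h0 hA) (fun A B hA hB => exists_serContr_cup h0 hA hB)
    (fun A B hA hB => exists_serLie_cup h0 hA hB) (l.map fun j => pderiv j m) (by
      intro A hA
      obtain ⟨j, -, rfl⟩ := List.mem_map.mp hA
      exact hd j) (by
      intro A hA B hB
      obtain ⟨i, -, rfl⟩ := List.mem_map.mp hA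
      obtain ⟨j, -, rfl⟩ := List.mem_map.mp hB
      exact exists_serLie_comm_serContr h0 (hd j) i) (by simpa using hl)
  refine ⟨h1, ?_⟩
  simpa [List.map_map, Function.comp_def] using h2

/-- Scalar series commute with `L_m`, so the homotopies of the monomials combine linearly, and
`sum_sumErase` collects the main terms into the operators `V^j`. Evenness of `W` is arranged later.
-/
theorem exists_homotopy (hτ : ∀ i, Even (τ i)) (hm : IsFamily 𝒱 τ m) (N : ℕ)
    (c : (l : ℕ) → (Fin (l + 1) → Fin n) → MvPowerSeries (Fin n) k)
    (hc : ∀ l (π : Equiv.Perm (Fin (l + 1))) (J : Fin (l + 1) → Fin n), c l (J ∘ π) = c l J) :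
    ∃ W, serLie 𝒱 (cupPoly 𝒱 m N c) = serLie 𝒱 m * W - W * serLie 𝒱 m +
      ∑ j, serV 𝒱 m N c j * serLie 𝒱 (pderiv j m) := by
  have h1 : ∀ l, ∃ W, ∑ J : Fin (l + 1) → Fin n, serScal (Chain k V) (c l J) *
        serLie 𝒱 (cupList 𝒱 m (List.ofFn fun r => pderiv (J r) m)) =
      serLie 𝒱 m * W - W * serLie 𝒱 m + ∑ J : Fin (l + 1) → Fin n, serScal (Chain k V) (c l J) *
        sumErase (List.ofFn fun r =>
          (serContr 𝒱 m (pderiv (J r) m), serLie 𝒱 (pderiv (J r) m))) := by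
    intro l
    refine exists_of_comm Finset.univ (fun J => ?_) fun J => serScal_comm _ _
    have := (exists_serLie_cupList hτ hm (List.ofFn J) (by simp)).2
    simpa [List.map_ofFn, Function.comp_def] using this
  obtain ⟨W, hW⟩ := exists_of_comm (z := fun _ => 1) (Finset.range N) h1 (fun _ => by simp)
  refine ⟨W, ?_⟩
  simp only [one_mul] at hW
  rw [serLie_cupPoly, hW]
  congr 1
  simp only [serV, Finset.sum_mul]
  rw [Finset.sum_comm]
  refine Finset.sum_congr rfl fun l _ => ?_
  exact sum_sumErase (fun J => serScal (Chain k V) (c l J)) (fun π J => by rw [hc])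
    (fun j => serContr 𝒱 m (pderiv j m)) (fun j => serLie 𝒱 (pderiv j m))

end Homotopy

/-! ### Parity -/

section ChainParity

variable {k V : Type*} [Field k] [AddCommGroup V] [Module k V] [CharZero k]
variable {𝒱 : ℤ → Submodule k V} [DirectSum.Decomposition 𝒱] {M A : Cochain k V}

theorem rot_comp_invChain :
    rot 𝒱 ∘ₗ invChain 𝒱 = tri (invT 𝒱) (invV 𝒱) (invT 𝒱) ∘ₗ rot 𝒱 := by
  refine chain_ext (𝒱 := 𝒱) fun a l => ?_
  simp only [LinearMap.comp_apply, invChain_word (invV_letter 𝒱 a), map_smul, rot_letter_word,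
    smul_splitSum, map_splitSum, TensorProduct.map_tmul, invT_word, invV_letter,
    ← TensorProduct.smul_tmul', TensorProduct.tmul_smul, smul_smul, ← pow_add]
  refine splitSum_congr fun x y h => ?_
  subst h
  rw [par_append]
  congr 2
  ring

theorem HasParity.markedInv_mul_markedLie (hA : HasParity 𝒱 1 A) :
    tri (invT 𝒱) (invV 𝒱) (invT 𝒱) * markedLie 𝒱 1 A =
      (-1 : k) • (markedLie 𝒱 1 A * tri (invT 𝒱) (invV 𝒱) (invT 𝒱)) := by
  have e := hA.markedEval_comp_tri_one
  refine LinearMap.ext fun x => ?_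
  simp only [markedLie_one, mul_add, add_mul, tri_mul_tri, tri_mul_theta, hA.invT_mul_coder_odd,
    theta_mul_tri _ _ _ _ (comult_invT (𝒱 := 𝒱)) (comult_invT (𝒱 := 𝒱)), tri_smul_left,
    tri_smul_right, mul_one, one_mul, List.map_cons, List.map_nil, List.sum_cons, List.sum_nil,
    add_zero, e, theta_smul, LinearMap.add_apply, LinearMap.smul_apply]
  module

theorem HasParity.invChain_mul_lie (hA : HasParity 𝒱 1 A) :
    invChain 𝒱 * lie 𝒱 A = (-1 : k) • (lie 𝒱 A * invChain 𝒱) := by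
  refine LinearMap.ext fun x => rot_injective 𝒱 ?_
  have h1 := LinearMap.congr_fun (rot_comp_invChain (𝒱 := 𝒱))
  have h2 := LinearMap.congr_fun hA.rot_lie
  have h3 := LinearMap.congr_fun hA.markedInv_mul_markedLie
  simp only [LinearMap.comp_apply, Module.End.mul_apply, LinearMap.smul_apply] at h1 h2 h3 ⊢
  rw [h1, h2, h3, map_smul, h2, h1]

theorem HasParity.markedInv_mul_markedIota (hM : HasParity 𝒱 1 M) (hA : HasParity 𝒱 1 A) :
    tri (invT 𝒱) (invV 𝒱) (invT 𝒱) * markedIota 𝒱 M A =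
      markedIota 𝒱 M A * tri (invT 𝒱) (invV 𝒱) (invT 𝒱) := by
  have e := hM.markedEval_markedLeft_comp_tri hA
  rw [pow_zero, one_smul] at e
  rw [hA.markedIota_eq]
  refine LinearMap.ext fun x => ?_
  simp only [tri_mul_theta,
    theta_mul_tri _ _ _ _ (comult_invT (𝒱 := 𝒱)) (comult_invT (𝒱 := 𝒱)),
    mul_one, one_mul, List.map_cons, List.map_nil, List.sum_cons, List.sum_nil,
    add_zero, e]

theorem HasParity.invChain_mul_contr (hM : HasParity 𝒱 1 M) (hA : HasParity 𝒱 1 A) :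
    invChain 𝒱 * contr 𝒱 M A = contr 𝒱 M A * invChain 𝒱 := by
  refine LinearMap.ext fun x => rot_injective 𝒱 ?_
  have h1 := LinearMap.congr_fun (rot_comp_invChain (𝒱 := 𝒱))
  have h2 := LinearMap.congr_fun (hM.rot_contr hA)
  have h3 := LinearMap.congr_fun (hM.markedInv_mul_markedIota hA)
  simp only [LinearMap.comp_apply, Module.End.mul_apply] at h1 h2 h3 ⊢
  rw [h1, h2, h3, h2, h1]

end ChainParity


/-! ### Making the homotopy even. -/

section Even

variable {k V : Type*} [Field k] [AddCommGroup V] [Module k V] [CharZero k]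
variable {𝒱 : ℤ → Submodule k V} [DirectSum.Decomposition 𝒱] {n : ℕ}
variable {m : Series n (Cochain k V)} {τ : Fin n → ℤ}

variable (𝒱 n) in
/-- The grading involution, as a constant power series. -/
def serInv : MvPowerSeries (Fin n) (Module.End k (Chain k V)) := MvPowerSeries.C (invChain 𝒱)

theorem serInv_mul_apply (X : MvPowerSeries (Fin n) (Module.End k (Chain k V)))
    (e : Fin n →₀ ℕ) : (serInv 𝒱 n * X) e = invChain 𝒱 * X e :=
  MvPowerSeries.coeff_C_mul e X (invChain 𝒱)

theorem mul_serInv_apply (X : MvPowerSeries (Fin n) (Module.End k (Chain k V)))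
    (e : Fin n →₀ ℕ) : (X * serInv 𝒱 n) e = X e * invChain 𝒱 :=
  MvPowerSeries.coeff_mul_C e X (invChain 𝒱)

theorem serInv_mul_serInv : serInv 𝒱 n * serInv 𝒱 n = 1 := by
  have h : invChain 𝒱 * invChain 𝒱 = 1 := invChain_mul_invChain 𝒱
  rw [serInv, ← map_mul]
  exact (congrArg _ h).trans (map_one _)

theorem serInv_mul_serLie {A : Series n (Cochain k V)} (hA : ∀ e, HasParity 𝒱 1 (A e)) :
    serInv 𝒱 n * serLie 𝒱 A = -(serLie 𝒱 A * serInv 𝒱 n) := by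
  funext e
  refine (serInv_mul_apply _ e).trans (((hA e).invChain_mul_lie).trans ?_)
  refine .trans ?_ (congrArg Neg.neg (mul_serInv_apply (serLie 𝒱 A) e).symm)
  exact neg_one_smul k (serLie 𝒱 A e * invChain 𝒱)

theorem serInv_commute_serContr {M A : Series n (Cochain k V)} (hM : ∀ e, HasParity 𝒱 1 (M e))
    (hA : ∀ e, HasParity 𝒱 1 (A e)) : Commute (serInv 𝒱 n) (serContr 𝒱 M A) := by
  funext e
  refine (serInv_mul_apply _ e).trans (.trans ?_ (mul_serInv_apply _ e).symm)
  have h : ∀ a b x, invChain 𝒱 (contr 𝒱 (M a) (A b) x) = contr 𝒱 (M a) (A b) (invChain 𝒱 x) :=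
    fun a b => LinearMap.congr_fun ((hM a).invChain_mul_contr (hA b))
  refine LinearMap.ext fun x => ?_
  simp only [serContr, ser, conv₂, Module.End.mul_apply, LinearMap.sum_apply, map_sum, h]

theorem commute_serV {X : MvPowerSeries (Fin n) (Module.End k (Chain k V))}
    (hX : ∀ j, Commute X (serContr 𝒱 m (pderiv j m))) (N : ℕ)
    (c : (l : ℕ) → (Fin (l + 1) → Fin n) → MvPowerSeries (Fin n) k) (j : Fin n) :
    Commute X (serV 𝒱 m N c j) := by
  have hs : ∀ c, Commute X (serScal (Chain k V) c) := fun c => (serScal_comm c X).symm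
  refine Commute.sum_right _ _ _ fun l _ => Commute.smul_right (Commute.sum_right _ _ _ fun J _ =>
    Commute.mul_right (hs _) (Commute.list_prod_right _ _ fun y hy => ?_)) _
  obtain ⟨r, rfl⟩ := List.mem_ofFn' _ _ |>.mp hy
  exact hX _

theorem anticomm_mul_of_commute {R : Type*} [Ring R] {s v x : MvPowerSeries (Fin n) R}
    (hv : s * v = v * s) (hx : s * x = -(x * s)) : s * (v * x) = -(v * x * s) := by
  linear_combination (norm := noncomm_ring) hv * x + v * hx

/-- Conjugation by the involution `s` changes the sign of the odd elements `P`, `L`, `Q`, so `s * W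
* s` solves the same equation as `W`; the two equations are added. -/
theorem even_identity {R : Type*} [Ring R] {s P L W Q : MvPowerSeries (Fin n) R} (hs : s * s = 1)
    (hP : s * P = -(P * s)) (hL : s * L = -(L * s)) (hQ : s * Q = -(Q * s))
    (h : P = L * W - W * L + Q) :
    P + P = L * (W + s * W * s) - (W + s * W * s) * L + (Q + Q) := by
  linear_combination (norm := noncomm_ring) h - s * h * s + hP * s - P * hs - hL * W * s +
    s * W * hL - hQ * s + Q * hs

theorem hasParity_scal {q : Fin 2} (c : MvPowerSeries (Fin n) k) {A : Series n (Cochain k V)}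
    (hA : ∀ e, HasParity 𝒱 q (A e)) (e : Fin n →₀ ℕ) : HasParity 𝒱 q (scal c A e) :=
  HasParity.sum _ (f := fun p : (Fin n →₀ ℕ) × (Fin n →₀ ℕ) =>
    (MvPowerSeries.coeff p.1 c • (1 : Module.End k (Cochain k V))) (A p.2)) fun p _ =>
    (hA p.2).smul _

theorem hasParity_cupPoly (hτ : ∀ i, Even (τ i)) (hm : IsFamily 𝒱 τ m) (N : ℕ)
    (c : (l : ℕ) → (Fin (l + 1) → Fin n) → MvPowerSeries (Fin n) k) (e : Fin n →₀ ℕ) :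
    HasParity 𝒱 1 (cupPoly 𝒱 m N c e) := by
  rw [cupPoly, Finset.sum_apply]
  refine HasParity.sum _ fun l _ => ?_
  rw [Finset.sum_apply]
  refine HasParity.sum _ fun J _ => hasParity_scal _ (fun e => ?_) e
  have := (exists_serLie_cupList hτ hm (List.ofFn J) (by simp)).1.odd e
  simpa [List.map_ofFn, Function.comp_def] using this

theorem exists_isHomotopy (hτ : ∀ i, Even (τ i)) (hm : IsFamily 𝒱 τ m) (N : ℕ)
    (c : (l : ℕ) → (Fin (l + 1) → Fin n) → MvPowerSeries (Fin n) k)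
    (hc : ∀ l (π : Equiv.Perm (Fin (l + 1))) (J : Fin (l + 1) → Fin n), c l (J ∘ π) = c l J) :
    ∃ W, IsHomotopy 𝒱 m N c W := by
  obtain ⟨W, hW⟩ := exists_homotopy hτ hm N c hc
  have h0 := isOddCocycle_self hτ hm
  have hd := isOddCocycle_pderiv hτ hm
  -- The even part of `W`: the average of `W` and its conjugate by the grading involution.
  let W' : MvPowerSeries (Fin n) (Module.End k (Chain k V)) :=
    ser fun e => (2⁻¹ : k) • ((W e : Module.End k (Chain k V)) + invChain 𝒱 * W e * invChain 𝒱)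
  have h2 : W' + W' = W + serInv 𝒱 n * W * serInv 𝒱 n := by
    funext e
    refine LinearMap.ext fun x => ?_
    have h3 : (serInv 𝒱 n * W * serInv 𝒱 n) e = invChain 𝒱 * W e * invChain 𝒱 :=
      (mul_serInv_apply _ e).trans (congrArg (· * invChain 𝒱) (serInv_mul_apply W e))
    change W' e x + W' e x = W e x + (serInv 𝒱 n * W * serInv 𝒱 n) e x
    rw [h3]
    simp only [W', ser, LinearMap.smul_apply, LinearMap.add_apply]
    rw [← two_smul k, smul_smul, mul_inv_cancel₀ two_ne_zero, one_smul]
  have hQ : serInv 𝒱 n * ∑ j, serV 𝒱 m N c j * serLie 𝒱 (pderiv j m) =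
      -((∑ j, serV 𝒱 m N c j * serLie 𝒱 (pderiv j m)) * serInv 𝒱 n) := by
    rw [Finset.mul_sum, Finset.sum_mul, ← Finset.sum_neg_distrib]
    refine Finset.sum_congr rfl fun j _ => ?_
    have h4 : serInv 𝒱 n * serV 𝒱 m N c j = serV 𝒱 m N c j * serInv 𝒱 n :=
      commute_serV (fun i => serInv_commute_serContr h0.odd (hd i).odd) N c j
    exact anticomm_mul_of_commute h4 (serInv_mul_serLie (hd j).odd)
  have h5 := even_identity serInv_mul_serInv (serInv_mul_serLie (hasParity_cupPoly hτ hm N c))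
    (serInv_mul_serLie h0.odd) hQ hW
  rw [← h2] at h5
  have h6 : serLie 𝒱 (cupPoly 𝒱 m N c) = serLie 𝒱 m * W' - W' * serLie 𝒱 m +
      ∑ j, serV 𝒱 m N c j * serLie 𝒱 (pderiv j m) := by
    refine sub_eq_zero.mp (eq_zero_of_add_self ?_)
    rw [mul_add, add_mul] at h5
    linear_combination (norm := abel) h5
  refine ⟨W', fun e => ?_, ?_⟩
  · have h7 := invChain_invChain (k := k) 𝒱
    refine LinearMap.ext fun x => ?_
    simp only [W', ser, Module.End.mul_apply, LinearMap.smul_apply, LinearMap.add_apply, map_smul,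
      map_add, h7]
    rw [add_comm]
  · have h8 := congrArg (actHom (k := k) (M := Chain k V) (n := n)) h6
    simp only [map_add, map_sub, map_mul, map_sum] at h8
    simp only [opV_eq]
    exact h8

end Even


/-! ### Lie derivatives along a primitive `U` of `Ψ`. -/

section Exactness

theorem ser_comm_of_comm {n : ℕ} {R : Type*} [Ring R] {f g : Series n R}
    {H : (Fin n →₀ ℕ) → (Fin n →₀ ℕ) → R} (h : ∀ a b, f a * g b - g b * f a = H a b) :
    ser f * ser g - ser g * ser f = ser (conv₂ H) := by
  rw [ser_mul, ser_mul g, conv₂_swap (fun a b => g a * f b), ← ser_sub, conv₂_sub]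
  simp only [h]

theorem ser_anticomm_of_anticomm {n : ℕ} {R : Type*} [Ring R] {f g : Series n R}
    {H : (Fin n →₀ ℕ) → (Fin n →₀ ℕ) → R} (h : ∀ a b, f a * g b + g b * f a = H a b) :
    ser f * ser g + ser g * ser f = ser (conv₂ H) := by
  rw [ser_mul_add_mul]
  simp only [h]

variable {k V : Type*} [Field k] [AddCommGroup V] [Module k V] [CharZero k]
variable {𝒱 : ℤ → Submodule k V} [DirectSum.Decomposition 𝒱] {n : ℕ}
variable {m U : Series n (Cochain k V)} {τ : Fin n → ℤ}

theorem HasParity.lie_bracket_apply {p q : Fin 2} {A B : Cochain k V} (hA : HasParity 𝒱 p A)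
    (hB : HasParity 𝒱 q B) (x : Chain k V) :
    lie 𝒱 A (lie 𝒱 B x) - (-1 : k) ^ ((p : ℕ) * q) • lie 𝒱 B (lie 𝒱 A x) =
      lie 𝒱 (AInfinity.bracket 𝒱 A B) x := by
  have hA' := LinearMap.congr_fun hA.rot_lie
  have hB' := LinearMap.congr_fun hB.rot_lie
  have hAB := LinearMap.congr_fun (hA.bracket hB).rot_lie x
  have h := LinearMap.congr_fun (hA.markedLie_bracket hB) (rot 𝒱 x)
  simp only [LinearMap.comp_apply, LinearMap.sub_apply, LinearMap.smul_apply,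
    Module.End.mul_apply] at hA' hB' hAB h
  refine rot_injective 𝒱 ?_
  rw [map_sub, map_smul, hA', hB', hB', hA', hAB, h]

theorem serLie_comm_of_even (hm : ∀ e, HasParity 𝒱 1 (m e)) (hU : ∀ e, HasParity 𝒱 0 (U e)) :
    serLie 𝒱 m * serLie 𝒱 U - serLie 𝒱 U * serLie 𝒱 m = serLie 𝒱 (delta 𝒱 m U) := by
  refine (ser_comm_of_comm fun a b => LinearMap.ext fun x => ?_).trans (congrArg ser
    (conv₂_map (lie_add 𝒱) fun a b => bracket 𝒱 (m a) (U b)).symm)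
  have h := (hm a).lie_bracket_apply (hU b) x
  simp only [Fin.val_zero, mul_zero, pow_zero, one_smul] at h
  exact h

theorem serLie_anticomm_of_odd (hm : ∀ e, HasParity 𝒱 1 (m e)) (hU : ∀ e, HasParity 𝒱 1 (U e)) :
    serLie 𝒱 m * serLie 𝒱 U + serLie 𝒱 U * serLie 𝒱 m = serLie 𝒱 (delta 𝒱 m U) := by
  refine (ser_anticomm_of_anticomm fun a b => LinearMap.ext fun x => ?_).trans (congrArg ser
    (conv₂_map (lie_add 𝒱) fun a b => bracket 𝒱 (m a) (U b)).symm)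
  have h := (hm a).lie_bracket_apply (hU b) x
  simp only [Fin.val_one, mul_one, pow_one, neg_one_smul, sub_neg_eq_add] at h
  exact h

theorem HasParity.eq_zero {A : Cochain k V} (h0 : HasParity 𝒱 0 A) (h1 : HasParity 𝒱 1 A) :
    A = 0 := by
  have h := h0.part_eq 0
  rw [h1.part_eq 0] at h
  simpa using h.symm

/-- No parity is assumed of `U`. Its even part is already a primitive of the odd `Ψ` and yields `u`;
its odd part is a cocycle and yields `v`, which anticommutes with `L_m`. -/
theorem exists_serLie_eq_comm (hτ : ∀ i, Even (τ i)) (hm : IsFamily 𝒱 τ m)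
    {Ψ : Series n (Cochain k V)}
    (hΨ : ∀ e, HasParity 𝒱 1 (Ψ e)) (hU : Ψ = delta 𝒱 m U) :
    ∃ u v, serLie 𝒱 U = u + v ∧ serLie 𝒱 Ψ = serLie 𝒱 m * u - u * serLie 𝒱 m ∧
      serLie 𝒱 m * v + v * serLie 𝒱 m = 0 := by
  have hodd := (isOddCocycle_self hτ hm).odd
  obtain ⟨U₀, hU₀⟩ : ∃ U₀ : Series n (Cochain k V), ∀ e, U₀ e = part 𝒱 0 (U e) :=
    ⟨_, fun _ => rfl⟩
  obtain ⟨U₁, hU₁⟩ : ∃ U₁ : Series n (Cochain k V), ∀ e, U₁ e = part 𝒱 1 (U e) :=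
    ⟨_, fun _ => rfl⟩
  have p₀ : ∀ e, HasParity 𝒱 0 (U₀ e) := fun e => hU₀ e ▸ hasParity_part 𝒱 0 (U e)
  have p₁ : ∀ e, HasParity 𝒱 1 (U₁ e) := fun e => hU₁ e ▸ hasParity_part 𝒱 1 (U e)
  have hsum : U = U₀ + U₁ := by
    funext e
    rw [Pi.add_apply, hU₀, hU₁, part_add_part]
  have hd : Ψ = delta 𝒱 m U₀ + delta 𝒱 m U₁ := by
    rw [hU, hsum]
    simp only [delta, convol_eq_conv₂, conv₂_add, Pi.add_apply, bracket_add_right]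
  -- This cochain is even, since `δ` reverses parity, and it is also odd as the difference of `Ψ`
  -- and `δU₀`.
  have h1 : delta 𝒱 m U₁ = 0 := by
    funext e
    refine HasParity.eq_zero (hasParity_delta hodd p₁ e) ?_
    have h2 : delta 𝒱 m U₁ e = Ψ e + (-1 : k) • delta 𝒱 m U₀ e := by
      rw [hd, Pi.add_apply]
      module
    rw [h2]
    exact (hΨ e).add ((hasParity_delta hodd p₀ e).smul _)
  have h3 : Ψ = delta 𝒱 m U₀ := by rw [hd, h1, add_zero]
  refine ⟨serLie 𝒱 U₀, serLie 𝒱 U₁, ?_, ?_, ?_⟩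
  · rw [hsum]
    exact congrArg ser (funext fun e => lie_add 𝒱 (U₀ e) (U₁ e))
  · rw [h3]
    exact (serLie_comm_of_even hodd p₀).symm
  · rw [serLie_anticomm_of_odd hodd p₁, h1]
    refine congrArg ser (funext fun e => ?_)
    have := lie_smul 𝒱 (0 : k) (0 : Cochain k V)
    rwa [zero_smul, zero_smul] at this

end Exactness

/-! ### The induced map on homology. -/

section Descent

variable {k M : Type*} [Field k] [AddCommGroup M] [Module k M] {n : ℕ}

theorem pderiv_act (j : Fin n) (X : Series n (Module.End k M)) (f : Series n M) :
    pderiv j (act X f) = act (pderiv j X) f + act X (pderiv j f) :=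
  pderiv_convol (op := fun (F : Module.End k M) x => F x) (fun _ _ _ => rfl)
    (fun F _ _ => map_add F _ _) j X f

variable (k M) in
/-- Differentiation with respect to `tⱼ` as a linear map. -/
def pderivₗ (j : Fin n) : Module.End k (Series n M) where
  toFun := pderiv j
  map_add' _ _ := funext fun _ => smul_add _ _ _
  map_smul' r _ := funext fun _ => smul_comm _ r _

/-- The second hypothesis only asks that boundaries go to boundaries, not that `H` commutes with
`D`; this leaves room for the odd part of `U`. -/
theorem existsUnique_homology_map {A : Type*} [AddCommGroup A] [Module k A] {D H : Module.End k A}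
    (hker : ∀ x, D x = 0 → D (H x) = 0) (hrange : ∀ y, ∃ z, H (D y) = D z) :
    ∃! h : LinearMap.ker D ⧸ (LinearMap.range D).submoduleOf (LinearMap.ker D) →ₗ[k]
        LinearMap.ker D ⧸ (LinearMap.range D).submoduleOf (LinearMap.ker D),
      ∀ x : LinearMap.ker D, ∃ hx : H x ∈ LinearMap.ker D,
        h (Submodule.Quotient.mk x) = Submodule.Quotient.mk ⟨H x, hx⟩ := by
  refine ⟨Submodule.mapQ _ _ (H.restrict (p := LinearMap.ker D) (q := LinearMap.ker D) hker) ?_,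
    fun x => ⟨hker x x.2, rfl⟩, fun h hh => ?_⟩
  · rintro ⟨x, hx⟩ ⟨y, hy⟩
    obtain ⟨z, hz⟩ := hrange y
    refine ⟨z, hz.symm.trans ?_⟩
    rw [hy]
    rfl
  · refine LinearMap.ext fun q => ?_
    obtain ⟨x, rfl⟩ := Submodule.Quotient.mk_surjective _ q
    obtain ⟨hx, e⟩ := hh x
    exact e

variable {A : Type*} [AddCommGroup A] [Module k A] {D W u v P : Module.End k A}
  {X Y d : Fin n → Module.End k A}

/-- On a cycle `x`, differentiating `D x = 0` gives `D (d j x) = -Y j x`. The terms `X j * Y j` thus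
produced cancel against `[D, W]` and `[D, u]`, while `D (v x) = -v (D x) = 0`. -/
theorem deformed_ker (hW : P = D * W - W * D + ∑ j, X j * Y j) (hu : P = D * u - u * D)
    (hv : D * v + v * D = 0) (hX : ∀ j, Commute D (X j))
    (hd : ∀ j x, d j (D x) = Y j x + D (d j x)) {x : A} (hx : D x = 0) :
    D ((W - (u + v) - ∑ j, X j * d j) x) = 0 := by
  have hW' := LinearMap.congr_fun (hW.symm.trans hu) x
  have hv' := LinearMap.congr_fun hv x
  have hX' : ∀ j y, D (X j y) = X j (D y) := fun j => LinearMap.congr_fun (hX j).eq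
  have hd' : ∀ j, D (d j x) = -Y j x := fun j => by
    have := hd j x
    rw [hx, map_zero] at this
    exact (neg_eq_of_add_eq_zero_right this.symm).symm
  simp only [LinearMap.add_apply, LinearMap.sub_apply, Module.End.mul_apply, LinearMap.sum_apply,
    LinearMap.zero_apply, hx, map_zero, sub_zero, add_zero, map_sub, map_add, map_sum, hX', hd',
    map_neg, Finset.sum_neg_distrib] at hW' hv' ⊢
  rw [hv', ← hW']
  abel

/-- All summands but `v` can be carried past `D` together, by the equation for `W`. The summand `v`
anticommutes with `D`, which is why its sign is reversed on the right. -/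
theorem deformed_range (hW : P = D * W - W * D + ∑ j, X j * Y j) (hu : P = D * u - u * D)
    (hv : D * v + v * D = 0) (hX : ∀ j, Commute D (X j))
    (hd : ∀ j x, d j (D x) = Y j x + D (d j x)) (y : A) :
    (W - (u + v) - ∑ j, X j * d j) (D y) = D ((W - u + v - ∑ j, X j * d j) y) := by
  have hW' := LinearMap.congr_fun (hW.symm.trans hu) y
  have hv' := LinearMap.congr_fun hv y
  have hX' : ∀ j y, D (X j y) = X j (D y) := fun j => LinearMap.congr_fun (hX j).eq
  simp only [LinearMap.add_apply, LinearMap.sub_apply, Module.End.mul_apply, LinearMap.sum_apply,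
    LinearMap.zero_apply, map_sub, map_add, map_sum, hX', hd, Finset.sum_add_distrib]
    at hW' hv' ⊢
  linear_combination (norm := abel) -hW' - hv'

end Descent

end AInfinity

end

open AInfinity in
theorem theorem7p2 {k V : Type*} [Field k] [CharZero k] [AddCommGroup V] [Module k V]
    (𝒱 : ℤ → Submodule k V) [DirectSum.Decomposition 𝒱]
    {n : ℕ} (τ : Fin n → ℤ) (hτ : ∀ i, Even (τ i))
    (m : Series n (Cochain k V)) (hm : IsFamily 𝒱 τ m)
    (N : ℕ) (c : (l : ℕ) → (Fin (l + 1) → Fin n) → MvPowerSeries (Fin n) k)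
    (hc : ∀ l (π : Equiv.Perm (Fin (l + 1))) (J : Fin (l + 1) → Fin n), c l (J ∘ π) = c l J) :
    (∃ W : Series n (Module.End k (Chain k V)), IsHomotopy 𝒱 m N c W) ∧
    ∀ W : Series n (Module.End k (Chain k V)), IsHomotopy 𝒱 m N c W →
      ∀ U : Series n (Cochain k V), cupPoly 𝒱 m N c = delta 𝒱 m U →
        ∃! h : HH 𝒱 m →ₗ[k] HH 𝒱 m,
          ∀ α : LinearMap.ker (lieSeries 𝒱 m),
            ∃ hα : hChain 𝒱 m N c W U α ∈ LinearMap.ker (lieSeries 𝒱 m),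
              h (Submodule.Quotient.mk α) = Submodule.Quotient.mk ⟨hChain 𝒱 m N c W U α, hα⟩ := by
  refine ⟨exists_isHomotopy hτ hm N c hc, fun W hW U hU => ?_⟩
  have h0 := isOddCocycle_self hτ hm
  obtain ⟨u, v, huv, hu, hv⟩ := exists_serLie_eq_comm hτ hm (hasParity_cupPoly hτ hm N c) hU
  have hu' := congrArg (actHom (k := k) (M := Chain k V) (n := n)) hu
  have hv' := congrArg (actHom (k := k) (M := Chain k V) (n := n)) hv
  have huv' := congrArg (actHom (k := k) (M := Chain k V) (n := n)) huv
  simp only [map_add, map_sub, map_mul, map_zero] at hu' hv' huv'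
  -- `V^j` is built from scalars and contractions `i_{m_(i)}`, all of which commute with `L_m`.
  have hX : ∀ j, Commute (lieSeries 𝒱 m) (opV 𝒱 m N c j) := fun j => by
    rw [opV_eq]
    exact (commute_serV (fun i => serLie_comm_serContr h0 (isOddCocycle_pderiv hτ hm i)) N c j).map
      actHom
  have hd : ∀ j x, pderivₗ k (Chain k V) j (lieSeries 𝒱 m x) =
      lieSeries 𝒱 (pderiv j m) x + lieSeries 𝒱 m (pderivₗ k (Chain k V) j x) := fun j x =>
    (pderiv_act j (fun e => lie 𝒱 (m e)) x).trans
      (congrArg (fun X => act X x + lieSeries 𝒱 m (pderiv j x)) (serLie_pderiv j m).symm)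
  -- The chain is rewritten as the value of one `k`-linear operator, with `L_U` split as `u + v`.
  -- Differentiation is not linear over power series, so only `k`-linearity is available.
  have hH : ∀ α, hChain 𝒱 m N c W U α = (act W - (actHom u + actHom v) -
      ∑ j, opV 𝒱 m N c j * pderivₗ k (Chain k V) j) α := fun α => by
    rw [← huv']
    simp only [hChain, LinearMap.sub_apply, LinearMap.sum_apply, Module.End.mul_apply]
    rfl
  simp only [hH]
  exact existsUnique_homology_map (fun x hx => deformed_ker hW.eq hu' hv' hX hd hx)
    (fun y => ⟨_, deformed_range hW.eq hu' hv' hX hd y⟩)
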